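/- Let $\mathbb K$ be $\mathbb R$ or $\mathbb C$, let $\mathcal U\subset\mathbb R^u$ be a connected open set, let $F=\mathcal U\times\mathbb K^n$ carry the standard Euclidean/Hermitian structure on each fibre, and let $L:\mathcal U\to \mathrm{End}_{\mathbb K}(\mathbb K^n)$ be real analytic, each $L(x)$ being normal (and symmetric if $\mathbb K=\mathbb R$). Let $s(x)$ be the number of distinct eigenvalues of $L(x)$, $s_L=\max_{\mathcal U} s$, and $D_L=\{x\in\mathcal U: s(x)<s_L\}$. Let $H_2$ be the space of quadratic forms on $\mathbb K^n$, let $Q_{i,j}(x)\in H_2$ ($i<j$) be the components $v\mapsto (L(x)v)_iv_j-(L(x)v)_jv_i$ of $v\mapsto L(x)v\wedge v$, let $J_{x,2}\subset H_2$ be the space of quadratic forms vanishing on all eigenspaces of $L(x)$, and let $d_L$ be the constant value of $\dim J_{x,2}$ on $\mathcal U\setminus D_L$. Let $\mathcal O$ be the sheaf of $\mathbb K$-valued real analytic functions on $\mathcal U$, let $\mathcal M_L$ be the $\mathcal O$-module of sections of $\mathcal U\times\Lambda^{d_L}H_2$ generated by the $d_L$-fold wedge products of the $Q_{i,j}$,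 and let $\mathcal F_L\subset\mathcal O$ be its ideal of coefficients, i.e. the ideal generated by the $d_L\times d_L$ minors of the matrix of coefficients of the $Q_{i,j}$. Assume that $L$ is not a multiple of the identity (i.e. not every $L(x)$, $x\in\mathcal U$, is scalar) and that $\mathcal F_L$ is (locally) principal. Let $\mathcal M_L'=\mathcal F_L^{-1}\mathcal M_L$ (the sections $w$ of $\mathcal U\times\Lambda^{d_L}H_2$ with $\mathcal F_L w\subset\mathcal M_L$), let $J'_{y,2}=\{P\in H_2: P\wedge w(y)=0\text{ for all }w\in\mathcal M'_{L,y}\}$ for $y\in\mathcal U$, and let the reduced eigen-bouquet bundle $EV_L'\subset \mathcal U\times(\mathbb K^n\setminus 0)$ have as its fibre at $y$ the set of nonzero common zeros of $J'_{y,2}$. Then: (i) There are integers $1\le e_1\le\dots\le e_{s_L}$ which are, for every $x\in\mathcal U\setminus D_L$, the dimensions of the eigenspaces of $L(x)$ up to order, such that for every simply connected open $V\subset\mathcal U$ (for instance any ball in $\mathcal U$, and $\mathcal U$ itself if it is simply connected) the set $\mathbb P EV_L'|_V\subset V\times\mathbb P(\mathbb K^n)$ has exactly $s_L$ connected components $\mathcal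 P_1,\dots,\mathcal P_{s_L}$. Each $\mathcal P_i$ is a real analytic submanifold of $V\times\mathbb P(\mathbb K^n)$ of real dimension $u+(e_i-1)\dim_{\mathbb R}\mathbb K$, the projection $\mathcal P_i\to V$ is a submersion, $\mathcal P_i$ is a real analytic sub-bundle of $V\times\mathbb P(\mathbb K^n)$ with linearly embedded fibre $\mathbb P(\mathbb K^{e_i})$, and its cone $\mathcal E_i=\mathrm{Cone}(\mathcal P_i)$ is a real analytic vector sub-bundle of $F|_V$ of rank $e_i$. The $\mathcal E_i$ are pairwise orthogonal, and each fibre $\mathcal E_{i,x}$ is contained in an eigenspace of $L(x)$ and is equal to it when $x\notin D_L$. (ii) Every $y\in\mathcal U$ has a neighbourhood over which there are $n$ real analytic sections of $F$ which form at every point $x$ an orthonormal/unitary basis of $\mathbb K^n$ consisting of eigenvectors of $L(x)$. (iii) Every $y\in\mathcal U$ has a neighbourhood over which there are $n$ real analytic $\mathbb K$-valued functions which are at every point $x$ the eigenvalues of $L(x)$, counted with multiplicity. -/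

import Mathlib

open Set Filter Topology
open scoped LinearAlgebra.Projectivization

namespace EigenBouquet

noncomputable section

/-! ### The trivial bundle `𝒰 × 𝕜ⁿ` over an open subset of `ℝᵘ`, and its projective bundle -/

/-- The parameter space `ℝᵘ`. -/
abbrev Base (u : ℕ) : Type := EuclideanSpace ℝ (Fin u)

/-- The fibre `𝕜ⁿ` with its standard Euclidean / Hermitian structure. -/
abbrev Fib (𝕜 : Type*) [RCLike 𝕜] (n : ℕ) : Type _ := EuclideanSpace 𝕜 (Fin n)

/-- A projective space carries the quotient topology from the pointed vector space. -/
instance projTopology (𝕜 : Type*) [RCLike 𝕜] (n : ℕ) : TopologicalSpace (ℙ 𝕜 (Fib 𝕜 n)) :=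
  TopologicalSpace.coinduced
    (fun v : {v : Fib 𝕜 n // v ≠ 0} => Projectivization.mk 𝕜 v.1 v.2) inferInstance

/-- The total space of the projective bundle of the trivial bundle `ℝᵘ × 𝕜ⁿ`. -/
abbrev ProjTotal (𝕜 : Type*) [RCLike 𝕜] (u n : ℕ) : Type _ := Base u × ℙ 𝕜 (Fib 𝕜 n)

/-! ### Analytic submanifolds, submersions, sub-bundles -/

section Submanifolds

variable {X : Type*} [NormedAddCommGroup X] [NormedSpace ℝ X]

/-- `S` is an (embedded) real analytic submanifold of dimension `m` of the normed space `X`: near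
each of its points an analytic diffeomorphism between open sets carries it to a linear subspace of
dimension `m`. -/
def IsAnalyticSubmanifold (S : Set X) (m : ℕ) : Prop :=
  ∀ p ∈ S, ∃ Φ : OpenPartialHomeomorph X X, p ∈ Φ.source ∧
    AnalyticOnNhd ℝ Φ Φ.source ∧ AnalyticOnNhd ℝ Φ.symm Φ.target ∧
    ∃ T : Submodule ℝ X, Module.finrank ℝ T = m ∧ ∀ q ∈ Φ.source, (q ∈ S ↔ Φ q ∈ T)

/-- The tangent vectors to `S` at `p`: the velocities at `p` of the analytic arcs in `S`. -/
def tangentVectors (S : Set X) (p : X) : Set X :=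
  {ξ | ∃ γ : ℝ → X, AnalyticAt ℝ γ 0 ∧ γ 0 = p ∧ (∀ᶠ t in 𝓝 0, γ t ∈ S) ∧ HasDerivAt γ ξ 0}

end Submanifolds

variable {𝕜 : Type*} [RCLike 𝕜] {u n : ℕ}

/-- Inverse of the `k`-th standard affine chart of `ℝᵘ × ℙ(𝕜ⁿ)`: to `(x, a)` it associates `x` and
the line of the vector with `k`-th coordinate `1` and other coordinates `a`. -/
def affineChart (k : Fin n) (p : Base u × ({j : Fin n // j ≠ k} → 𝕜)) : ProjTotal 𝕜 u n :=
  (p.1, Projectivization.mk 𝕜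
    (WithLp.toLp 2 (fun j => if h : j = k then (1 : 𝕜) else p.2 ⟨j, h⟩) : Fib 𝕜 n)
    (fun h0 => one_ne_zero (α := 𝕜) (by simpa using congrArg (fun v : Fib 𝕜 n => v k) h0)))

/-- `S` is a real analytic submanifold of `ℝᵘ × ℙ(𝕜ⁿ)` of (real) dimension `m`: it is one in each
of the standard affine charts. -/
def IsAnalyticSubmanifoldProj (S : Set (ProjTotal 𝕜 u n)) (m : ℕ) : Prop :=
  ∀ k : Fin n, IsAnalyticSubmanifold (affineChart k ⁻¹' S) m

/-- The projection to `ℝᵘ` restricts to a submersion on the submanifold `S` of `ℝᵘ × ℙ(𝕜ⁿ)`. -/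
def IsSubmersionToBase (S : Set (ProjTotal 𝕜 u n)) : Prop :=
  ∀ k : Fin n, ∀ p ∈ affineChart k ⁻¹' S,
    Prod.fst '' tangentVectors (affineChart k ⁻¹' S) p = (univ : Set (Base u))

/-- `Z` is a real analytic sub-bundle of `V × ℙ(𝕜ⁿ)` with fibre the linearly embedded projective
space `ℙ(𝕜ᵉ)`: every point of `V` has a neighbourhood `W` over which `Z` is the image of
`W × ℙ(𝕜ᵉ)` under a real analytic family of linear embeddings. -/
def IsProjSubbundle (V : Set (Base u)) (Z : Set (ProjTotal 𝕜 u n)) (e : ℕ) : Prop :=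
  (∀ p ∈ Z, p.1 ∈ V) ∧
  ∀ y ∈ V, ∃ W : Set (Base u), IsOpen W ∧ y ∈ W ∧ W ⊆ V ∧
    ∃ A : Base u → (Fib 𝕜 e →L[𝕜] Fib 𝕜 n), AnalyticOnNhd ℝ A W ∧
      ∀ x ∈ W, ∃ hA : Function.Injective (A x : Fib 𝕜 e →ₗ[𝕜] Fib 𝕜 n),
        {l | (x, l) ∈ Z} = range (Projectivization.map (A x : Fib 𝕜 e →ₗ[𝕜] Fib 𝕜 n) hA)

/-- `C` is a real analytic vector sub-bundle of rank `e` of `V × 𝕜ⁿ`: locally over `V` its fibres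
have a frame of `e` real analytic sections. -/
def IsVectorSubbundle (V : Set (Base u)) (C : Set (Base u × Fib 𝕜 n)) (e : ℕ) : Prop :=
  (∀ p ∈ C, p.1 ∈ V) ∧
  ∀ y ∈ V, ∃ W : Set (Base u), IsOpen W ∧ y ∈ W ∧ W ⊆ V ∧
    ∃ b : Fin e → Base u → Fib 𝕜 n, (∀ i, AnalyticOnNhd ℝ (b i) W) ∧
      ∀ x ∈ W, LinearIndependent 𝕜 (fun i => b i x) ∧
        {v | (x, v) ∈ C} = (Submodule.span 𝕜 (range fun i => b i x) : Set (Fib 𝕜 n))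

/-- The cone bundle over a subset of the projective bundle. -/
def cone (Z : Set (ProjTotal 𝕜 u n)) : Set (Base u × Fib 𝕜 n) :=
  {p | ∃ l : ℙ 𝕜 (Fib 𝕜 n), (p.1, l) ∈ Z ∧ p.2 ∈ l.submodule}

/-! ### Eigen-bouquets and the discriminant locus -/

/-- A family of operators on `𝕜ⁿ`, parametrized by `ℝᵘ`. -/
abbrev OpFamily (𝕜 : Type*) [RCLike 𝕜] (u n : ℕ) : Type _ := Base u → (Fib 𝕜 n →L[𝕜] Fib 𝕜 n)

/-- The operator `L(x)` as an algebraic endomorphism of `𝕜ⁿ`. -/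
abbrev endo (L : OpFamily 𝕜 u n) (x : Base u) : Module.End 𝕜 (Fib 𝕜 n) :=
  (L x : Fib 𝕜 n →ₗ[𝕜] Fib 𝕜 n)

/-- The pointed eigen-bouquet of `L(x)`: the union of the pointed eigen-spaces. -/
def EV (L : OpFamily 𝕜 u n) (x : Base u) : Set (Fib 𝕜 n) :=
  {v | ∃ μ : 𝕜, (endo L x).HasEigenvector μ v}

/-- The number `s(x)` of distinct eigen-spaces of `L(x)`. -/
def numEig (L : OpFamily 𝕜 u n) (x : Base u) : ℕ := {μ : 𝕜 | (endo L x).HasEigenvalue μ}.ncard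

/-- `s_L`, the maximum of `s(x)` over `U`. -/
def sMax (U : Set (Base u)) (L : OpFamily 𝕜 u n) : ℕ := sSup (numEig L '' U)

/-- The discriminant locus `D_L`. -/
def discLocus (U : Set (Base u)) (L : OpFamily 𝕜 u n) : Set (Base u) :=
  {y ∈ U | numEig L y < sMax U L}

/-- The eigen-spaces of `L(x)` have dimensions `e 0, …, e (s - 1)`, up to the order. -/
def HasEigDims (L : OpFamily 𝕜 u n) (x : Base u) {s : ℕ} (e : Fin s → ℕ) : Prop :=
  ∃ σ : Fin s ≃ {μ : 𝕜 // (endo L x).HasEigenvalue μ},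
    ∀ i, Module.finrank 𝕜 ((endo L x).eigenspace (σ i)) = e i

/-! ### Quadratic polynomials vanishing along the eigen-bouquet -/

/-- The space of quadratic forms in `n` variables (`S²` of the dual of `𝕜ⁿ`). -/
abbrev Quad (𝕜 : Type*) [RCLike 𝕜] (n : ℕ) : Type _ :=
  MvPolynomial.homogeneousSubmodule (Fin n) 𝕜 2

/-- The linear form `v ↦ (L(x) v)_i`. -/
def rowForm (L : OpFamily 𝕜 u n) (x : Base u) (i : Fin n) : MvPolynomial (Fin n) 𝕜 :=
  ∑ k, MvPolynomial.C (L x (EuclideanSpace.single k 1) i) * MvPolynomial.X k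

theorem rowForm_isHomogeneous (L : OpFamily 𝕜 u n) (x : Base u) (i : Fin n) :
    (rowForm L x i).IsHomogeneous 1 :=
  MvPolynomial.IsHomogeneous.sum _ _ _ fun k _ => by
    simpa using (MvPolynomial.isHomogeneous_C (Fin n) _).mul (MvPolynomial.isHomogeneous_X 𝕜 k)

/-- The components `Q_{i,j}(x)(v) = (L(x) v)_i v_j - (L(x) v)_j v_i` of `v ↦ L(x) v ∧ v`. -/
def Q (L : OpFamily 𝕜 u n) (ij : {p : Fin n × Fin n // p.1 < p.2}) (x : Base u) : Quad 𝕜 n :=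
  ⟨rowForm L x ij.1.1 * MvPolynomial.X ij.1.2 - rowForm L x ij.1.2 * MvPolynomial.X ij.1.1,
    sub_mem
      ((rowForm_isHomogeneous L x ij.1.1).mul (MvPolynomial.isHomogeneous_X 𝕜 ij.1.2))
      ((rowForm_isHomogeneous L x ij.1.2).mul (MvPolynomial.isHomogeneous_X 𝕜 ij.1.1))⟩

/-- `J_{x,2}`: the quadratic polynomials vanishing along the eigen-bouquet of `L(x)`. -/
def J₂ (L : OpFamily 𝕜 u n) (x : Base u) : Submodule 𝕜 (Quad 𝕜 n) where
  carrier := {P | ∀ v ∈ EV L x, MvPolynomial.eval (fun i => v i) (P : MvPolynomial (Fin n) 𝕜) = 0}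
  add_mem' := fun ha hb v hv => by simp [ha v hv, hb v hv]
  zero_mem' := fun v _ => by simp
  smul_mem' := fun c P hP v hv => by simp [MvPolynomial.smul_eval, hP v hv]

/-- `d_L`, the (constant) dimension of `J_{x,2}` for `x` outside of the discriminant locus. -/
def dGen (U : Set (Base u)) (L : OpFamily 𝕜 u n) : ℕ :=
  sSup ((fun x => Module.finrank 𝕜 (J₂ L x)) '' (U \ discLocus U L))

/-! ### The Fitting ideal, the module `ℳ_L`, and its weak transform, stalk by stalk -/

/-- The stalk at `y` of the sheaf of `𝕜`-valued real analytic functions. -/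
def Ostalk (𝕜 : Type*) [RCLike 𝕜] {u : ℕ} (y : Base u) : Subring (Germ (𝓝 y) 𝕜) where
  carrier := {g | ∃ f : Base u → 𝕜, AnalyticAt ℝ f y ∧ g = (f : Germ (𝓝 y) 𝕜)}
  mul_mem' := by
    rintro _ _ ⟨f, hf, rfl⟩ ⟨g, hg, rfl⟩
    exact ⟨f * g, hf.mul hg, rfl⟩
  one_mem' := ⟨fun _ => 1, analyticAt_const, rfl⟩
  add_mem' := by
    rintro _ _ ⟨f, hf, rfl⟩ ⟨g, hg, rfl⟩
    exact ⟨f + g, hf.add hg, rfl⟩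
  zero_mem' := ⟨fun _ => 0, analyticAt_const, rfl⟩
  neg_mem' := by
    rintro _ ⟨f, hf, rfl⟩
    exact ⟨-f, hf.neg, rfl⟩

/-- The fibre `Λᵈ S²` of the bundle of `d`-vectors of quadratic forms. -/
abbrev WedgeQuad (𝕜 : Type*) [RCLike 𝕜] (n d : ℕ) : Type _ := ⋀[𝕜]^d (Quad 𝕜 n)

/-- The `d`-vector `Q_{I 0}(x) ∧ … ∧ Q_{I (d - 1)}(x)`. -/
def wedgeQ (L : OpFamily 𝕜 u n) {d : ℕ} (I : Fin d → {p : Fin n × Fin n // p.1 < p.2})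
    (x : Base u) : WedgeQuad 𝕜 n d :=
  exteriorPower.ιMulti 𝕜 d (fun a => Q L (I a) x)

/-- The stalk at `y` of the Fitting ideal `ℱ_L`: generated by the coefficients of the `d_L`-vectors
`Q_{I 0} ∧ … ∧ Q_{I (d_L - 1)}`, that is by the `d_L × d_L` minors of the matrix of
the `Q_{i,j}`. -/
def fittingStalk (U : Set (Base u)) (L : OpFamily 𝕜 u n) (y : Base u) : Ideal (Ostalk 𝕜 y) :=
  Ideal.span {g | ∃ (I : Fin (dGen U L) → {p : Fin n × Fin n // p.1 < p.2})
    (c : Module.Dual 𝕜 (WedgeQuad 𝕜 n (dGen U L))),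
    (g : Germ (𝓝 y) 𝕜) = ((fun x => c (wedgeQ L I x) : Base u → 𝕜) : Germ (𝓝 y) 𝕜)}

/-- The stalk at `y` of the module `ℳ_L`, generated by the `d_L`-vectors
`Q_{I 0} ∧ … ∧ Q_{I (d_L - 1)}`. -/
def mStalk (U : Set (Base u)) (L : OpFamily 𝕜 u n) (y : Base u) :
    Submodule (Ostalk 𝕜 y) (Germ (𝓝 y) (WedgeQuad 𝕜 n (dGen U L))) :=
  Submodule.span (Ostalk 𝕜 y)
    (range fun I : Fin (dGen U L) → {p : Fin n × Fin n // p.1 < p.2} =>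
      ((wedgeQ L I : Base u → WedgeQuad 𝕜 n (dGen U L)) :
        Germ (𝓝 y) (WedgeQuad 𝕜 n (dGen U L))))

/-- The stalk at `y` of the weak transform `ℳ'_L = ℱ_L⁻¹ ⬝ ℳ_L`: the analytic germs `w` of
`d_L`-vectors with `ℱ_L w ⊆ ℳ_L`. Analyticity of a map to a finite dimensional space is tested on
linear forms. -/
def weakTransformStalk (U : Set (Base u)) (L : OpFamily 𝕜 u n) (y : Base u) :
    Set (Germ (𝓝 y) (WedgeQuad 𝕜 n (dGen U L))) :=
  {w | (∃ f : Base u → WedgeQuad 𝕜 n (dGen U L), w = (f : Germ (𝓝 y) _) ∧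
      ∀ c : Module.Dual 𝕜 (WedgeQuad 𝕜 n (dGen U L)), AnalyticAt ℝ (fun x => c (f x)) y) ∧
    ∀ g ∈ fittingStalk U L y, (g : Germ (𝓝 y) 𝕜) • w ∈ mStalk U L y}

/-- `J'_{y,2}`: the space of quadratic forms whose Plücker line is spanned by the values at `y` of
the sections of `ℳ'_L`, that is the quadratic forms `P` with `P ∧ w(y) = 0` for all these `w`. -/
def J₂' (U : Set (Base u)) (L : OpFamily 𝕜 u n) (y : Base u) : Submodule 𝕜 (Quad 𝕜 n) where
  carrier := {P | ∀ w ∈ weakTransformStalk U L y,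
    ExteriorAlgebra.ι 𝕜 P * (w.value : ExteriorAlgebra 𝕜 (Quad 𝕜 n)) = 0}
  add_mem' := fun ha hb w hw => by rw [map_add, add_mul, ha w hw, hb w hw, add_zero]
  zero_mem' := fun w _ => by rw [map_zero, zero_mul]
  smul_mem' := fun c P hP w hw => by rw [map_smul, smul_mul_assoc, hP w hw, smul_zero]

/-- The fibre at `y` of the reduced (pointed) eigen-bouquet bundle `EV'_L`. -/
def EV' (U : Set (Base u)) (L : OpFamily 𝕜 u n) (y : Base u) : Set (Fib 𝕜 n) :=
  {v | v ≠ 0 ∧ ∀ P ∈ J₂' U L y,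
    MvPolynomial.eval (fun i => v i) (P : MvPolynomial (Fin n) 𝕜) = 0}

/-- The projective bundle `ℙ EV'_L` restricted to `V`. -/
def projEV' (U : Set (Base u)) (L : OpFamily 𝕜 u n) (V : Set (Base u)) :
    Set (ProjTotal 𝕜 u n) :=
  {p | p.1 ∈ V ∧ ∃ (v : Fib 𝕜 n) (hv : v ≠ 0), v ∈ EV' U L p.1 ∧ p.2 = Projectivization.mk 𝕜 v hv}

end

end EigenBouquet

set_option linter.unusedSectionVars false

/-! Where `L(x)` has the maximal number of eigenvalues, `v = Σ P_i v` along the spectral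
projections, and a quadratic form vanishing on the eigenspaces is a combination of the products
`(P_i v)_k (P_j v)_l` with `i ≠ j`. Since `(λ_i - λ_j) P_i v ⊗ P_j v = (P_i ⊗ P_j)(L v ⊗ v - v ⊗ L
v)`, these products are combinations of the `Q_{i,j}`. Hence `J₂` is the span of the `Q_{i,j}` at
such points (`J₂_eq_span`).

In the local ring of analytic germs a principal ideal is generated by one of any given set of
generators. So near each point one minor `c₀(Q_{I₀})` divides all the others, and dividing the wedge
products by it gives analytic `d_L`-vectors `w_I` with `c₀(w_{I₀}) = 1`. They are all multiples of
`w_{I₀}`, whose value at `y` alone determines `J'_y` (`mem_J₂'_iff`). Contraction with `c₀` then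
produces an analytic family of projections `p_x` of the space of quadratic forms onto `J'_x`
(`exists_localReduction`).

Spectral projections have norm `1`, so along an ultrafilter of generic points tending to `y` they
converge to a resolution of the identity by projections `P_i`. The spaces of these projections
consist of eigenvectors of `L(y)`, and the identities linking them to `p` pass to the limit, so
their union is the reduced eigen-bouquet (`exists_limit_resolution`, `mem_EV'_iff`).

Analyticity is recovered from linear algebra. The operators `T` for which the components of `T v ∧
v` lie in `J'_x` are exactly the combinations of the `P_i`; they form the kernel of an analytic
family of linear maps, of constant dimension `s_L` (`ker_scalarEq`). Each `P_i(y)` therefore extends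
to an analytic section of these kernels (`exists_analytic_section`), and replacing `R = 2T - 1` by
`R (R²)^{-1/2}` turns it into a projection (`exists_analytic_idempotent`). A polar decomposition
gives analytic unitary operators carrying the projections at `y` to those at `x`
(`exists_unitary_transport`).

Transporting an adapted basis proves (ii), and its Rayleigh quotients prove (iii). For (i), the
projections form a covering with `s_L` sheets, which has global sections over a simply connected `V`
(`exists_globalBouquet`); the unitary transport straightens each of the resulting projective
bundles. -/

namespace EigenBouquet

noncomputable section

/-! ### Real analytic maps with values in spaces over `𝕜` -/

section Analytic

variable {X : Type*} [NormedAddCommGroup X] [NormedSpace ℝ X]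

/-- Endomorphisms of a normed space over `𝕜` form a real normed algebra. -/
instance opRealNormedAlgebra (𝕜 : Type*) [RCLike 𝕜] (E : Type*) [NormedAddCommGroup E]
    [NormedSpace 𝕜 E] [NormedSpace ℝ E] [IsScalarTower ℝ 𝕜 E] : NormedAlgebra ℝ (E →L[𝕜] E) :=
  { Algebra.ofModule (R := ℝ) (A := E →L[𝕜] E)
      (fun r x y => by ext v; simp)
      (fun r x y => by ext v; exact (x.restrictScalars ℝ).map_smul r (y v)) with
    norm_smul_le := fun r x => norm_smul_le r x }

variable {𝕜 : Type*} [RCLike 𝕜]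

theorem analyticAt_clm_of_apply {E F : Type*} [NormedAddCommGroup E] [NormedSpace 𝕜 E]
    [FiniteDimensional 𝕜 E] [NormedAddCommGroup F] [NormedSpace 𝕜 F] [NormedSpace ℝ F]
    [IsScalarTower ℝ 𝕜 F] [SMulCommClass 𝕜 ℝ F] {f : X → (E →L[𝕜] F)} {x : X}
    (h : ∀ v, AnalyticAt ℝ (fun x => f x v) x) : AnalyticAt ℝ f x := by
  let b := Module.finBasis 𝕜 E
  have key : f = fun x => ∑ i, ContinuousLinearMap.smulRight
      (LinearMap.toContinuousLinearMap (b.coord i)) (f x (b i)) := by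
    funext x
    ext v
    conv_lhs => rw [← b.sum_repr v]
    simp [-Module.Basis.sum_repr]
  rw [key]
  refine Finset.analyticAt_fun_sum _ fun i _ => ?_
  exact ((((ContinuousLinearMap.smulRightL 𝕜 E F) (LinearMap.toContinuousLinearMap
    (b.coord i))).restrictScalars ℝ).analyticAt _).comp (h (b i))

variable {E F G : Type*} [NormedAddCommGroup E] [NormedSpace 𝕜 E] [NormedSpace ℝ E]
  [IsScalarTower ℝ 𝕜 E] [NormedAddCommGroup F] [NormedSpace 𝕜 F] [NormedSpace ℝ F]
  [IsScalarTower ℝ 𝕜 F] [NormedAddCommGroup G] [NormedSpace 𝕜 G] [NormedSpace ℝ G]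
  [IsScalarTower ℝ 𝕜 G]

variable (𝕜 E F) in
/-- The evaluation of operators on vectors, as a real bilinear map. -/
def evalBilin : (E →L[𝕜] F) →L[ℝ] E →L[ℝ] F :=
  LinearMap.mkContinuous₂ (LinearMap.mk₂ ℝ (fun T v => T v) (by intros; rfl) (by intros; rfl)
    (by intros; simp) (by intro r T v; exact (T.restrictScalars ℝ).map_smul r v)) 1
    (fun T v => by rw [one_mul]; exact T.le_opNorm v)

theorem analyticAt_apply {f : X → (E →L[𝕜] F)} {g : X → E} {x : X}
    (hf : AnalyticAt ℝ f x) (hg : AnalyticAt ℝ g x) : AnalyticAt ℝ (fun x => f x (g x)) x :=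
  ((evalBilin 𝕜 E F).analyticAt_bilinear _).comp (AnalyticAt.prod hf hg)

theorem analyticAt_comp_clm [FiniteDimensional 𝕜 E] {f : X → (F →L[𝕜] G)}
    {g : X → (E →L[𝕜] F)} {x : X}
    (hf : AnalyticAt ℝ f x) (hg : AnalyticAt ℝ g x) : AnalyticAt ℝ (fun x => (f x).comp (g x)) x :=
  analyticAt_clm_of_apply (f := fun x => (f x).comp (g x)) fun v =>
    analyticAt_apply (g := fun x => g x v) hf (analyticAt_apply hg analyticAt_const)

theorem analyticAt_coord {n : ℕ} {g : X → Fib 𝕜 n} {x : X} (hg : AnalyticAt ℝ g x) (i : Fin n) :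
    AnalyticAt ℝ (fun x => g x i) x :=
  (((EuclideanSpace.proj i : Fib 𝕜 n →L[𝕜] 𝕜).restrictScalars ℝ).analyticAt _).comp hg

theorem analyticAt_of_coord {n : ℕ} {g : X → Fib 𝕜 n} {x : X}
    (hg : ∀ i, AnalyticAt ℝ (fun x => g x i) x) : AnalyticAt ℝ g x :=
  ((((EuclideanSpace.equiv (Fin n) 𝕜).symm : (Fin n → 𝕜) →L[𝕜] Fib 𝕜 n).restrictScalars
    ℝ).analyticAt _).comp (AnalyticAt.pi hg : AnalyticAt ℝ (fun x i => g x i) x)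

section Inner

variable {H : Type*} [NormedAddCommGroup H] [InnerProductSpace 𝕜 H] [NormedSpace ℝ H]
  [IsScalarTower ℝ 𝕜 H]

/-- The adjoint is only conjugate linear over `𝕜`, but it is continuous and linear over `ℝ`, which
is the field of analyticity here. -/
theorem analyticAt_star [CompleteSpace H] {f : X → (H →L[𝕜] H)} {x : X} (hf : AnalyticAt ℝ f x) :
    AnalyticAt ℝ (fun x => star (f x)) x := by
  let S : (H →L[𝕜] H) →L[ℝ] (H →L[𝕜] H) := LinearMap.mkContinuous
    { toFun := fun T => star T
      map_add' := fun a b => star_add a b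
      map_smul' := fun r a => by
        have h1 : ∀ b : H →L[𝕜] H, r • b = (r : 𝕜) • b := fun b => by
          ext v
          exact RCLike.real_smul_eq_coe_smul (K := 𝕜) r (b v)
        simp only [RingHom.id_apply]
        rw [h1, h1, star_smul]
        simp } 1 (fun T => by rw [one_mul]; exact (norm_star T).le)
  exact (S.analyticAt _).comp hf

theorem analyticAt_inner {f g : X → H} {x : X} (hf : AnalyticAt ℝ f x)
    (hg : AnalyticAt ℝ g x) : AnalyticAt ℝ (fun x => inner 𝕜 (f x) (g x)) x := by
  have hsm : ∀ (r : ℝ) (a : H), r • a = (r : 𝕜) • a := fun r a => by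
    rw [← RCLike.real_smul_eq_coe_smul]
  let S : H →L[ℝ] H →L[ℝ] 𝕜 := LinearMap.mkContinuous₂ (LinearMap.mk₂ ℝ
    (fun v w => inner 𝕜 v w) (fun a b c => inner_add_left a b c)
    (fun r a b => by
      rw [hsm, inner_smul_left, RCLike.conj_ofReal, RCLike.real_smul_eq_coe_mul])
    (fun a b c => inner_add_right a b c)
    (fun r a b => by
      rw [hsm, inner_smul_right, RCLike.real_smul_eq_coe_mul])) 1
    (fun v w => by simpa using norm_inner_le_norm v w)
  exact (S.analyticAt_bilinear _).comp (AnalyticAt.prod hf hg)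

end Inner

theorem analyticAt_det {k : ℕ} {f : X → Matrix (Fin k) (Fin k) 𝕜} {x : X}
    (hf : ∀ i j, AnalyticAt ℝ (fun x => f x i j) x) : AnalyticAt ℝ (fun x => (f x).det) x := by
  simp only [Matrix.det_apply]
  refine Finset.analyticAt_fun_sum _ fun σ _ => ?_
  have h : AnalyticAt ℝ (fun x => ∏ i, f x (σ i) i) x :=
    Finset.analyticAt_fun_prod _ fun i _ => hf _ _
  rcases Int.units_eq_one_or (Equiv.Perm.sign σ) with h1 | h1
  · simpa [h1] using h
  · simpa only [h1, Units.neg_smul, one_smul] using h.fun_neg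

/-- Near `1`, a Banach algebra has an analytic square root, which is the only one close to `1`. -/
theorem exists_analytic_sqrt (A : Type*) [NormedRing A] [NormedAlgebra ℝ A] [CompleteSpace A] :
    ∃ (r : A → A) (δ ε : ℝ), 0 < δ ∧ 0 < ε ∧ ε ≤ 1 ∧ r 1 = 1 ∧
      (∀ z ∈ Metric.ball (1 : A) δ, AnalyticAt ℝ r z ∧ r z * r z = z ∧
        r z ∈ Metric.ball (1 : A) ε) ∧
      ∀ s ∈ Metric.ball (1 : A) ε, s * s ∈ Metric.ball (1 : A) δ → r (s * s) = s := by
  let q : A → A := fun s => s * s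
  have hq : AnalyticAt ℝ q 1 := analyticAt_id.mul analyticAt_id
  -- Squaring has derivative `v ↦ 2v` at `1`, so the inverse function theorem applies even in a
  -- noncommutative algebra.
  let D : A ≃L[ℝ] A := ContinuousLinearEquiv.smulLeft (Units.mk0 (2 : ℝ) two_ne_zero)
  have hd : HasStrictFDerivAt q (D : A →L[ℝ] A) 1 := by
    have := (hasStrictFDerivAt_id (𝕜 := ℝ) (1 : A)).mul' (hasStrictFDerivAt_id (𝕜 := ℝ) (1 : A))
    refine this.congr_fderiv ?_
    ext v
    simp [D, two_smul, Units.smul_def]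
  let Φ := hd.toOpenPartialHomeomorph q
  have hΦ : (Φ : A → A) = q := hd.toOpenPartialHomeomorph_coe
  have h1 : (1 : A) ∈ Φ.source := hd.mem_toOpenPartialHomeomorph_source
  have hq1 : q 1 = 1 := by simp [q]
  have h1t : (1 : A) ∈ Φ.target := by
    have := Φ.map_source h1
    rwa [hΦ, hq1] at this
  have hr1 : Φ.symm 1 = 1 := by
    have := Φ.left_inv h1
    rwa [hΦ, hq1] at this
  have han : AnalyticAt ℝ Φ.symm 1 := by
    have := Φ.analyticAt_symm' (i := D) h1 (by rw [hΦ]; exact hq)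
      (by rw [hΦ]; exact hd.hasFDerivAt.fderiv)
    rwa [hΦ, hq1] at this
  obtain ⟨ε0, hε0, hs⟩ := Metric.isOpen_iff.1 Φ.open_source 1 h1
  let ε := min ε0 1
  have hε : 0 < ε := lt_min hε0 one_pos
  have hcont : ∀ᶠ z in 𝓝 (1 : A), Φ.symm z ∈ Metric.ball (1 : A) ε := by
    refine han.continuousAt ?_
    rw [hr1]
    exact Metric.ball_mem_nhds _ hε
  obtain ⟨δ, hδ, hb⟩ := Metric.eventually_nhds_iff_ball.1
    ((hcont.and han.eventually_analyticAt).and (Φ.open_target.mem_nhds h1t))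
  refine ⟨Φ.symm, δ, ε, hδ, hε, min_le_right _ _, hr1, fun z hz => ?_, fun s hs' _ => ?_⟩
  · obtain ⟨⟨h2, h3⟩, h4⟩ := hb z hz
    refine ⟨h3, ?_, h2⟩
    have := Φ.right_inv h4
    rwa [hΦ] at this
  · have := Φ.left_inv (hs (Metric.ball_subset_ball (min_le_left _ _) hs'))
    rwa [hΦ] at this

/-- This is the identity theorem: vanishing near one point of a connected set would propagate to the
whole set. It makes generic points dense in `U`. -/
theorem frequently_ne_zero {U : Set X} (hU : IsPreconnected U) {f : X → 𝕜}
    (hf : AnalyticOnNhd ℝ f U) {x₁ : X} (h₁ : x₁ ∈ U) (hne : f x₁ ≠ 0) {y : X} (hy : y ∈ U) :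
    ∃ᶠ x in 𝓝 y, f x ≠ 0 := by
  intro h
  simp only [not_not] at h
  exact hne (hf.eqOn_zero_of_preconnected_of_eventuallyEq_zero hU hy h h₁)

end Analytic

/-- Being different is an open condition. This is the tool that carries identities from generic
points to the discriminant locus. -/
theorem eq_of_frequently_eq {X Y : Type*} [TopologicalSpace X] [TopologicalSpace Y] [T2Space Y]
    {f g : X → Y} {y : X} (hf : ContinuousAt f y) (hg : ContinuousAt g y)
    (h : ∃ᶠ x in 𝓝 y, f x = g x) : f y = g y := by
  by_contra hne
  refine h ?_
  filter_upwards [(hf.prodMk hg) (isOpen_ne_fun continuous_fst continuous_snd |>.mem_nhds hne)]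
    with x hx using hx

end

end EigenBouquet

namespace EigenBouquet

noncomputable section

variable {𝕜 : Type*} [RCLike 𝕜] {E : Type*} [NormedAddCommGroup E] [InnerProductSpace 𝕜 E]
  [FiniteDimensional 𝕜 E] [CompleteSpace E]

/-! ### Orthogonal resolutions of the identity -/

/-- A family of non-zero pairwise orthogonal projections with sum `1`. -/
structure IsResolution {s : ℕ} (P : Fin s → (E →L[𝕜] E)) : Prop where
  star_eq : ∀ i, star (P i) = P i
  mul_eq : ∀ i j, P i * P j = if i = j then P i else 0
  sum_eq : ∑ i, P i = 1
  ne_zero : ∀ i, P i ≠ 0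

namespace IsResolution

variable {s : ℕ} {P P' : Fin s → (E →L[𝕜] E)}

theorem apply_apply (h : IsResolution P) (i j : Fin s) (v : E) :
    P i (P j v) = if i = j then P i v else 0 := by
  have := congrArg (fun T : E →L[𝕜] E => T v) (h.mul_eq i j)
  split_ifs at this ⊢ <;> simpa using this

theorem apply_self (h : IsResolution P) (i : Fin s) (v : E) : P i (P i v) = P i v := by
  rw [h.apply_apply, if_pos rfl]

theorem apply_ne (h : IsResolution P) {i j : Fin s} (hij : i ≠ j) (v : E) :
    P i (P j v) = 0 := by
  rw [h.apply_apply, if_neg hij]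

theorem sum_proj (h : IsResolution P) (v : E) : ∑ i, P i v = v := by
  have := congrArg (fun T : E →L[𝕜] E => T v) h.sum_eq
  simpa using this

theorem inner_left (h : IsResolution P) (i : Fin s) (v w : E) :
    inner 𝕜 (P i v) w = inner 𝕜 v (P i w) := by
  rw [← ContinuousLinearMap.adjoint_inner_right, ← ContinuousLinearMap.star_eq_adjoint, h.star_eq]

theorem inner_eq_zero (h : IsResolution P) {i j : Fin s} (hij : i ≠ j) (v w : E) :
    inner 𝕜 (P i v) (P j w) = 0 := by
  rw [h.inner_left, h.apply_ne hij, inner_zero_right]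

theorem norm_apply_le (h : IsResolution P) (i : Fin s) (v : E) : ‖P i v‖ ≤ ‖v‖ := by
  have h1 : ‖P i v‖ * ‖P i v‖ ≤ ‖v‖ * ‖P i v‖ := by
    have : (inner 𝕜 v (P i v) : 𝕜) = ((‖P i v‖ * ‖P i v‖ : ℝ) : 𝕜) := by
      rw [← h.apply_self i v, ← h.inner_left, h.apply_self, inner_self_eq_norm_sq_to_K]
      push_cast; ring
    calc ‖P i v‖ * ‖P i v‖ = ‖(inner 𝕜 v (P i v) : 𝕜)‖ := by
          rw [this, RCLike.norm_ofReal, abs_of_nonneg (by positivity)]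
      _ ≤ _ := norm_inner_le_norm _ _
  rcases (norm_nonneg (P i v)).eq_or_lt with h0 | h0
  · rw [← h0]; exact norm_nonneg _
  · exact le_of_mul_le_mul_right h1 h0

theorem norm_le_one (h : IsResolution P) (i : Fin s) : ‖P i‖ ≤ 1 :=
  ContinuousLinearMap.opNorm_le_bound _ zero_le_one fun v => by
    rw [one_mul]; exact h.norm_apply_le i v

theorem exists_apply_ne_zero (h : IsResolution P) (i : Fin s) : ∃ v, P i v ≠ 0 := by
  by_contra! hc
  exact h.ne_zero i (by ext1 v; simpa using hc v)

theorem exists_mem_ne_zero (h : IsResolution P) (i : Fin s) : ∃ v, P i v = v ∧ v ≠ 0 := by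
  obtain ⟨v, hv⟩ := h.exists_apply_ne_zero i
  exact ⟨P i v, h.apply_self i v, hv⟩

theorem one_le_norm (h : IsResolution P) (i : Fin s) : 1 ≤ ‖P i‖ := by
  obtain ⟨v, hv, h0⟩ := h.exists_mem_ne_zero i
  have := (P i).le_opNorm v
  rw [hv] at this
  have h1 : 0 < ‖v‖ := norm_pos_iff.2 h0
  nlinarith

theorem norm_sq_sum (h : IsResolution P) (v : E) : ‖v‖ ^ 2 = ∑ i, ‖P i v‖ ^ 2 := by
  have h1 : (inner 𝕜 v v : 𝕜) = ∑ i, inner 𝕜 (P i v) (P i v) := by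
    conv_lhs => rw [← h.sum_proj v]
    rw [sum_inner]
    refine Finset.sum_congr rfl fun i _ => ?_
    rw [h.sum_proj]
    conv_lhs => rw [← h.apply_self, h.inner_left]
  simp only [inner_self_eq_norm_sq_to_K] at h1
  exact_mod_cast h1

theorem norm_sum_smul_le (h : IsResolution P) (c : Fin s → 𝕜) {r : ℝ} (hr : 0 ≤ r)
    (hc : ∀ i, ‖c i‖ ≤ r) : ‖∑ i, c i • P i‖ ≤ r := by
  refine ContinuousLinearMap.opNorm_le_bound _ hr fun v => ?_
  refine (sq_le_sq₀ (norm_nonneg _) (by positivity)).1 ?_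
  rw [h.norm_sq_sum, mul_pow, h.norm_sq_sum v, Finset.mul_sum]
  refine Finset.sum_le_sum fun i _ => ?_
  have : P i ((∑ j, c j • P j) v) = c i • P i v := by
    rw [sum_apply, map_sum, Finset.sum_eq_single i]
    · simp [h.apply_self]
    · intro j _ hj
      simp [h.apply_ne hj.symm]
    · simp
  rw [this, norm_smul, mul_pow]
  gcongr
  exact hc i

/-- The hypotheses say `P P' = P'` and `P' P = P`. The adjoint of the first is `P' P = P'`. -/
theorem eq_of_range_subset (h : IsResolution P) (h' : IsResolution P') {i j : Fin s}
    (hs : ∀ v, P i (P' j v) = P' j v) (hs' : ∀ v, P' j (P i v) = P i v) : P i = P' j := by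
  have e1 : P i * P' j = P' j := by ext1 v; exact hs v
  have e2 : P' j * P i = P i := by ext1 v; exact hs' v
  have := congrArg star e1
  rw [star_mul, h.star_eq, h'.star_eq, e2] at this
  exact this

/-- A subspace inside a union of pairwise orthogonal subspaces lies in one of them: if it contained
non-zero vectors in two different ones, their sum would be in none. -/
theorem exists_mem_of_subset (h : IsResolution P) (h' : IsResolution P')
    (hs : ∀ i v, P' i v = v → v ≠ 0 → ∃ j, P j v = v) (i : Fin s) :
    ∃ j, ∀ v, P j (P' i v) = P' i v := by
  obtain ⟨v, hv, h0⟩ := h'.exists_mem_ne_zero i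
  obtain ⟨j, hj⟩ := hs i v hv h0
  refine ⟨j, fun w => ?_⟩
  set z := P' i w with hz
  by_cases hz0 : z = 0
  · rw [hz0, map_zero]
  obtain ⟨k, hk⟩ := hs i z (h'.apply_self i w) hz0
  by_cases hkj : k = j
  · rw [← hkj, hk]
  exfalso
  have hjz : P j z = 0 := by rw [← hk, h.apply_ne (Ne.symm hkj)]
  have hkv : P k v = 0 := by rw [← hj, h.apply_ne hkj]
  -- The test vector `v + z` has non-zero components in both ranges `j` and `k`.
  have hsum : v + z ≠ 0 := by
    intro h2
    have := congrArg (P j) h2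
    rw [map_add, hj, hjz, add_zero, map_zero] at this
    exact h0 this
  obtain ⟨l, hl⟩ := hs i (v + z) (by rw [map_add, hv, hz, h'.apply_self]) hsum
  have e1 := congrArg (P j) hl
  have e2 := congrArg (P k) hl
  rw [h.apply_apply] at e1 e2
  rw [map_add, hj, hjz, add_zero] at e1
  rw [map_add, hk, hkv, zero_add] at e2
  split_ifs at e1 e2 with h1 h2 h3
  · exact hkj (h2.trans h1.symm)
  · exact hz0 e2.symm
  · exact h0 e1.symm
  · exact h0 e1.symm

/-- Two resolutions whose ranges have the same union agree up to the order. -/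
theorem exists_perm (h : IsResolution P) (h' : IsResolution P')
    (hs : ∀ v, v ≠ 0 → ((∃ i, P i v = v) ↔ ∃ i, P' i v = v)) :
    ∃ τ : Equiv.Perm (Fin s), ∀ i, P' i = P (τ i) := by
  choose τ hτ using h.exists_mem_of_subset h' fun i v hv h0 => (hs v h0).2 ⟨i, hv⟩
  choose τ' hτ' using h'.exists_mem_of_subset h fun i v hv h0 => (hs v h0).1 ⟨i, hv⟩
  have e : ∀ i, τ' (τ i) = i := by
    intro i
    obtain ⟨v, hv, h0⟩ := h'.exists_mem_ne_zero i
    by_contra hne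
    have h1 := hτ' (τ i) v
    have h2 := hτ i v
    rw [hv] at h2
    rw [h2, ← hv, h'.apply_ne hne, hv] at h1
    exact h0 h1.symm
  have e' : ∀ i, τ (τ' i) = i := by
    intro i
    obtain ⟨v, hv, h0⟩ := h.exists_mem_ne_zero i
    by_contra hne
    have h1 := hτ (τ' i) v
    have h2 := hτ' i v
    rw [hv] at h2
    rw [h2, ← hv, h.apply_ne hne, hv] at h1
    exact h0 h1.symm
  refine ⟨⟨τ, τ', e, e'⟩, fun i => (h.eq_of_range_subset h' (hτ i) ?_).symm⟩
  have := hτ' (τ i)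
  rwa [e] at this

theorem perm (h : IsResolution P) (τ : Equiv.Perm (Fin s)) : IsResolution (fun i => P (τ i)) where
  star_eq i := h.star_eq _
  mul_eq i j := by simp [h.mul_eq]
  sum_eq := by rw [← h.sum_eq]; exact Equiv.sum_comp τ P
  ne_zero i := h.ne_zero _

/-- The range of a projection is where it fixes vectors. -/
theorem mem_range_iff (h : IsResolution P) (i : Fin s) (v : E) :
    v ∈ LinearMap.range (P i : E →ₗ[𝕜] E) ↔ P i v = v :=
  ⟨by rintro ⟨w, rfl⟩; exact h.apply_self i w, fun hv => ⟨v, hv⟩⟩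

end IsResolution

/-! ### Eigenspaces of normal operators -/

section Eigen

variable {s : ℕ} {P : Fin s → (E →L[𝕜] E)} {T : E →L[𝕜] E} {lam : Fin s → 𝕜}

theorem apply_eq_sum (h : IsResolution P) (hT : ∀ i, T * P i = lam i • P i) (v : E) :
    T v = ∑ i, lam i • P i v := by
  conv_lhs => rw [← h.sum_proj v]
  rw [map_sum]
  refine Finset.sum_congr rfl fun i _ => ?_
  exact congrArg (fun S : E →L[𝕜] E => S v) (hT i)

theorem apply_of_mem (hT : ∀ i, T * P i = lam i • P i) {i : Fin s} {v : E}
    (hv : P i v = v) : T v = lam i • v := by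
  have := congrArg (fun S : E →L[𝕜] E => S v) (hT i)
  simpa [hv] using this

theorem proj_apply_eq (h : IsResolution P) (hT : ∀ i, T * P i = lam i • P i) (i : Fin s)
    (v : E) : P i (T v) = lam i • P i v := by
  rw [apply_eq_sum h hT, map_sum, Finset.sum_eq_single i]
  · rw [map_smul, h.apply_self]
  · intro j _ hj
    rw [map_smul, h.apply_ne hj.symm, smul_zero]
  · simp

theorem hasEigenvector_of_mem (hT : ∀ i, T * P i = lam i • P i) {i : Fin s} {v : E}
    (hv : P i v = v) (h0 : v ≠ 0) :
    Module.End.HasEigenvector (T : E →ₗ[𝕜] E) (lam i) v :=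
  ⟨Module.End.mem_eigenspace_iff.2 (apply_of_mem hT hv), h0⟩

theorem hasEigenvalue_iff (h : IsResolution P) (hT : ∀ i, T * P i = lam i • P i) (μ : 𝕜) :
    Module.End.HasEigenvalue (T : E →ₗ[𝕜] E) μ ↔ μ ∈ range lam := by
  constructor
  · intro hμ
    obtain ⟨v, hv, h0⟩ := hμ.exists_hasEigenvector
    have hv' : T v = μ • v := Module.End.mem_eigenspace_iff.1 hv
    by_contra hc
    refine h0 ?_
    rw [← h.sum_proj v]
    refine Finset.sum_eq_zero fun i _ => ?_
    have h1 := proj_apply_eq h hT i v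
    rw [hv', map_smul] at h1
    by_contra h2
    exact hc ⟨i, (smul_left_injective 𝕜 h2 h1).symm⟩
  · rintro ⟨i, rfl⟩
    obtain ⟨v, hv, h0⟩ := h.exists_mem_ne_zero i
    exact Module.End.hasEigenvalue_of_hasEigenvector (hasEigenvector_of_mem hT hv h0)

/-- The scalars `lam` exhaust the eigenvalues, so a repetition would leave fewer than `s` of them.
Off the discriminant locus this forces the ranges to be full eigenspaces. -/
theorem injective_of_ncard (h : IsResolution P) (hT : ∀ i, T * P i = lam i • P i)
    (hs : {μ : 𝕜 | Module.End.HasEigenvalue (T : E →ₗ[𝕜] E) μ}.ncard = s) :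
    Function.Injective lam := by
  have h1 : {μ : 𝕜 | Module.End.HasEigenvalue (T : E →ₗ[𝕜] E) μ} = range lam := by
    ext μ; exact hasEigenvalue_iff h hT μ
  rw [h1, ← Set.image_univ] at hs
  have := Set.injOn_of_ncard_image_eq (f := lam) (s := univ) (by rw [hs]; simp)
  exact Set.injOn_univ.1 this

theorem mem_eigenspace_iff_of_injective (h : IsResolution P) (hT : ∀ i, T * P i = lam i • P i)
    (hl : Function.Injective lam) (i : Fin s) (v : E) :
    v ∈ Module.End.eigenspace (T : E →ₗ[𝕜] E) (lam i) ↔ P i v = v := by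
  refine ⟨fun hv => ?_, fun hv => Module.End.mem_eigenspace_iff.2 (apply_of_mem hT hv)⟩
  have hv' : T v = lam i • v := Module.End.mem_eigenspace_iff.1 hv
  conv_rhs => rw [← h.sum_proj v]
  symm
  refine Finset.sum_eq_single i (fun j _ hj => ?_) (by simp)
  have h1 := proj_apply_eq h hT j v
  rw [hv', map_smul] at h1
  by_contra h2
  exact hj (hl (smul_left_injective 𝕜 h2 h1).symm)

/-- The operator `T - μ` is again normal, so its adjoint also kills `v`; pairing with `w` leaves `(ν
- μ)⟨v, w⟩ = 0`. -/
theorem inner_eq_zero_of_normal (hT : IsStarNormal T) {μ ν : 𝕜} (hμν : μ ≠ ν) {v w : E}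
    (hv : T v = μ • v) (hw : T w = ν • w) : inner 𝕜 v w = (0 : 𝕜) := by
  have hN : IsStarNormal (T - μ • (1 : E →L[𝕜] E)) := by
    constructor
    rw [star_sub, star_smul, star_one]
    have h1 : Commute (star T) T := hT.star_comm_self
    exact ((h1.sub_right ((Commute.one_right _).smul_right _)).sub_left
      (((Commute.one_left _).smul_left _).sub_right
        (((Commute.one_left _).smul_left _).smul_right _)))
  have h0 : (T - μ • (1 : E →L[𝕜] E)) v = 0 := by simp [hv]
  have h1 := (ContinuousLinearMap.IsStarNormal.adjoint_apply_eq_zero_iff hN v).2 h0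
  have h2 : inner 𝕜 ((ContinuousLinearMap.adjoint (T - μ • (1 : E →L[𝕜] E))) v) w = (0 : 𝕜) := by
    rw [h1, inner_zero_left]
  rw [ContinuousLinearMap.adjoint_inner_left] at h2
  have h3 : (T - μ • (1 : E →L[𝕜] E)) w = (ν - μ) • w := by simp [hw, sub_smul]
  rw [h3, inner_smul_right] at h2
  exact (mul_eq_zero.1 h2).resolve_left (sub_ne_zero.2 hμν.symm)

/-- The operators `A = T + T*` and `B = I (T - T*)` are self-adjoint and commute, hence are jointly
diagonalisable, and `2T = A - I B`. Over `ℝ`, where `I = 0`, the same formula holds because `T` is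
symmetric. -/
theorem iSup_eigenspace_of_normal (hT : IsStarNormal T)
    (hsa : (RCLike.I : 𝕜) = 0 → IsSelfAdjoint T) :
    ⨆ μ : 𝕜, Module.End.eigenspace (T : E →ₗ[𝕜] E) μ = ⊤ := by
  have hc : Commute (star T) T := hT.star_comm_self
  let A : E →L[𝕜] E := T + star T
  let B : E →L[𝕜] E := (RCLike.I : 𝕜) • (T - star T)
  have hA : IsSelfAdjoint A := by
    simp [A, isSelfAdjoint_iff, add_comm]
  have hB : IsSelfAdjoint B := by
    simp only [B, isSelfAdjoint_iff, star_smul, star_sub, star_star]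
    rw [show star (RCLike.I : 𝕜) = -RCLike.I from RCLike.conj_I]
    module
  have hAB : Commute A B := by
    have h1 : Commute A (T - star T) := by
      refine (Commute.add_left ?_ ?_)
      · exact (Commute.refl T).sub_right hc.symm
      · exact hc.sub_right (Commute.refl _)
    exact h1.smul_right _
  have hTAB : ∀ v, (2 : 𝕜) • T v = A v - (RCLike.I : 𝕜) • B v := by
    intro v
    by_cases hI : (RCLike.I : 𝕜) = 0
    · have := hsa hI
      rw [isSelfAdjoint_iff] at this
      simp [A, this, hI, two_smul]
    · have hI2 : (RCLike.I : 𝕜) * RCLike.I = -1 := RCLike.I_mul_I_of_nonzero hI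
      simp only [A, B, add_apply, smul_apply,
        sub_apply, smul_smul, hI2]
      module
  have hA' := (ContinuousLinearMap.isSelfAdjoint_iff_isSymmetric.1 hA)
  have hB' := (ContinuousLinearMap.isSelfAdjoint_iff_isSymmetric.1 hB)
  have hAB' : Commute (A : E →ₗ[𝕜] E) (B : E →ₗ[𝕜] E) := by
    ext1 v
    exact congrArg (fun S : E →L[𝕜] E => S v) hAB.eq
  have htop := hA'.iSup_iSup_eigenspace_inf_eigenspace_eq_top_of_commute hB' hAB'
  rw [eq_top_iff, ← htop]
  refine iSup_le fun α => iSup_le fun γ => ?_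
  refine le_trans ?_ (le_iSup _ ((2 : 𝕜)⁻¹ * (α - RCLike.I * γ)))
  rintro v ⟨h1, h2⟩
  have h1' : A v = α • v := Module.End.mem_eigenspace_iff.1 h1
  have h2' : B v = γ • v := Module.End.mem_eigenspace_iff.1 h2
  refine Module.End.mem_eigenspace_iff.2 ?_
  have h3 := hTAB v
  rw [h1', h2', smul_smul, ← sub_smul] at h3
  change T v = _
  rw [mul_smul, ← h3, smul_smul, inv_mul_cancel₀ two_ne_zero, one_smul]

/-- The spectral theorem for a normal operator. -/
theorem exists_resolution (hT : IsStarNormal T) (hsa : (RCLike.I : 𝕜) = 0 → IsSelfAdjoint T) :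
    ∃ (P : Fin {μ : 𝕜 | Module.End.HasEigenvalue (T : E →ₗ[𝕜] E) μ}.ncard → (E →L[𝕜] E))
      (lam : _ → 𝕜), IsResolution P ∧ Function.Injective lam ∧ ∀ i, T * P i = lam i • P i := by
  set S := {μ : 𝕜 | Module.End.HasEigenvalue (T : E →ₗ[𝕜] E) μ} with hS
  have hfin : Finite S := Module.End.finite_hasEigenvalue _
  let ev : Fin S.ncard ≃ S := (Finite.equivFinOfCardEq (Nat.card_coe_set_eq S)).symm
  let V : Fin S.ncard → Submodule 𝕜 (E) := fun i =>
    Module.End.eigenspace (T : E →ₗ[𝕜] E) (ev i)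
  have hV : OrthogonalFamily 𝕜 (fun i => V i) fun i => (V i).subtypeₗᵢ := by
    intro i j hij v w
    refine inner_eq_zero_of_normal hT (fun h => hij (ev.injective (Subtype.ext h)))
      (Module.End.mem_eigenspace_iff.1 v.2) (Module.End.mem_eigenspace_iff.1 w.2)
  have htop : ⨆ i, V i = ⊤ := by
    rw [eq_top_iff, ← iSup_eigenspace_of_normal hT hsa]
    refine iSup_le fun μ => ?_
    by_cases hμ : Module.End.HasEigenvalue (T : E →ₗ[𝕜] E) μ
    · refine le_trans ?_ (le_iSup V (ev.symm ⟨μ, hμ⟩))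
      simp [V]
    · rw [Module.End.hasEigenvalue_iff, not_not] at hμ
      rw [hμ]; exact bot_le
  have hmem : ∀ i v, (V i).starProjection v ∈ V i := fun i v =>
    Submodule.starProjection_apply_mem _ _
  refine ⟨fun i => (V i).starProjection, fun i => ev i, ⟨fun i => ?_, fun i j => ?_, ?_,
    fun i => ?_⟩, fun i j h => ev.injective (Subtype.ext h), fun i => ?_⟩
  · exact (isSelfAdjoint_starProjection (V i))
  · split_ifs with hij
    · subst hij
      ext1 v
      exact Submodule.starProjection_eq_self_iff.2 (hmem i v)
    · ext1 v
      change (V i).starProjection ((V j).starProjection v) = 0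
      rw [Submodule.starProjection_apply_eq_zero_iff, Submodule.mem_orthogonal]
      intro w hw
      exact hV hij ⟨w, hw⟩ ⟨_, hmem j v⟩
  · ext1 v
    rw [sum_apply]
    exact hV.sum_projection_of_mem_iSup v (by rw [htop]; trivial)
  · intro h0
    obtain ⟨v, hv, hne⟩ := (ev i).2.exists_hasEigenvector
    refine hne ?_
    rw [← Submodule.starProjection_eq_self_iff.2 hv, h0]
    rfl
  · ext1 v
    exact Module.End.mem_eigenspace_iff.1 (hmem i v)

end Eigen

end

end EigenBouquet

namespace EigenBouquet

noncomputable section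

/-! ### Genericity of the complement of the discriminant locus -/

section Krylov

variable {𝕜 : Type*} [RCLike 𝕜] {E : Type*} [NormedAddCommGroup E] [InnerProductSpace 𝕜 E]
  [FiniteDimensional 𝕜 E] [CompleteSpace E]

theorem pow_apply_eq_sum {s : ℕ} {P : Fin s → (E →L[𝕜] E)} {T : E →L[𝕜] E} {lam : Fin s → 𝕜}
    (h : IsResolution P) (hT : ∀ i, T * P i = lam i • P i) (k : ℕ) (v : E) :
    (T ^ k) v = ∑ i, lam i ^ k • P i v := by
  induction k with
  | zero => simp [h.sum_proj]
  | succ k ih =>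
    rw [pow_succ', mul_apply_eq_comp, ih, map_sum]
    refine Finset.sum_congr rfl fun i _ => ?_
    rw [map_smul, apply_of_mem hT (h.apply_self i v), smul_smul, pow_succ]

/-- The matrix of the products of the vectors `w j` with the iterates `T ^ i z`. -/
def krylovMatrix {s : ℕ} (w : Fin s → E) (z : E) (T : E →L[𝕜] E) : Matrix (Fin s) (Fin s) 𝕜 :=
  Matrix.of fun i j => inner 𝕜 (w j) ((T ^ (i : ℕ)) z)

/-- The matrix factors through `𝕜ᵏ`, one coordinate per spectral projection, with a Vandermonde
matrix as left factor. -/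
theorem krylovMatrix_eq_mul {s k : ℕ} {P : Fin k → (E →L[𝕜] E)} {T : E →L[𝕜] E}
    {lam : Fin k → 𝕜} (h : IsResolution P) (hT : ∀ i, T * P i = lam i • P i) (w : Fin s → E)
    (z : E) : krylovMatrix w z T = (Matrix.of fun (i : Fin s) (l : Fin k) => lam l ^ (i : ℕ)) *
      Matrix.of fun (l : Fin k) (j : Fin s) => (inner 𝕜 (w j) (P l z) : 𝕜) := by
  ext i j
  simp [krylovMatrix, Matrix.mul_apply, pow_apply_eq_sum h hT, inner_sum, inner_smul_right]

/-- A matrix that factors through `𝕜ᵏ` has rank at most `k`. The determinant is thus a certificate,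
analytic in `T`, that there are at least `s` eigenvalues. -/
theorem le_of_krylovMatrix_det_ne_zero {s k : ℕ} {P : Fin k → (E →L[𝕜] E)} {T : E →L[𝕜] E}
    {lam : Fin k → 𝕜} (h : IsResolution P) (hT : ∀ i, T * P i = lam i • P i) (w : Fin s → E)
    (z : E) (hdet : (krylovMatrix w z T).det ≠ 0) : s ≤ k := by
  have h1 : (krylovMatrix w z T).rank = s := by
    have := Matrix.rank_of_isUnit _ ((Matrix.isUnit_iff_isUnit_det _).2 hdet.isUnit)
    simpa using this
  rw [krylovMatrix_eq_mul h hT] at h1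
  rw [← h1]
  refine (Matrix.rank_mul_le_left _ _).trans ?_
  simpa using Matrix.rank_le_card_width (Matrix.of fun (i : Fin s) (l : Fin k) => lam l ^ (i : ℕ))

/-- Take `w_j` in the `j`-th range and `z = Σ w_j`: the left factor is Vandermonde with distinct
nodes, and the right factor is diagonal with entries `‖w_j‖²`. -/
theorem exists_krylovMatrix_det_ne_zero {s : ℕ} {P : Fin s → (E →L[𝕜] E)} {T : E →L[𝕜] E}
    {lam : Fin s → 𝕜} (h : IsResolution P) (hT : ∀ i, T * P i = lam i • P i)
    (hl : Function.Injective lam) :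
    ∃ (w : Fin s → E) (z : E), (krylovMatrix w z T).det ≠ 0 := by
  choose w hw h0 using h.exists_mem_ne_zero
  refine ⟨w, ∑ j, w j, ?_⟩
  rw [krylovMatrix_eq_mul h hT, Matrix.det_mul]
  refine mul_ne_zero ?_ ?_
  · have : (Matrix.of fun (i l : Fin s) => lam l ^ (i : ℕ)) = (Matrix.vandermonde lam).transpose := by
      ext; simp [Matrix.vandermonde]
    rw [this, Matrix.det_transpose]
    exact Matrix.det_vandermonde_ne_zero_iff.2 hl
  · have : (Matrix.of fun (l : Fin s) (j : Fin s) => (inner 𝕜 (w j) (P l (∑ j, w j)) : 𝕜)) =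
        Matrix.diagonal fun j => inner 𝕜 (w j) (w j) := by
      ext l j
      have h1 : P l (∑ j, w j) = w l := by
        rw [map_sum, Finset.sum_eq_single l]
        · exact hw l
        · intro j _ hj
          rw [← hw j, h.apply_ne hj.symm]
        · simp
      rw [Matrix.of_apply, h1, Matrix.diagonal_apply]
      split_ifs with hlj
      · rw [hlj]
      · rw [← hw j, ← hw l]
        exact h.inner_eq_zero (Ne.symm hlj) _ _
    rw [this, Matrix.det_diagonal]
    exact Finset.prod_ne_zero_iff.2 fun j _ => inner_self_ne_zero.2 (h0 j)

theorem card_le_finrank_of_resolution {s : ℕ} {P : Fin s → (E →L[𝕜] E)} (h : IsResolution P) :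
    s ≤ Module.finrank 𝕜 E := by
  choose w hw h0 using h.exists_mem_ne_zero
  have : LinearIndependent 𝕜 w := linearIndependent_of_ne_zero_of_inner_eq_zero h0
    fun i j hij => by
      change inner 𝕜 (w i) (w j) = 0
      rw [← hw i, ← hw j]; exact h.inner_eq_zero hij _ _
  simpa using this.fintype_card_le_finrank

theorem analyticAt_krylovMatrix_det {X : Type*} [NormedAddCommGroup X] [NormedSpace ℝ X]
    [NormedSpace ℝ E] [IsScalarTower ℝ 𝕜 E] {s : ℕ} (w : Fin s → E) (z : E) {f : X → (E →L[𝕜] E)}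
    {x : X} (hf : AnalyticAt ℝ f x) :
    AnalyticAt ℝ (fun x => (krylovMatrix w z (f x)).det) x := by
  refine analyticAt_det fun i j => ?_
  exact analyticAt_inner analyticAt_const (analyticAt_apply (hf.pow i) analyticAt_const)

end Krylov

variable {𝕜 : Type*} [RCLike 𝕜] {u n : ℕ} {U : Set (Base u)} {L : OpFamily 𝕜 u n}

/-- The operators of the family are normal, and symmetric in the real case. -/
def IsNormalFamily (U : Set (Base u)) (L : OpFamily 𝕜 u n) : Prop :=
  ∀ x ∈ U, IsStarNormal (L x) ∧ ((RCLike.I : 𝕜) = 0 → IsSelfAdjoint (L x))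

theorem IsNormalFamily.exists_resolution (h : IsNormalFamily U L) {x : Base u} (hx : x ∈ U) :
    ∃ (P : Fin (numEig L x) → (Fib 𝕜 n →L[𝕜] Fib 𝕜 n)) (lam : Fin (numEig L x) → 𝕜),
      IsResolution P ∧ Function.Injective lam ∧ ∀ i, L x * P i = lam i • P i :=
  EigenBouquet.exists_resolution (h x hx).1 (h x hx).2

theorem IsNormalFamily.bddAbove (h : IsNormalFamily U L) : BddAbove (numEig L '' U) := by
  refine ⟨Module.finrank 𝕜 (Fib 𝕜 n), ?_⟩
  rintro _ ⟨x, hx, rfl⟩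
  obtain ⟨P, lam, hP, -, -⟩ := h.exists_resolution hx
  exact card_le_finrank_of_resolution hP

theorem IsNormalFamily.numEig_eq (h : IsNormalFamily U L) {x : Base u} (hx : x ∈ U)
    (hd : x ∉ discLocus U L) : numEig L x = sMax U L := by
  refine le_antisymm (le_csSup h.bddAbove ⟨x, hx, rfl⟩) ?_
  by_contra hc
  exact hd ⟨hx, not_le.1 hc⟩

theorem IsNormalFamily.exists_resolution_of_notMem (h : IsNormalFamily U L) {x : Base u}
    (hx : x ∈ U) (hd : x ∉ discLocus U L) :
    ∃ (P : Fin (sMax U L) → (Fib 𝕜 n →L[𝕜] Fib 𝕜 n)) (lam : Fin (sMax U L) → 𝕜),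
      IsResolution P ∧ Function.Injective lam ∧ ∀ i, L x * P i = lam i • P i := by
  rw [← h.numEig_eq hx hd]
  exact h.exists_resolution hx

/-- The function `φ` is the Krylov determinant with vectors chosen at a point where `numEig` is
maximal. Where `φ` does not vanish there are at least `sMax` eigenvalues, so the discriminant locus
lies in its zero set. -/
theorem IsNormalFamily.exists_discriminant (h : IsNormalFamily U L) (hne : U.Nonempty)
    (hL : AnalyticOnNhd ℝ L U) :
    ∃ φ : Base u → 𝕜, AnalyticOnNhd ℝ φ U ∧ (∃ x ∈ U, φ x ≠ 0) ∧
      ∀ x ∈ U, φ x ≠ 0 → x ∉ discLocus U L := by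
  obtain ⟨x₁, hx₁, he⟩ : sMax U L ∈ numEig L '' U := Nat.sSup_mem (hne.image _) h.bddAbove
  obtain ⟨P, lam, hP, hl, hT⟩ := h.exists_resolution_of_notMem hx₁ (fun hd => hd.2.ne he)
  obtain ⟨w, z, hdet⟩ := exists_krylovMatrix_det_ne_zero hP hT hl
  refine ⟨fun x => (krylovMatrix w z (L x)).det,
    fun x hx => analyticAt_krylovMatrix_det w z (hL x hx), ⟨x₁, hx₁, hdet⟩, fun x hx hne hd => ?_⟩
  obtain ⟨P, lam, hP, -, hT⟩ := h.exists_resolution hx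
  exact absurd hd.2 (not_lt.2 (le_of_krylovMatrix_det_ne_zero hP hT w z hne))

/-! ### Quadratic forms -/

/-- The value of a quadratic form at a vector. -/
def qev (v : Fib 𝕜 n) : Quad 𝕜 n →ₗ[𝕜] 𝕜 where
  toFun P := MvPolynomial.eval (fun i => v i) (P : MvPolynomial (Fin n) 𝕜)
  map_add' P R := by simp
  map_smul' c P := by simp [MvPolynomial.smul_eval]

/-- The field is infinite, so polynomials are determined by their values; identities between forms
are checked pointwise below. -/
theorem quad_ext {P R : Quad 𝕜 n} (h : ∀ v, qev v P = qev v R) : P = R := by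
  refine Subtype.ext (MvPolynomial.funext fun v => ?_)
  simpa [qev] using h (WithLp.toLp 2 v)

theorem continuous_qev (P : Quad 𝕜 n) : Continuous fun v : Fib 𝕜 n => qev v P := by
  refine (MvPolynomial.continuous_eval (P : MvPolynomial (Fin n) 𝕜)).comp ?_
  exact continuous_pi fun i => (EuclideanSpace.proj i : Fib 𝕜 n →L[𝕜] 𝕜).continuous

/-- The linear form `v ↦ (T v)_k`. -/
def linForm (T : Fib 𝕜 n →L[𝕜] Fib 𝕜 n) (k : Fin n) : MvPolynomial (Fin n) 𝕜 :=
  ∑ l, MvPolynomial.C (T (EuclideanSpace.single l 1) k) * MvPolynomial.X l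

theorem apply_coord (T : Fib 𝕜 n →L[𝕜] Fib 𝕜 n) (v : Fib 𝕜 n) (k : Fin n) :
    T v k = ∑ l, T (EuclideanSpace.single l 1) k * v l := by
  have hv : v = ∑ l, v l • EuclideanSpace.single l (1 : 𝕜) := by
    have := (EuclideanSpace.basisFun (Fin n) 𝕜).sum_repr v
    simpa using this.symm
  conv_lhs => rw [hv]
  simp [mul_comm]

theorem eval_linForm (T : Fib 𝕜 n →L[𝕜] Fib 𝕜 n) (k : Fin n) (v : Fib 𝕜 n) :
    MvPolynomial.eval (fun i => v i) (linForm T k) = T v k := by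
  rw [apply_coord]
  simp [linForm]

/-- The quadratic form `v ↦ (S v)_k (T v)_l`. -/
def prodForm (S T : Fib 𝕜 n →L[𝕜] Fib 𝕜 n) (k l : Fin n) : Quad 𝕜 n :=
  ⟨linForm S k * linForm T l, (rowForm_isHomogeneous (u := 0) (fun _ => S) 0 k).mul
    (rowForm_isHomogeneous (u := 0) (fun _ => T) 0 l)⟩

@[simp] theorem qev_prodForm (S T : Fib 𝕜 n →L[𝕜] Fib 𝕜 n) (k l : Fin n) (v : Fib 𝕜 n) :
    qev v (prodForm S T k l) = S v k * T v l := by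
  simp [qev, prodForm, eval_linForm]

@[simp] theorem qev_Q (ij : {p : Fin n × Fin n // p.1 < p.2}) (x : Base u) (v : Fib 𝕜 n) :
    qev v (Q L ij x) = L x v ij.1.1 * v ij.1.2 - L x v ij.1.2 * v ij.1.1 := by
  have := eval_linForm (L x) ij.1.1 v
  have h2 := eval_linForm (L x) ij.1.2 v
  simp only [linForm] at this h2
  simp [qev, Q, rowForm, ← this, ← h2]

theorem quad_eq_sum (P : Quad 𝕜 n) :
    ∃ c : Fin n × Fin n → 𝕜, ∀ v, qev v P = ∑ kl, c kl * (v kl.1 * v kl.2) := by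
  have h2 : (P : MvPolynomial (Fin n) 𝕜) ∈
      Submodule.span 𝕜 (range fun kl : Fin n × Fin n =>
        (MvPolynomial.X kl.1 * MvPolynomial.X kl.2 : MvPolynomial (Fin n) 𝕜)) := by
    obtain ⟨P, h⟩ := P
    change P ∈ _
    rw [← MvPolynomial.homogeneousSubmodule_one_pow, pow_two,
      MvPolynomial.homogeneousSubmodule_one_eq_span_X, Submodule.span_mul_span] at h
    refine Submodule.span_mono ?_ h
    rintro _ ⟨_, ⟨k, rfl⟩, _, ⟨l, rfl⟩, rfl⟩
    exact ⟨(k, l), rfl⟩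
  obtain ⟨c, hc⟩ := (Submodule.mem_span_range_iff_exists_fun 𝕜).1 h2
  refine ⟨c, fun v => ?_⟩
  change MvPolynomial.eval _ (P : MvPolynomial (Fin n) 𝕜) = _
  rw [← hc]
  simp [MvPolynomial.smul_eval]

theorem mem_J₂_iff (x : Base u) (P : Quad 𝕜 n) : P ∈ J₂ L x ↔ ∀ v ∈ EV L x, qev v P = 0 :=
  Iff.rfl

theorem qev_zero (P : Quad 𝕜 n) : qev (0 : Fib 𝕜 n) P = 0 := by
  obtain ⟨c, hc⟩ := quad_eq_sum P
  simp [hc]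

theorem Q_mem_J₂ (ij : {p : Fin n × Fin n // p.1 < p.2}) (x : Base u) : Q L ij x ∈ J₂ L x := by
  rw [mem_J₂_iff]
  rintro v ⟨μ, hμ, -⟩
  have : L x v = μ • v := Module.End.mem_eigenspace_iff.1 hμ
  simp [this]
  ring

/-! ### Quadratic forms vanishing on the eigenspaces of an operator with a known resolution -/

section Resolution

variable {s : ℕ} {P : Fin s → (Fib 𝕜 n →L[𝕜] Fib 𝕜 n)} {lam : Fin s → 𝕜} {x : Base u}

theorem mem_EV_iff (hP : IsResolution P) (hT : ∀ i, L x * P i = lam i • P i)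
    (hl : Function.Injective lam) (v : Fib 𝕜 n) : v ∈ EV L x ↔ v ≠ 0 ∧ ∃ i, P i v = v := by
  constructor
  · rintro ⟨μ, hμ⟩
    refine ⟨hμ.2, ?_⟩
    obtain ⟨i, rfl⟩ := (hasEigenvalue_iff hP hT μ).1
      (Module.End.hasEigenvalue_of_hasEigenvector hμ)
    exact ⟨i, (mem_eigenspace_iff_of_injective hP hT hl i v).1 hμ.1⟩
  · rintro ⟨h0, i, hi⟩
    exact ⟨lam i, hasEigenvector_of_mem hT hi h0⟩

theorem qev_proj_eq_zero (hP : IsResolution P) (hT : ∀ i, L x * P i = lam i • P i)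
    {R : Quad 𝕜 n} (hR : R ∈ J₂ L x) (i : Fin s) (v : Fib 𝕜 n) : qev (P i v) R = 0 := by
  by_cases h0 : P i v = 0
  · rw [h0, qev_zero]
  · exact hR _ ⟨lam i, hasEigenvector_of_mem hT (hP.apply_self i v) h0⟩

/-- An eigenvector lies in a single range, so one of the two factors vanishes on it. -/
theorem prodForm_mem_J₂ (hP : IsResolution P) (hT : ∀ i, L x * P i = lam i • P i)
    (hl : Function.Injective lam) {i j : Fin s} (hij : i ≠ j) (k l : Fin n) :
    prodForm (P i) (P j) k l ∈ J₂ L x := by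
  rw [mem_J₂_iff]
  intro v hv
  obtain ⟨-, m, hm⟩ := (mem_EV_iff hP hT hl v).1 hv
  rw [qev_prodForm, ← hm]
  by_cases him : i = m
  · rw [hP.apply_ne (fun h => hij (him.trans h.symm)) v]; simp
  · rw [hP.apply_ne him v]; simp

theorem antisymm_mem_span_Q (a b : Fin n) :
    prodForm (L x) 1 a b - prodForm (L x) 1 b a ∈
      Submodule.span 𝕜 (range fun ij => Q L ij x) := by
  rcases lt_trichotomy a b with h | h | h
  · refine Submodule.subset_span ⟨⟨(a, b), h⟩, quad_ext fun v => ?_⟩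
    simp
  · subst h
    rw [sub_self]; exact zero_mem _
  · rw [← neg_sub]
    refine neg_mem (Submodule.subset_span ⟨⟨(b, a), h⟩, quad_ext fun v => ?_⟩)
    simp

/-- Applying `P i ⊗ P j` to `L v ⊗ v - v ⊗ L v` gives `(λ_i - λ_j) P_i v ⊗ P_j v`, because `P_i L =
λ_i P_i`. The eigenvalues being distinct, one may divide. -/
theorem prodForm_mem_span_Q (hP : IsResolution P) (hT : ∀ i, L x * P i = lam i • P i)
    (hl : Function.Injective lam) {i j : Fin s} (hij : i ≠ j) (k l : Fin n) :
    prodForm (P i) (P j) k l ∈ Submodule.span 𝕜 (range fun ij => Q L ij x) := by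
  have hne : lam i - lam j ≠ 0 := sub_ne_zero.2 (hl.ne hij)
  rw [← Submodule.smul_mem_iff _ hne]
  have key : (lam i - lam j) • prodForm (P i) (P j) k l =
      ∑ a, ∑ b, (P i (EuclideanSpace.single a 1) k * P j (EuclideanSpace.single b 1) l) •
        (prodForm (L x) 1 a b - prodForm (L x) 1 b a) := by
    refine quad_ext fun v => ?_
    have e1 : ∀ i k, lam i * P i v k = ∑ a, P i (EuclideanSpace.single a 1) k * L x v a := by
      intro i k
      rw [← apply_coord, proj_apply_eq hP hT]
      simp
    simp only [map_smul, map_sum, map_sub, qev_prodForm, smul_eq_mul,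
      one_apply_eq_self]
    have e2 : (lam i - lam j) * (P i v k * P j v l) =
        (lam i * P i v k) * P j v l - P i v k * (lam j * P j v l) := by ring
    rw [e2, e1, e1, apply_coord (P i) v k, apply_coord (P j) v l, Finset.sum_mul_sum,
      Finset.sum_mul_sum, ← Finset.sum_sub_distrib]
    refine Finset.sum_congr rfl fun a _ => ?_
    rw [← Finset.sum_sub_distrib]
    refine Finset.sum_congr rfl fun b _ => ?_
    ring
  rw [key]
  exact Submodule.sum_mem _ fun a _ => Submodule.sum_mem _ fun b _ =>
    Submodule.smul_mem _ _ (antisymm_mem_span_Q a b)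

/-- Substituting `v = Σ P_i v` in a form `R` splits it into diagonal terms `R(P_i v)`, which vanish,
and cross terms, which are products as in `prodForm_mem_span_Q`. -/
theorem J₂_eq_span (hP : IsResolution P) (hT : ∀ i, L x * P i = lam i • P i)
    (hl : Function.Injective lam) :
    J₂ L x = Submodule.span 𝕜 (range fun ij => Q L ij x) := by
  refine le_antisymm (fun R hR => ?_) (Submodule.span_le.2 ?_)
  · obtain ⟨c, hc⟩ := quad_eq_sum R
    have key : R = ∑ i, ∑ j, if i = j then 0 else
        ∑ kl : Fin n × Fin n, c kl • prodForm (P i) (P j) kl.1 kl.2 := by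
      refine quad_ext fun v => ?_
      have e1 : ∀ k, v k = ∑ i, P i v k := by
        intro k
        conv_lhs => rw [← hP.sum_proj v]
        simp
      have e2 : qev v R = ∑ i, ∑ j, ∑ kl : Fin n × Fin n, c kl * (P i v kl.1 * P j v kl.2) := by
        rw [hc]
        conv_lhs =>
          enter [2, kl]
          rw [e1 kl.1, e1 kl.2, Finset.sum_mul_sum, Finset.mul_sum]
          enter [2, i]
          rw [Finset.mul_sum]
        rw [Finset.sum_comm]
        refine Finset.sum_congr rfl fun i _ => ?_
        rw [Finset.sum_comm]
      rw [e2, map_sum]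
      refine Finset.sum_congr rfl fun i _ => ?_
      rw [map_sum]
      refine Finset.sum_congr rfl fun j _ => ?_
      split_ifs with hij
      · subst hij
        rw [← hc, qev_proj_eq_zero hP hT hR, map_zero]
      · simp
    rw [key]
    refine Submodule.sum_mem _ fun i _ => Submodule.sum_mem _ fun j _ => ?_
    split_ifs with hij
    · exact zero_mem _
    · exact Submodule.sum_mem _ fun kl _ =>
        Submodule.smul_mem _ _ (prodForm_mem_span_Q hP hT hl hij _ _)
  · rintro _ ⟨ij, rfl⟩
    exact Q_mem_J₂ ij x

end Resolution

instance : FiniteDimensional 𝕜 (Quad 𝕜 n) := by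
  have hfin : FiniteDimensional 𝕜 (Submodule.span 𝕜 (range fun kl : Fin n × Fin n =>
      prodForm (1 : Fib 𝕜 n →L[𝕜] Fib 𝕜 n) 1 kl.1 kl.2)) :=
    FiniteDimensional.span_of_finite 𝕜 (finite_range _)
  have htop : Submodule.span 𝕜 (range fun kl : Fin n × Fin n =>
      prodForm (1 : Fib 𝕜 n →L[𝕜] Fib 𝕜 n) 1 kl.1 kl.2) = ⊤ := by
    rw [eq_top_iff]
    rintro P -
    obtain ⟨c, hc⟩ := quad_eq_sum P
    refine (Submodule.mem_span_range_iff_exists_fun 𝕜).2 ⟨c, quad_ext fun v => ?_⟩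
    simp [hc]
  rw [htop] at hfin
  exact Submodule.topEquiv.finiteDimensional

/-! ### Minors of maximal size -/

theorem finrank_J₂_le (hx : x ∈ U \ discLocus U L) : Module.finrank 𝕜 (J₂ L x) ≤ dGen U L := by
  refine le_csSup ⟨Module.finrank 𝕜 (Quad 𝕜 n), ?_⟩ ⟨x, hx, rfl⟩
  rintro _ ⟨y, -, rfl⟩
  exact Submodule.finrank_le _

/-- A left inverse of the map `𝕜ᵈ → V` defined by `f` supplies `d` functionals dual to `f`; the
pairing of their wedge with that of `f` is the determinant of the identity matrix. -/
theorem exists_ne_zero_of_linearIndependent {V : Type*} [AddCommGroup V] [Module 𝕜 V] {d : ℕ}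
    {f : Fin d → V} (hf : LinearIndependent 𝕜 f) :
    ∃ c : Module.Dual 𝕜 (⋀[𝕜]^d V), c (exteriorPower.ιMulti 𝕜 d f) ≠ 0 := by
  obtain ⟨g, hg⟩ := LinearMap.exists_leftInverse_of_injective
    (Fintype.linearCombination 𝕜 f) (LinearMap.ker_eq_bot.2
      (linearIndependent_iff_injective_fintypeLinearCombination.1 hf))
  have hgf : ∀ i, g (f i) = Pi.single i 1 := by
    intro i
    have := congrArg (fun h => h (Pi.single i 1)) hg
    simpa using this
  refine ⟨exteriorPower.pairingDual 𝕜 V d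
    (exteriorPower.ιMulti 𝕜 d fun j => (LinearMap.proj j).comp g), ?_⟩
  rw [exteriorPower.pairingDual_ιMulti_ιMulti]
  have : (Matrix.of fun i j => ((LinearMap.proj j).comp g : Module.Dual 𝕜 V) (f i)) =
      (1 : Matrix (Fin d) (Fin d) 𝕜) := by
    ext i j
    simp [hgf, Matrix.one_apply, Pi.single_apply, eq_comm]
  rw [this]
  simp

theorem linearIndependent_of_ne_zero {V : Type*} [AddCommGroup V] [Module 𝕜 V] {d : ℕ}
    {f : Fin d → V} (hf : exteriorPower.ιMulti 𝕜 d f ≠ 0) : LinearIndependent 𝕜 f := by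
  by_contra hc
  exact hf (AlternatingMap.map_linearDependent _ _ hc)

/-- Some minor of maximal size does not vanish identically. -/
theorem IsNormalFamily.exists_minor_ne_zero (h : IsNormalFamily U L) (hne : U.Nonempty)
    (hL : AnalyticOnNhd ℝ L U) :
    ∃ x ∈ U, ∃ (I : Fin (dGen U L) → {p : Fin n × Fin n // p.1 < p.2})
      (c : Module.Dual 𝕜 (WedgeQuad 𝕜 n (dGen U L))), c (wedgeQ L I x) ≠ 0 := by
  obtain ⟨φ, -, ⟨x₀, hx₀, hφ₀⟩, hφ⟩ := h.exists_discriminant hne hL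
  -- The supremum defining `dGen` is attained: the set is bounded, and non-empty because some point
  -- lies off the discriminant locus.
  have hmem : dGen U L ∈ (fun x => Module.finrank 𝕜 (J₂ L x)) '' (U \ discLocus U L) := by
    refine Nat.sSup_mem ⟨_, x₀, ⟨hx₀, hφ x₀ hx₀ hφ₀⟩, rfl⟩ ⟨Module.finrank 𝕜 (Quad 𝕜 n), ?_⟩
    rintro _ ⟨y, -, rfl⟩
    exact Submodule.finrank_le _
  obtain ⟨x, ⟨hx, hd⟩, he⟩ := hmem
  refine ⟨x, hx, ?_⟩
  obtain ⟨P, lam, hP, hl, hT⟩ := h.exists_resolution_of_notMem hx hd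
  have he : Module.finrank 𝕜 (Submodule.span 𝕜 (range fun ij => Q L ij x)) = dGen U L := by
    rw [← J₂_eq_span hP hT hl]; exact he
  obtain ⟨f, hf, -, hli⟩ := Submodule.exists_fun_fin_finrank_span_eq 𝕜 (range fun ij => Q L ij x)
  choose I hI using hf
  have hli' : LinearIndependent 𝕜 fun a => Q L (I (Fin.cast he.symm a)) x := by
    have := hli.comp (Fin.cast he.symm) (Fin.cast_injective _)
    simp only [hI]
    exact this
  exact ⟨_, exists_ne_zero_of_linearIndependent hli'⟩

end

end EigenBouquet

namespace EigenBouquet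

noncomputable section

/-! ### Projection onto the space of a decomposable multivector -/

section Reduction

variable {K V : Type*} [Field K] [AddCommGroup V] [Module K V] {d : ℕ}

/-- The alternating map `(P, v₁, …, v_d) ↦ c(v₁ ∧ … ∧ v_d) P - Σ ± c(P ∧ …) v_a`. -/
def contraction (c : Module.Dual K (⋀[K]^d V)) : V [⋀^Fin (d + 1)]→ₗ[K] V :=
  AlternatingMap.alternatizeUncurryFin
    { toFun := fun P => (LinearMap.toSpanSingleton K V P).compAlternatingMap
        (c.compAlternatingMap (exteriorPower.ιMulti K d))
      map_add' := fun P R => by ext v; simp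
      map_smul' := fun r P => by ext v; simp [smul_comm r] }

/-- In the alternating sum the term removing `P` is `c(v₁ ∧ … ∧ v_d) P`; every other term is a
multiple of some `v_a`. -/
theorem contraction_cons (c : Module.Dual K (⋀[K]^d V)) (P : V) (v : Fin d → V) :
    c (exteriorPower.ιMulti K d v) • P - contraction c (Fin.cons P v : Fin (d + 1) → V) ∈
      Submodule.span K (range v) := by
  rw [contraction, AlternatingMap.alternatizeUncurryFin_apply, Fin.sum_univ_succ]
  have h0 : Fin.removeNth (0 : Fin (d + 1)) (Fin.cons P v : Fin (d + 1) → V) = v := by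
    ext i; simp [Fin.removeNth]
  simp only [Fin.val_zero, pow_zero, one_smul, Fin.cons_zero, h0, LinearMap.coe_mk,
    AddHom.coe_mk, LinearMap.compAlternatingMap_apply, LinearMap.toSpanSingleton_apply,
    Fin.cons_succ]
  rw [sub_add_cancel_left]
  refine neg_mem (Submodule.sum_mem _ fun i _ => ?_)
  have h1 : ∀ (m : ℕ) (z : V), z ∈ Submodule.span K (range v) →
      (-1 : ℤ) ^ m • z ∈ Submodule.span K (range v) := fun m z hz =>
    zsmul_mem hz _
  exact h1 _ _ (Submodule.smul_mem _ _ (Submodule.subset_span ⟨i, rfl⟩))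

/-- The linear extension of `contraction` to the exterior algebra. -/
def contractionLift (c : Module.Dual K (⋀[K]^d V)) : ExteriorAlgebra K V →ₗ[K] V :=
  ExteriorAlgebra.liftAlternating (Pi.single (d + 1) (contraction c))

/-- Being alternating in all `d + 1` arguments, `contraction` depends only on `P ∧ v₁ ∧ … ∧ v_d`. It
can therefore be evaluated on `P ∧ w` for an arbitrary `d`-vector `w`, linearly in `w`. -/
theorem contractionLift_ι_mul (c : Module.Dual K (⋀[K]^d V)) (P : V) (v : Fin d → V) :
    contractionLift c (ExteriorAlgebra.ι K P * (exteriorPower.ιMulti K d v : ExteriorAlgebra K V)) =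
      contraction c (Fin.cons P v : Fin (d + 1) → V) := by
  have : ExteriorAlgebra.ι K P * (exteriorPower.ιMulti K d v : ExteriorAlgebra K V) =
      ExteriorAlgebra.ιMulti K (d + 1) (Fin.cons P v : Fin (d + 1) → V) := by
    rw [ExteriorAlgebra.ιMulti_succ_apply]
    simp [Matrix.vecTail, Function.comp_def]
  rw [this, contractionLift, ExteriorAlgebra.liftAlternating_apply_ιMulti, Pi.single_eq_same]

/-- The exterior product with a fixed vector, on the left. -/
def wedgeLeft (P : V) : ⋀[K]^d V →ₗ[K] ExteriorAlgebra K V :=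
  (LinearMap.mulLeft K (ExteriorAlgebra.ι K P)).comp (Submodule.subtype _)

/-- If `w` is decomposable and `c(w) = 1`, a projection onto the space of `w`. -/
def reduction (c : Module.Dual K (⋀[K]^d V)) (w : ⋀[K]^d V) : V →ₗ[K] V :=
  LinearMap.id - (contractionLift c).comp
    ((LinearMap.mulRight K (w : ExteriorAlgebra K V)).comp (ExteriorAlgebra.ι K))

theorem reduction_apply (c : Module.Dual K (⋀[K]^d V)) (w : ⋀[K]^d V) (P : V) :
    reduction c w P = P - contractionLift c (ExteriorAlgebra.ι K P * (w : ExteriorAlgebra K V)) :=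
  rfl

theorem reduction_apply' (c : Module.Dual K (⋀[K]^d V)) (w : ⋀[K]^d V) (P : V) :
    reduction c w P = P - contractionLift c (wedgeLeft P w) :=
  rfl

theorem reduction_eq_self {c : Module.Dual K (⋀[K]^d V)} {w : ⋀[K]^d V} {P : V}
    (h : ExteriorAlgebra.ι K P * (w : ExteriorAlgebra K V) = 0) : reduction c w P = P := by
  rw [reduction_apply, h, map_zero, sub_zero]

/-- After multiplication by `c(v₁ ∧ … ∧ v_d)`, the vector `w` becomes the wedge of the `v_a`, and
the claim is `contraction_cons`. -/
theorem reduction_mem_span {c : Module.Dual K (⋀[K]^d V)} {w : ⋀[K]^d V} {v : Fin d → V}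
    (hv : exteriorPower.ιMulti K d v = c (exteriorPower.ιMulti K d v) • w)
    (hc : c (exteriorPower.ιMulti K d v) ≠ 0) (P : V) :
    reduction c w P ∈ Submodule.span K (range v) := by
  rw [← Submodule.smul_mem_iff _ hc]
  have h := contraction_cons c P v
  rw [← contractionLift_ι_mul] at h
  convert h using 1
  rw [reduction_apply, smul_sub]
  congr 1
  conv_rhs => rw [hv]
  rw [Submodule.coe_smul, mul_smul_comm, map_smul]

theorem ι_mul_ιMulti_eq_zero {v : Fin d → V} {P : V} (hP : P ∈ Submodule.span K (range v)) :
    ExteriorAlgebra.ι K P * (exteriorPower.ιMulti K d v : ExteriorAlgebra K V) = 0 := by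
  induction hP using Submodule.span_induction with
  | mem x hx =>
    obtain ⟨a, rfl⟩ := hx
    have : ExteriorAlgebra.ι K (v a) * (exteriorPower.ιMulti K d v : ExteriorAlgebra K V) =
        ExteriorAlgebra.ιMulti K (d + 1) (Fin.cons (v a) v : Fin (d + 1) → V) := by
      rw [ExteriorAlgebra.ιMulti_succ_apply]
      simp [Matrix.vecTail, Function.comp_def]
    rw [this]
    refine ExteriorAlgebra.ιMulti_eq_zero_of_not_inj fun hinj => ?_
    have := @hinj 0 a.succ (by simp)
    exact (Fin.succ_ne_zero a) this.symm
  | zero => simp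
  | add x y _ _ hx hy => rw [map_add, add_mul, hx, hy, add_zero]
  | smul r x _ hx => rw [map_smul, smul_mul_assoc, hx, smul_zero]

/-- In a subspace of dimension at most `d`, all `d`-vectors are multiples of a non-zero one. -/
theorem exists_ιMulti_eq_smul {S : Submodule K V} [FiniteDimensional K S]
    (hS : Module.finrank K S ≤ d) {v v' : Fin d → V} (hv : ∀ a, v a ∈ S) (hv' : ∀ a, v' a ∈ S)
    (hne : LinearIndependent K v) :
    S = Submodule.span K (range v) ∧
      ∃ δ : K, exteriorPower.ιMulti K d v' = δ • exteriorPower.ιMulti K d v := by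
  let vS : Fin d → S := fun a => ⟨v a, hv a⟩
  have hli : LinearIndependent K vS := LinearIndependent.of_comp S.subtype hne
  have hcard : Fintype.card (Fin d) = Module.finrank K S :=
    le_antisymm hli.fintype_card_le_finrank (by simpa using hS)
  have htop : Submodule.span K (range vS) = ⊤ := hli.span_eq_top_of_card_eq_finrank' hcard
  let e : Module.Basis (Fin d) K S := Module.Basis.mk hli htop.ge
  refine ⟨?_, e.det fun a => ⟨v' a, hv' a⟩, ?_⟩
  · have h1 := congrArg (Submodule.map S.subtype) htop
    rw [Submodule.map_span, Submodule.map_top, Submodule.range_subtype, ← range_comp] at h1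
    exact h1.symm
  -- Functionals separate `d`-vectors, and each restricts to an alternating form in top degree on
  -- `S`, hence to a multiple of the determinant in the basis `v`.
  · rw [← sub_eq_zero, ← Module.forall_dual_apply_eq_zero_iff K]
    intro c
    rw [map_sub, map_smul, sub_eq_zero]
    have h1 := AlternatingMap.eq_smul_basis_det e
      ((c.compAlternatingMap (exteriorPower.ιMulti K d)).compLinearMap S.subtype)
    have h2 := congrArg (fun f => f fun a => (⟨v' a, hv' a⟩ : S)) h1
    simp only [AlternatingMap.compLinearMap_apply, LinearMap.compAlternatingMap_apply,
      AlternatingMap.smul_apply, smul_eq_mul] at h2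
    rw [smul_eq_mul, mul_comm]
    have hev : v = fun i => S.subtype (e i) := funext fun i => by simp [e, vS]
    rw [hev]
    exact h2

end Reduction

end

end EigenBouquet

namespace EigenBouquet

noncomputable section

variable {𝕜 : Type*} [RCLike 𝕜] {u n : ℕ} {U : Set (Base u)} {L : OpFamily 𝕜 u n}

/-! ### The local ring of analytic germs -/

/-- Evaluation at `y` is a local homomorphism to a field: a germ with non-zero value has an analytic
inverse. -/
theorem isLocalRing_Ostalk (y : Base u) : IsLocalRing (Ostalk 𝕜 y) := by
  let ev : Ostalk 𝕜 y →+* 𝕜 := (Germ.valueRingHom (x := y)).comp (Ostalk 𝕜 y).subtype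
  have : IsLocalHom ev := by
    constructor
    rintro ⟨_, f, hf, rfl⟩ hu
    have h0 : f y ≠ 0 := hu.ne_zero
    refine IsUnit.of_mul_eq_one ⟨_, f⁻¹, hf.inv h0, rfl⟩ (Subtype.ext ?_)
    refine Germ.coe_eq.2 ?_
    filter_upwards [hf.continuousAt.eventually_ne h0] with x hx
    exact mul_inv_cancel₀ hx
  exact RingHom.domain_isLocalRing ev

/-- This is Nakayama's argument. If every element of `S` were in `𝔪 a`, then `a` itself would be,
forcing `a = 0`; so some element of `S` is a unit times `a`. -/
theorem exists_generator_of_span {R : Type*} [CommRing R] [IsLocalRing R] {S : Set R}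
    (h : (Ideal.span S).IsPrincipal) (h0 : ∃ m ∈ S, m ≠ 0) :
    ∃ m ∈ S, ∀ m' ∈ S, ∃ b, m' = b * m := by
  obtain ⟨a, ha⟩ := h.principal
  change Ideal.span S = Ideal.span {a} at ha
  by_cases hS : ∀ m ∈ S, ∃ t ∈ IsLocalRing.maximalIdeal R, m = t * a
  · exfalso
    have h1 : ∀ z ∈ Ideal.span S, ∃ t ∈ IsLocalRing.maximalIdeal R, z = t * a := by
      intro z hz
      induction hz using Submodule.span_induction with
      | mem x hx => exact hS x hx
      | zero => exact ⟨0, zero_mem _, by simp⟩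
      | add x y _ _ hx hy =>
        obtain ⟨t, ht, rfl⟩ := hx
        obtain ⟨t', ht', rfl⟩ := hy
        exact ⟨t + t', add_mem ht ht', by ring⟩
      | smul r x _ hx =>
        obtain ⟨t, ht, rfl⟩ := hx
        exact ⟨r * t, Ideal.mul_mem_left _ _ ht, by simp [mul_assoc]⟩
    obtain ⟨t, ht, hta⟩ := h1 a (by rw [ha]; exact Ideal.mem_span_singleton_self a)
    -- From `a = t a` with `t` in the maximal ideal, `(1 - t) a = 0` with `1 - t` invertible.
    have hu : IsUnit (1 - t) := by
      by_contra hc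
      exact (IsLocalRing.maximalIdeal.isMaximal R).ne_top ((Ideal.eq_top_iff_one _).2 (by
        have := add_mem ((IsLocalRing.mem_maximalIdeal _).2 hc) ht
        simp at this))
    have ha0 : a = 0 := by
      refine (hu.mul_right_eq_zero).1 ?_
      rw [sub_mul, one_mul, ← hta, sub_self]
    obtain ⟨m, hm, hm0⟩ := h0
    obtain ⟨t, -, rfl⟩ := hS m hm
    exact hm0 (by rw [ha0, mul_zero])
  · push Not at hS
    obtain ⟨m, hm, hmt⟩ := hS
    refine ⟨m, hm, fun m' hm' => ?_⟩
    have h2 : ∀ z ∈ S, ∃ b, z = b * a := fun z hz => by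
      have : z ∈ Ideal.span {a} := by rw [← ha]; exact Ideal.subset_span hz
      obtain ⟨b, hb⟩ := Ideal.mem_span_singleton'.1 this
      exact ⟨b, hb.symm⟩
    obtain ⟨b, rfl⟩ := h2 m hm
    obtain ⟨b', rfl⟩ := h2 m' hm'
    have hb : IsUnit b := by
      by_contra hc
      exact hmt b ((IsLocalRing.mem_maximalIdeal _).2 hc) rfl
    obtain ⟨v, rfl⟩ := hb
    exact ⟨b' * (v⁻¹ : Rˣ), by simp [mul_assoc]⟩

/-! ### Analyticity of the minors -/

theorem analyticAt_dual_Q {y : Base u} (hL : AnalyticAt ℝ L y)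
    (ij : {p : Fin n × Fin n // p.1 < p.2}) (ℓ : Module.Dual 𝕜 (Quad 𝕜 n)) :
    AnalyticAt ℝ (fun x => ℓ (Q L ij x)) y := by
  have key : ∀ x, Q L ij x =
      ∑ k, (L x (EuclideanSpace.single k 1) ij.1.1 • prodForm 1 1 k ij.1.2 -
        L x (EuclideanSpace.single k 1) ij.1.2 • prodForm 1 1 k ij.1.1) := by
    intro x
    refine quad_ext fun v => ?_
    rw [qev_Q, apply_coord (L x) v, apply_coord (L x) v, Finset.sum_mul, Finset.sum_mul,
      ← Finset.sum_sub_distrib, map_sum]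
    refine Finset.sum_congr rfl fun k _ => ?_
    simp [mul_assoc]
  have ha : ∀ k i, AnalyticAt ℝ (fun x => L x (EuclideanSpace.single k 1) i) y := fun k i =>
    analyticAt_coord (analyticAt_apply hL analyticAt_const) i
  simp only [key, map_sum, map_sub, map_smul, smul_eq_mul]
  exact Finset.analyticAt_fun_sum _ fun k _ =>
    ((ha k _).mul analyticAt_const).sub ((ha k _).mul analyticAt_const)

/-- Multilinear expansion in a basis writes each coefficient as a polynomial in the coordinates of
the `Q_{i,j}`. -/
theorem analyticAt_wedgeQ {y : Base u} (hL : AnalyticAt ℝ L y) {d : ℕ}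
    (I : Fin d → {p : Fin n × Fin n // p.1 < p.2}) (c : Module.Dual 𝕜 (WedgeQuad 𝕜 n d)) :
    AnalyticAt ℝ (fun x => c (wedgeQ L I x)) y := by
  let e := Module.finBasis 𝕜 (Quad 𝕜 n)
  have key : ∀ x, c (wedgeQ L I x) = ∑ r : Fin d → Fin (Module.finrank 𝕜 (Quad 𝕜 n)),
      (∏ a, e.coord (r a) (Q L (I a) x)) * c (exteriorPower.ιMulti 𝕜 d fun a => e (r a)) := by
    intro x
    let f := (c.compAlternatingMap (exteriorPower.ιMulti 𝕜 d)).toMultilinearMap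
    have h1 : c (wedgeQ L I x) = f fun a => ∑ k, e.coord k (Q L (I a) x) • e k := by
      simp only [Module.Basis.coord_apply, e.sum_repr]
      rfl
    rw [h1, MultilinearMap.map_sum]
    refine Finset.sum_congr rfl fun r _ => ?_
    rw [MultilinearMap.map_smul_univ]
    rfl
  simp only [key]
  exact Finset.analyticAt_fun_sum _ fun r _ =>
    (Finset.analyticAt_fun_prod _ fun a _ => analyticAt_dual_Q hL _ _).mul analyticAt_const

/-! ### A local generator of the Fitting ideal -/

/-- Local generator: the minor `c₀` of the rows `I₀` divides all the others near `y`. -/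
theorem IsNormalFamily.exists_local_generator (h : IsNormalFamily U L) (hUo : IsOpen U)
    (hUc : IsPreconnected U) (hL : AnalyticOnNhd ℝ L U) {y : Base u} (hy : y ∈ U)
    (hp : (fittingStalk U L y).IsPrincipal) :
    ∃ W : Set (Base u), IsOpen W ∧ y ∈ W ∧ W ⊆ U ∧
      ∃ (I₀ : Fin (dGen U L) → {p : Fin n × Fin n // p.1 < p.2})
        (c₀ : Module.Dual 𝕜 (WedgeQuad 𝕜 n (dGen U L)))
        (w : (Fin (dGen U L) → {p : Fin n × Fin n // p.1 < p.2}) → Base u →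
          WedgeQuad 𝕜 n (dGen U L)),
        (∃ x ∈ U, c₀ (wedgeQ L I₀ x) ≠ 0) ∧
        (∀ I (c : Module.Dual 𝕜 (WedgeQuad 𝕜 n (dGen U L))),
          AnalyticOnNhd ℝ (fun x => c (w I x)) W) ∧
        ∀ I, ∀ x ∈ W, wedgeQ L I x = c₀ (wedgeQ L I₀ x) • w I x := by
  have := isLocalRing_Ostalk (𝕜 := 𝕜) y
  have han : ∀ I (c : Module.Dual 𝕜 (WedgeQuad 𝕜 n (dGen U L))), AnalyticAt ℝ (fun x => c (wedgeQ L I x)) y := fun I c =>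
    analyticAt_wedgeQ (d := dGen U L) (hL y hy) I c
  -- Nakayama's argument needs a non-zero generator of the stalk. A minor that is non-zero somewhere
  -- in `U` has a non-zero germ at `y`, by the identity theorem.
  obtain ⟨x₁, hx₁, I₁, c₁, hne₁⟩ := h.exists_minor_ne_zero ⟨y, hy⟩ hL
  have hfr := frequently_ne_zero hUc
    (fun z hz => analyticAt_wedgeQ (d := dGen U L) (hL z hz) I₁ c₁) hx₁ hne₁ hy
  obtain ⟨m, ⟨I₀, c₀, hm⟩, hgen⟩ := exists_generator_of_span hp
    ⟨⟨_, _, han I₁ c₁, rfl⟩, ⟨I₁, c₁, rfl⟩, fun h0 => hfr (by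
      filter_upwards [Germ.coe_eq.1 (congrArg Subtype.val h0)] with x hx
      simpa using hx)⟩
  let e := Module.finBasis 𝕜 (WedgeQuad 𝕜 n (dGen U L))
  have hb : ∀ I (c : Module.Dual 𝕜 (WedgeQuad 𝕜 n (dGen U L))), ∃ b : Base u → 𝕜, AnalyticAt ℝ b y ∧
      ∀ᶠ x in 𝓝 y, c (wedgeQ L I x) = b x * c₀ (wedgeQ L I₀ x) := by
    intro I c
    obtain ⟨⟨_, b, hb, rfl⟩, hbm⟩ := hgen ⟨_, _, han I c, rfl⟩ ⟨I, c, rfl⟩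
    refine ⟨b, hb, Germ.coe_eq.1 (?_ : _ = ((fun x => b x * c₀ (wedgeQ L I₀ x) :
      Base u → 𝕜) : Germ (𝓝 y) 𝕜))⟩
    have := congrArg Subtype.val hbm
    simp only [Subring.coe_mul, hm] at this
    exact this
  choose b hban hbeq using hb
  -- There are finitely many `I` and basis indices `k`, so one neighbourhood serves all the
  -- quotients.
  have hev : ∀ᶠ x in 𝓝 y, x ∈ U ∧ ∀ I k, AnalyticAt ℝ (b I (e.coord k)) x ∧
      e.coord k (wedgeQ L I x) = b I (e.coord k) x * c₀ (wedgeQ L I₀ x) := by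
    refine (hUo.eventually_mem hy).and (eventually_all.2 fun I => eventually_all.2 fun k => ?_)
    exact (hban I _).eventually_analyticAt.and (hbeq I _)
  obtain ⟨W, hW, hWo, hyW⟩ := eventually_nhds_iff.1 hev
  have hweq : ∀ I, ∀ x ∈ W, wedgeQ L I x =
      c₀ (wedgeQ L I₀ x) • ∑ k, b I (e.coord k) x • e k := by
    intro I x hx
    rw [Finset.smul_sum]
    conv_lhs => rw [← e.sum_repr (wedgeQ L I x)]
    refine Finset.sum_congr rfl fun k _ => ?_
    rw [smul_smul, mul_comm, ← ((hW x hx).2 I k).2]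
    rfl
  refine ⟨W, hWo, hyW, fun x hx => (hW x hx).1, I₀, c₀,
    fun I x => ∑ k, b I (e.coord k) x • e k, ?_, fun I c x hx => ?_, hweq⟩
  · by_contra! hc
    refine hfr ?_
    filter_upwards [hWo.mem_nhds hyW] with x hx
    rw [not_not, hweq I₁ x hx, hc x (hW x hx).1, zero_smul, map_zero]
  · simp only [map_sum, map_smul, smul_eq_mul]
    exact Finset.analyticAt_fun_sum _ fun k _ => (((hW x hx).2 I k).1).mul analyticAt_const

end

end EigenBouquet

namespace EigenBouquet

noncomputable section

variable {𝕜 : Type*} [RCLike 𝕜] {u n : ℕ} {U : Set (Base u)} {L : OpFamily 𝕜 u n}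

/-! ### The weak transform and the spaces `J'` -/

/-- A local description of `J'`: the `d`-vector `w`, which at generic points is a non-zero multiple
of the wedge product of a basis of `J₂`. -/
structure LocalPlucker (U : Set (Base u)) (L : OpFamily 𝕜 u n) (W : Set (Base u))
    (I₀ : Fin (dGen U L) → {p : Fin n × Fin n // p.1 < p.2})
    (c₀ : Module.Dual 𝕜 (WedgeQuad 𝕜 n (dGen U L))) (φ : Base u → 𝕜)
    (w : (Fin (dGen U L) → {p : Fin n × Fin n // p.1 < p.2}) → Base u →
      WedgeQuad 𝕜 n (dGen U L)) : Prop where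
  isOpen : IsOpen W
  subset : W ⊆ U
  analytic : AnalyticOnNhd ℝ L U
  frequently : ∀ z ∈ U, ∃ᶠ x in 𝓝 z, φ x ≠ 0 ∧ c₀ (wedgeQ L I₀ x) ≠ 0
  notMem : ∀ x ∈ U, φ x ≠ 0 → x ∉ discLocus U L
  analytic_w : ∀ I (c : Module.Dual 𝕜 (WedgeQuad 𝕜 n (dGen U L))),
    AnalyticOnNhd ℝ (fun x => c (w I x)) W
  wedge_eq : ∀ I, ∀ x ∈ W, wedgeQ L I x = c₀ (wedgeQ L I₀ x) • w I x

theorem IsNormalFamily.exists_localPlucker (h : IsNormalFamily U L) (hUo : IsOpen U)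
    (hUc : IsPreconnected U) (hL : AnalyticOnNhd ℝ L U) {y : Base u} (hy : y ∈ U)
    (hp : (fittingStalk U L y).IsPrincipal) :
    ∃ W I₀ c₀ φ w, y ∈ W ∧ LocalPlucker U L W I₀ c₀ φ w := by
  obtain ⟨W, hWo, hyW, hWU, I₀, c₀, w, ⟨x₁, hx₁, hne₁⟩, haw, hw⟩ :=
    h.exists_local_generator hUo hUc hL hy hp
  obtain ⟨φ, hφ, ⟨x₀, hx₀, hφ₀⟩, hφd⟩ := h.exists_discriminant ⟨y, hy⟩ hL
  refine ⟨W, I₀, c₀, φ, w, hyW, hWo, hWU, hL, fun z hz hc => ?_, hφd, haw, hw⟩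
  -- Both functions must be non-zero at one point: find `x` with `φ x ≠ 0`, then move to a nearby
  -- zero-free point of the minor, where `φ` is still non-zero.
  obtain ⟨N, hN, hNo, hzN⟩ := eventually_nhds_iff.1 (hc.and (hUo.eventually_mem hz))
  obtain ⟨x, hφx, hx⟩ := ((frequently_ne_zero hUc hφ hx₀ hφ₀ hz).and_eventually
    (hNo.eventually_mem hzN)).exists
  have hxU := (hN x hx).2
  obtain ⟨x', hx', h1, h2⟩ := ((frequently_ne_zero hUc
    (fun z hz => analyticAt_wedgeQ (d := dGen U L) (hL z hz) I₀ c₀) hx₁ hne₁ hxU).and_eventually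
    ((((hφ x hxU).continuousAt.eventually_ne hφx)).and (hNo.eventually_mem hx))).exists
  exact (hN x' h2).1 ⟨h1, hx'⟩

/-- Testing on functionals allows continuity arguments in `V` without choosing a topology on it. -/
theorem eq_of_forall_dual_frequently {V : Type*} [AddCommGroup V] [Module 𝕜 V]
    {f g : Base u → V} {y : Base u}
    (hf : ∀ c : Module.Dual 𝕜 V, ContinuousAt (fun x => c (f x)) y)
    (hg : ∀ c : Module.Dual 𝕜 V, ContinuousAt (fun x => c (g x)) y)
    (h : ∃ᶠ x in 𝓝 y, f x = g x) : f y = g y := by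
  rw [← sub_eq_zero, ← Module.forall_dual_apply_eq_zero_iff 𝕜]
  intro c
  rw [map_sub, sub_eq_zero]
  exact eq_of_frequently_eq (hf c) (hg c) (h.mono fun x hx => congrArg c hx)

namespace LocalPlucker

variable {W : Set (Base u)} {I₀ : Fin (dGen U L) → {p : Fin n × Fin n // p.1 < p.2}}
  {c₀ : Module.Dual 𝕜 (WedgeQuad 𝕜 n (dGen U L))} {φ : Base u → 𝕜}
  {w : (Fin (dGen U L) → {p : Fin n × Fin n // p.1 < p.2}) → Base u →
      WedgeQuad 𝕜 n (dGen U L)}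

/-- Applying `c₀` to `Q_{I₀} = m w_{I₀}` with `m = c₀(Q_{I₀})` gives `m = m c₀(w_{I₀})`; cancel `m`
at generic points and pass to the limit. In particular `w_{I₀}` never vanishes on `W`. -/
theorem coeff_eq_one (h : LocalPlucker U L W I₀ c₀ φ w) {x : Base u} (hx : x ∈ W) :
    c₀ (w I₀ x) = 1 := by
  refine eq_of_frequently_eq (f := fun x => c₀ (w I₀ x)) (g := fun _ => (1 : 𝕜))
    (h.analytic_w I₀ c₀ x hx).continuousAt continuousAt_const ?_
  refine ((h.frequently x (h.subset hx)).and_eventually (h.isOpen.eventually_mem hx)).mono ?_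
  rintro z ⟨⟨-, hz⟩, hzW⟩
  have := congrArg c₀ (h.wedge_eq I₀ z hzW)
  rw [map_smul, smul_eq_mul] at this
  exact (mul_left_cancel₀ hz (by rw [mul_one]; exact this)).symm

/-- A non-zero minor makes the `d` forms `Q_{I₀ a}` independent inside `J₂`, whose dimension is at
most `d`. They are therefore a basis, and the top exterior power is a line. -/
theorem generic (h : LocalPlucker U L W I₀ c₀ φ w) {x : Base u} (hx : x ∈ U)
    (h1 : φ x ≠ 0) (h2 : c₀ (wedgeQ L I₀ x) ≠ 0)
    (I : Fin (dGen U L) → {p : Fin n × Fin n // p.1 < p.2}) :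
    J₂ L x = Submodule.span 𝕜 (range fun a => Q L (I₀ a) x) ∧
      ∃ δ : 𝕜, wedgeQ L I x = δ • wedgeQ L I₀ x := by
  refine exists_ιMulti_eq_smul (finrank_J₂_le ⟨hx, h.notMem x hx h1⟩)
    (fun a => Q_mem_J₂ _ x) (fun a => Q_mem_J₂ (I a) x) (linearIndependent_of_ne_zero ?_)
  intro h0
  have h3 : wedgeQ L I₀ x = 0 := h0
  exact h2 (by rw [h3, map_zero])

/-- Generically all `w_I` are on the Plücker line of `J₂`, spanned by `w_{I₀}`; the scalar is read
off with `c₀`, and the identity extends by continuity. -/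
theorem w_eq (h : LocalPlucker U L W I₀ c₀ φ w) {x : Base u} (hx : x ∈ W)
    (I : Fin (dGen U L) → {p : Fin n × Fin n // p.1 < p.2}) :
    w I x = c₀ (w I x) • w I₀ x := by
  refine eq_of_forall_dual_frequently (f := fun x => w I x)
    (g := fun x => c₀ (w I x) • w I₀ x) (fun c => (h.analytic_w I c x hx).continuousAt)
    (fun c => ?_) ?_
  · simp only [map_smul, smul_eq_mul]
    exact ((h.analytic_w I c₀ x hx).mul (h.analytic_w I₀ c x hx)).continuousAt
  · refine ((h.frequently x (h.subset hx)).and_eventually (h.isOpen.eventually_mem hx)).mono ?_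
    rintro z ⟨⟨hz, hz'⟩, hzW⟩
    obtain ⟨-, δ, hδ⟩ := h.generic (h.subset hzW) hz hz' I
    rw [h.wedge_eq I z hzW] at hδ
    nth_rewrite 2 [h.wedge_eq I₀ z hzW] at hδ
    rw [smul_comm] at hδ
    have h1 : w I z = δ • w I₀ z := smul_right_injective _ hz' hδ
    rw [h1, map_smul, h.coeff_eq_one hzW, smul_eq_mul, mul_one]

theorem eventually_eq_of_mem_mStalk (h : LocalPlucker U L W I₀ c₀ φ w) {x : Base u} (hx : x ∈ W)
    {m : Germ (𝓝 x) (WedgeQuad 𝕜 n (dGen U L))} (hm : m ∈ mStalk U L x) :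
    ∃ f : Base u → WedgeQuad 𝕜 n (dGen U L), m = (f : Germ (𝓝 x) _) ∧
      ∀ᶠ z in 𝓝 x, f z = c₀ (f z) • w I₀ z := by
  induction hm using Submodule.span_induction with
  | mem m hm =>
    obtain ⟨I, rfl⟩ := hm
    refine ⟨_, rfl, ?_⟩
    filter_upwards [h.isOpen.eventually_mem hx] with z hz
    rw [h.wedge_eq I z hz, map_smul]
    conv_lhs => rw [h.w_eq hz I]
    rw [smul_smul, smul_eq_mul]
  | zero => exact ⟨fun _ => 0, rfl, by simp⟩
  | add m m' _ _ hm hm' =>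
    obtain ⟨f, rfl, hf⟩ := hm
    obtain ⟨f', rfl, hf'⟩ := hm'
    refine ⟨f + f', rfl, ?_⟩
    filter_upwards [hf, hf'] with z h1 h2
    rw [Pi.add_apply, map_add, add_smul, ← h1, ← h2]
  | smul r m _ hm =>
    obtain ⟨f, rfl, hf⟩ := hm
    obtain ⟨_, r, hr, rfl⟩ := r
    refine ⟨r • f, rfl, ?_⟩
    filter_upwards [hf] with z h1
    rw [Pi.smul_apply', map_smul, smul_assoc, ← h1]

/-- For a section `f` of the weak transform, `m f` belongs to `ℳ_L`, hence lies on the line of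
`w_{I₀}`. Cancelling the minor `m` at generic points puts `f` itself on this line, and continuity
gives the value at `x`. -/
theorem value_eq (h : LocalPlucker U L W I₀ c₀ φ w) {x : Base u} (hx : x ∈ W)
    {m : Germ (𝓝 x) (WedgeQuad 𝕜 n (dGen U L))} (hm : m ∈ weakTransformStalk U L x) :
    ∃ r : 𝕜, m.value = r • w I₀ x := by
  obtain ⟨⟨f, rfl, hf⟩, hF⟩ := hm
  refine ⟨c₀ (f x), ?_⟩
  change f x = _
  refine eq_of_forall_dual_frequently (f := f) (g := fun x => c₀ (f x) • w I₀ x)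
    (fun c => (hf c).continuousAt) (fun c => ?_) ?_
  · simp only [map_smul, smul_eq_mul]
    exact ((hf c₀).mul (h.analytic_w I₀ c x hx)).continuousAt
  have hg := hF ⟨_, _, analyticAt_wedgeQ (d := dGen U L) (h.analytic x (h.subset hx)) I₀ c₀, rfl⟩
    (Submodule.subset_span ⟨I₀, c₀, rfl⟩)
  obtain ⟨f', hf', hev⟩ := h.eventually_eq_of_mem_mStalk hx hg
  have hf'' : (fun z => c₀ (wedgeQ L I₀ z) • f z) =ᶠ[𝓝 x] f' := Germ.coe_eq.1 hf'
  refine ((h.frequently x (h.subset hx)).and_eventually (hev.and hf'')).mono ?_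
  rintro z ⟨⟨-, hz⟩, h1, h2⟩
  rw [← h2, map_smul, smul_assoc] at h1
  exact smul_right_injective _ hz h1

/-- A generator `g = c(Q_I)` of the Fitting ideal equals `m c(w_I)`, so `g w_{I₀} = c(w_I) Q_{I₀}`
belongs to `ℳ_L`. -/
theorem w_mem_weakTransform (h : LocalPlucker U L W I₀ c₀ φ w) {x : Base u} (hx : x ∈ W) :
    ((w I₀ : Base u → WedgeQuad 𝕜 n (dGen U L)) : Germ (𝓝 x) (WedgeQuad 𝕜 n (dGen U L))) ∈
      weakTransformStalk U L x := by
  refine ⟨⟨_, rfl, fun c => h.analytic_w I₀ c x hx⟩, fun g hg => ?_⟩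
  induction hg using Submodule.span_induction with
  | mem g hg =>
    obtain ⟨I, c, hg⟩ := hg
    have h2 := Submodule.smul_mem (mStalk U L x)
      (⟨_, _, h.analytic_w I c x hx, rfl⟩ : Ostalk 𝕜 x) (Submodule.subset_span ⟨I₀, rfl⟩)
    have h1 : (g : Germ (𝓝 x) 𝕜) • ((w I₀ : Base u → WedgeQuad 𝕜 n (dGen U L)) :
        Germ (𝓝 x) (WedgeQuad 𝕜 n (dGen U L))) =
        ((fun z => c (w I z) • wedgeQ L I₀ z : Base u → WedgeQuad 𝕜 n (dGen U L)) :
          Germ (𝓝 x) (WedgeQuad 𝕜 n (dGen U L))) := by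
      rw [hg]
      refine Germ.coe_eq.2 ?_
      filter_upwards [h.isOpen.eventually_mem hx] with z hz
      rw [h.wedge_eq I z hz, map_smul]
      nth_rewrite 2 [h.wedge_eq I₀ z hz]
      rw [smul_smul, smul_eq_mul, mul_comm]
    rw [h1]
    exact h2
  | zero => rw [Subring.coe_zero, zero_smul]; exact zero_mem _
  | add g g' _ _ hg hg' => rw [Subring.coe_add, add_smul]; exact add_mem hg hg'
  | smul r g _ hg =>
    rw [smul_eq_mul, Subring.coe_mul, mul_smul]
    exact Submodule.smul_mem _ r hg

theorem mem_J₂'_iff (h : LocalPlucker U L W I₀ c₀ φ w) {x : Base u} (hx : x ∈ W) (P : Quad 𝕜 n) :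
    P ∈ J₂' U L x ↔
      ExteriorAlgebra.ι 𝕜 P * (w I₀ x : ExteriorAlgebra 𝕜 (Quad 𝕜 n)) = 0 := by
  constructor
  · intro hP
    exact hP _ (h.w_mem_weakTransform hx)
  · intro hP m hm
    obtain ⟨r, hr⟩ := h.value_eq hx hm
    rw [hr, Submodule.coe_smul, mul_smul_comm, hP, smul_zero]

theorem analytic_reduction (h : LocalPlucker U L W I₀ c₀ φ w) {x : Base u} (hx : x ∈ W)
    (ℓ : Module.Dual 𝕜 (Quad 𝕜 n)) (P : Quad 𝕜 n) :
    AnalyticAt ℝ (fun x => ℓ (reduction c₀ (w I₀ x) P)) x := by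
  simp only [reduction_apply', map_sub]
  exact analyticAt_const.sub
    (h.analytic_w I₀ ((ℓ.comp (contractionLift c₀)).comp (wedgeLeft P)) x hx)

/-- Generically the reduction lands in the space of `w_{I₀}`, so its wedge with `w_{I₀}` vanishes
there, and by continuity everywhere on `W`. A fixed vector is its own reduction. -/
theorem reduction_eq_self_iff (h : LocalPlucker U L W I₀ c₀ φ w) {x : Base u} (hx : x ∈ W)
    (P : Quad 𝕜 n) : P ∈ J₂' U L x ↔ reduction c₀ (w I₀ x) P = P := by
  rw [h.mem_J₂'_iff hx]
  refine ⟨reduction_eq_self, fun hP => ?_⟩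
  rw [← hP]
  let e := Module.finBasis 𝕜 (Quad 𝕜 n)
  refine eq_of_forall_dual_frequently (𝕜 := 𝕜)
    (f := fun x => ExteriorAlgebra.ι 𝕜 (reduction c₀ (w I₀ x) P) *
    (w I₀ x : ExteriorAlgebra 𝕜 (Quad 𝕜 n))) (g := fun _ => 0) (fun c => ?_)
    (fun c => continuousAt_const) ?_
  · have key : ∀ z, c (ExteriorAlgebra.ι 𝕜 (reduction c₀ (w I₀ z) P) *
        (w I₀ z : ExteriorAlgebra 𝕜 (Quad 𝕜 n))) = ∑ k, e.coord k (reduction c₀ (w I₀ z) P) *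
          c (wedgeLeft (e k) (w I₀ z)) := by
      intro z
      conv_lhs => rw [← e.sum_repr (reduction c₀ (w I₀ z) P)]
      simp only [map_sum, map_smul, Finset.sum_mul, smul_mul_assoc, smul_eq_mul,
        Module.Basis.coord_apply]
      rfl
    simp only [key]
    exact (Finset.analyticAt_fun_sum _ fun k _ => (h.analytic_reduction hx _ _).mul
      (h.analytic_w I₀ (c.comp (wedgeLeft (e k))) x hx)).continuousAt
  · refine ((h.frequently x (h.subset hx)).and_eventually (h.isOpen.eventually_mem hx)).mono ?_
    rintro z ⟨⟨-, hz⟩, hzW⟩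
    have h1 := ι_mul_ιMulti_eq_zero (reduction_mem_span (h.wedge_eq I₀ z hzW) hz P)
    change ExteriorAlgebra.ι 𝕜 _ * (wedgeQ L I₀ z : ExteriorAlgebra 𝕜 (Quad 𝕜 n)) = 0 at h1
    rw [h.wedge_eq I₀ z hzW, Submodule.coe_smul, mul_smul_comm] at h1
    exact (smul_eq_zero.1 h1).resolve_left hz

end LocalPlucker

/-- The data of an analytic family of projections with ranges `J'`. -/
structure LocalReduction (U : Set (Base u)) (L : OpFamily 𝕜 u n) (W : Set (Base u))
    (p : Base u → Quad 𝕜 n →ₗ[𝕜] Quad 𝕜 n) : Prop where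
  isOpen : IsOpen W
  subset : W ⊆ U
  analytic : ∀ (ℓ : Module.Dual 𝕜 (Quad 𝕜 n)) P, AnalyticOnNhd ℝ (fun x => ℓ (p x P)) W
  mem_iff : ∀ x ∈ W, ∀ P, P ∈ J₂' U L x ↔ p x P = P
  frequently : ∀ y ∈ W, ∃ᶠ x in 𝓝 y, x ∈ W ∧ x ∉ discLocus U L ∧ (∀ P, p x P ∈ J₂ L x) ∧
    ∀ P ∈ J₂ L x, p x P = P

theorem IsNormalFamily.exists_localReduction (h : IsNormalFamily U L) (hUo : IsOpen U)
    (hUc : IsPreconnected U) (hL : AnalyticOnNhd ℝ L U) {y : Base u} (hy : y ∈ U)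
    (hp : (fittingStalk U L y).IsPrincipal) :
    ∃ W p, y ∈ W ∧ LocalReduction U L W p := by
  obtain ⟨W, I₀, c₀, φ, w, hyW, hw⟩ := h.exists_localPlucker hUo hUc hL hy hp
  refine ⟨W, fun x => reduction c₀ (w I₀ x), hyW, hw.isOpen, hw.subset,
    fun ℓ P x hx => hw.analytic_reduction hx ℓ P, fun x hx P => hw.reduction_eq_self_iff hx P,
    fun z hz => ?_⟩
  refine ((hw.frequently z (hw.subset hz)).and_eventually (hw.isOpen.eventually_mem hz)).mono ?_
  rintro x ⟨⟨h1, h2⟩, hx⟩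
  obtain ⟨hJ, -⟩ := hw.generic (hw.subset hx) h1 h2 I₀
  refine ⟨hx, hw.notMem x (hw.subset hx) h1, fun P => ?_, fun P hP => reduction_eq_self ?_⟩
  · rw [hJ]
    exact reduction_mem_span (hw.wedge_eq I₀ x hx) h2 P
  · rw [hJ] at hP
    have h3 := ι_mul_ιMulti_eq_zero hP
    change ExteriorAlgebra.ι 𝕜 _ * (wedgeQ L I₀ x : ExteriorAlgebra 𝕜 (Quad 𝕜 n)) = 0 at h3
    rw [hw.wedge_eq I₀ x hx, Submodule.coe_smul, mul_smul_comm] at h3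
    exact (smul_eq_zero.1 h3).resolve_left h2

end

end EigenBouquet

namespace EigenBouquet

noncomputable section

variable {𝕜 : Type*} [RCLike 𝕜]

/-! ### Limits of resolutions -/

section Limit

variable {E : Type*} [NormedAddCommGroup E] [InnerProductSpace 𝕜 E]
  [FiniteDimensional 𝕜 E] [CompleteSpace E] {X : Type*} {s : ℕ}

/-- Projections of a resolution have norm `1` and their eigenvalues are bounded by `‖T x‖`, so
compactness gives limits along an ultrafilter. The algebraic identities are closed conditions, and
norm at least `1` keeps each limit non-zero. No compatible labelling of the `Pf x` is needed. -/
theorem exists_limit_resolution (l : Ultrafilter X) {Pf : X → Fin s → (E →L[𝕜] E)}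
    {lamf : X → Fin s → 𝕜} {T : X → (E →L[𝕜] E)} {T₀ : E →L[𝕜] E} (hT : Tendsto T l (𝓝 T₀))
    (h : ∀ᶠ x in l, IsResolution (Pf x) ∧ ∀ i, T x * Pf x i = lamf x i • Pf x i) :
    ∃ (P : Fin s → (E →L[𝕜] E)) (lam : Fin s → 𝕜), (∀ i, Tendsto (fun x => Pf x i) l (𝓝 (P i))) ∧
      IsResolution P ∧ ∀ i, T₀ * P i = lam i • P i := by
  have hprop : ProperSpace (E →L[𝕜] E) := FiniteDimensional.proper_rclike 𝕜 _
  have hP : ∀ i, ∃ P : E →L[𝕜] E, Tendsto (fun x => Pf x i) l (𝓝 P) := by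
    intro i
    have hK : IsCompact (Metric.closedBall (0 : E →L[𝕜] E) 1) := isCompact_closedBall _ _
    obtain ⟨P, -, hP⟩ := hK.ultrafilter_le_nhds (l.map fun x => Pf x i) (by
      rw [le_principal_iff, Ultrafilter.coe_map, mem_map]
      filter_upwards [h] with x hx
      simpa using hx.1.norm_le_one i)
    exact ⟨P, hP⟩
  have hlam : ∀ i, ∃ c : 𝕜, Tendsto (fun x => lamf x i) l (𝓝 c) := by
    intro i
    have hK : IsCompact (Metric.closedBall (0 : 𝕜) (‖T₀‖ + 1)) := isCompact_closedBall _ _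
    obtain ⟨c, -, hc⟩ := hK.ultrafilter_le_nhds (l.map fun x => lamf x i) (by
      rw [le_principal_iff, Ultrafilter.coe_map, mem_map]
      filter_upwards [h, hT.norm.eventually (gt_mem_nhds (lt_add_one ‖T₀‖))] with x hx hx'
      simp only [mem_preimage, mem_closedBall_zero_iff]
      have h1 := norm_mul_le (T x) (Pf x i)
      rw [hx.2 i, norm_smul] at h1
      have h2 := hx.1.norm_le_one i
      have h3 := hx.1.one_le_norm i
      have h4 : ‖Pf x i‖ = 1 := le_antisymm h2 h3
      rw [h4, mul_one, mul_one] at h1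
      exact h1.trans hx'.le)
    exact ⟨c, hc⟩
  choose P hP using hP
  choose lam hlam using hlam
  refine ⟨P, lam, hP, ⟨fun i => ?_, fun i j => ?_, ?_, fun i h0 => ?_⟩, fun i => ?_⟩
  · refine tendsto_nhds_unique ((hP i).star) ((hP i).congr' ?_)
    filter_upwards [h] with x hx using (hx.1.star_eq i).symm
  · split_ifs with hij
    · refine tendsto_nhds_unique ((hP i).mul (hP j)) ((hP i).congr' ?_)
      filter_upwards [h] with x hx
      rw [hx.1.mul_eq, if_pos hij]
    · refine tendsto_nhds_unique ((hP i).mul (hP j)) (tendsto_const_nhds.congr' ?_)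
      filter_upwards [h] with x hx
      rw [hx.1.mul_eq, if_neg hij]
  · refine tendsto_nhds_unique (tendsto_finsetSum _ fun i _ => hP i) (tendsto_const_nhds.congr' ?_)
    filter_upwards [h] with x hx using hx.1.sum_eq.symm
  · have h1 : 1 ≤ ‖P i‖ := by
      refine ge_of_tendsto (hP i).norm ?_
      filter_upwards [h] with x hx using hx.1.one_le_norm i
    rw [h0, norm_zero] at h1
    linarith
  · refine tendsto_nhds_unique (hT.mul (hP i)) (((hlam i).smul (hP i)).congr' ?_)
    filter_upwards [h] with x hx using (hx.2 i).symm

end Limit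

/-! ### Analytic sections of kernels of constant rank -/

section Kernel

variable {X : Type*} [NormedAddCommGroup X] [NormedSpace ℝ X] {V V' : Type*}
  [NormedAddCommGroup V] [NormedSpace 𝕜 V] [FiniteDimensional 𝕜 V] [NormedSpace ℝ V]
  [IsScalarTower ℝ 𝕜 V] [AddCommGroup V'] [Module 𝕜 V']

theorem analyticAt_of_dual {f : X → V} {y : X}
    (h : ∀ ℓ : Module.Dual 𝕜 V, AnalyticAt ℝ (fun x => ℓ (f x)) y) : AnalyticAt ℝ f y := by
  let e := Module.finBasis 𝕜 V
  have key : f = fun x => ∑ k, e.coord k (f x) • e k := by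
    funext x
    simp only [Module.Basis.coord_apply, e.sum_repr]
  rw [key]
  exact Finset.analyticAt_fun_sum _ fun k _ => (h _).smul analyticAt_const

/-- Here `π` is a projection onto the kernel of `N`, and `R` a generalised inverse of `N` vanishing
compatibly with it. -/
theorem exists_comp_eq_id_sub (N : V →ₗ[𝕜] V') :
    ∃ (π : V →ₗ[𝕜] V) (R : V' →ₗ[𝕜] V), (∀ v, N (π v) = 0) ∧ π + R.comp N = LinearMap.id := by
  obtain ⟨q, hq⟩ := LinearMap.exists_leftInverse_of_injective (LinearMap.ker N).subtype
    (Submodule.ker_subtype _)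
  let π := (LinearMap.ker N).subtype.comp q
  have hle : LinearMap.ker N ≤ LinearMap.ker (LinearMap.id - π) := by
    intro v hv
    have := congrArg (fun f => f ⟨v, hv⟩) hq
    simp only [LinearMap.comp_apply, Submodule.subtype_apply, LinearMap.id_apply] at this
    simp [π, this]
  let R₀ : LinearMap.range N →ₗ[𝕜] V :=
    ((LinearMap.ker N).liftQ _ hle).comp N.quotKerEquivRange.symm.toLinearMap
  obtain ⟨R, hR⟩ := LinearMap.exists_extend R₀
  refine ⟨π, R, fun v => (q v).2, ?_⟩
  ext v
  have h1 : R (N v) = R₀ ⟨N v, v, rfl⟩ := by rw [← hR]; rfl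
  have h2 : N.quotKerEquivRange.symm ⟨N v, v, rfl⟩ = Submodule.Quotient.mk v := by
    rw [LinearEquiv.symm_apply_eq]
    rfl
  simp only [LinearMap.add_apply, LinearMap.comp_apply, LinearMap.id_apply]
  rw [h1]
  simp only [R₀, LinearMap.comp_apply, LinearEquiv.coe_coe, h2]
  rw [Submodule.liftQ_apply]
  simp

/-- The operator `B(x) = π + R N(x)` is `1` at `y`, hence invertible nearby. On `ker N(x)` it
coincides with `π`, so it maps into `ker N(y)` injectively, and onto since the dimensions agree.
Thus `B(x)⁻¹ v₀` is the section. -/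
theorem exists_analytic_section {N : X → V →ₗ[𝕜] V'} {y : X}
    (hN : ∀ (ℓ : Module.Dual 𝕜 V') v, AnalyticAt ℝ (fun x => ℓ (N x v)) y)
    (hr : ∀ᶠ x in 𝓝 y, Module.finrank 𝕜 (LinearMap.ker (N x)) =
      Module.finrank 𝕜 (LinearMap.ker (N y)))
    {v₀ : V} (hv₀ : N y v₀ = 0) :
    ∃ f : X → V, AnalyticAt ℝ f y ∧ f y = v₀ ∧ ∀ᶠ x in 𝓝 y, N x (f x) = 0 := by
  have : CompleteSpace V := FiniteDimensional.complete 𝕜 V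
  obtain ⟨π, R, hπ, hR⟩ := exists_comp_eq_id_sub (N y)
  let B : X → (V →L[𝕜] V) := fun x => LinearMap.toContinuousLinearMap (π + R.comp (N x))
  have hB : AnalyticAt ℝ B y := by
    refine analyticAt_clm_of_apply fun v => analyticAt_of_dual (𝕜 := 𝕜) fun ℓ => ?_
    have : ∀ x, ℓ (B x v) = ℓ (π v) + (ℓ.comp R) (N x v) := fun x => by simp [B]
    simp only [this]
    exact analyticAt_const.add (hN _ v)
  have hBy : B y = 1 := by
    ext v
    exact congrArg (fun f => f v) hR
  have hinv : AnalyticAt ℝ (fun x => Ring.inverse (B x)) y := by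
    refine AnalyticAt.fun_comp ?_ hB
    rw [hBy]
    exact analyticAt_inverse (𝕜 := ℝ) (1 : (V →L[𝕜] V)ˣ)
  have hunit : ∀ᶠ x in 𝓝 y, IsUnit (B x) := by
    refine hB.continuousAt.eventually (Units.isOpen.mem_nhds ?_)
    rw [hBy]
    exact isUnit_one
  refine ⟨fun x => Ring.inverse (B x) v₀, analyticAt_apply hinv analyticAt_const, ?_, ?_⟩
  · simp [hBy]
  · filter_upwards [hunit, hr] with x hu hx
    have hleft : ∀ v, Ring.inverse (B x) (B x v) = v := fun v =>
      congrArg (fun f : V →L[𝕜] V => f v) (Ring.inverse_mul_cancel _ hu)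
    let β : LinearMap.ker (N x) →ₗ[𝕜] LinearMap.ker (N y) :=
      LinearMap.restrict (B x : V →ₗ[𝕜] V) (fun v hv => by
        have hv' : N x v = 0 := hv
        simp [B, hv', hπ])
    have hinj : Function.Injective β := by
      intro v w hvw
      have h1 : B x v = B x w := congrArg Subtype.val hvw
      exact Subtype.ext (by rw [← hleft v, h1, hleft])
    obtain ⟨w, hw⟩ := (LinearMap.injective_iff_surjective_of_finrank_eq_finrank hx).1 hinj ⟨v₀, hv₀⟩
    have h2 : B x w = v₀ := congrArg Subtype.val hw
    rw [← h2, hleft]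
    exact w.2

end Kernel

/-! ### Analytic families of projections -/

section Split

variable {E : Type*} [NormedAddCommGroup E] [InnerProductSpace 𝕜 E]
  [FiniteDimensional 𝕜 E] [CompleteSpace E] [NormedSpace ℝ E] [IsScalarTower ℝ 𝕜 E]
  {X : Type*} [NormedAddCommGroup X] [NormedSpace ℝ X] {s : ℕ}

theorem IsResolution.sum_smul_mul {P : Fin s → (E →L[𝕜] E)} (h : IsResolution P)
    (a b : Fin s → 𝕜) : (∑ i, a i • P i) * (∑ i, b i • P i) = ∑ i, (a i * b i) • P i := by
  rw [Finset.sum_mul_sum]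
  refine Finset.sum_congr rfl fun i _ => ?_
  rw [Finset.sum_eq_single i]
  · rw [smul_mul_smul_comm, h.mul_eq, if_pos rfl]
  · intro j _ hj
    rw [smul_mul_smul_comm, h.mul_eq, if_neg hj.symm, smul_zero]
  · simp

theorem IsResolution.norm_coeff_le {P : Fin s → (E →L[𝕜] E)} (h : IsResolution P)
    (a : Fin s → 𝕜) (i : Fin s) : ‖a i‖ ≤ ‖∑ j, a j • P j‖ := by
  have h1 : (∑ j, a j • P j) * P i = a i • P i := by
    rw [Finset.sum_mul, Finset.sum_eq_single i]
    · rw [smul_mul_assoc, h.mul_eq, if_pos rfl]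
    · intro j _ hj
      rw [smul_mul_assoc, h.mul_eq, if_neg hj, smul_zero]
    · simp
  have h2 := norm_mul_le (∑ j, a j • P j) (P i)
  have h4 : ‖P i‖ = 1 := le_antisymm (h.norm_le_one i) (h.one_le_norm i)
  rwa [h1, norm_smul, h4, mul_one, mul_one] at h2

theorem IsResolution.one_eq {P : Fin s → (E →L[𝕜] E)} (h : IsResolution P) :
    (1 : E →L[𝕜] E) = ∑ i, (1 : 𝕜) • P i := by
  simp [h.sum_eq]

/-- An analytic family of elements of the algebras of the resolutions which starts at a projection
can be deformed to a family of projections. -/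
theorem exists_analytic_idempotent {y : X} {T : X → (E →L[𝕜] E)} (hT : AnalyticAt ℝ T y)
    (hy : T y * T y = T y) {Pf : X → Fin s → (E →L[𝕜] E)}
    (h : ∀ᶠ x in 𝓝 y, IsResolution (Pf x) ∧ ∃ t : Fin s → 𝕜, T x = ∑ i, t i • Pf x i) :
    ∃ S : X → (E →L[𝕜] E), AnalyticAt ℝ S y ∧ S y = T y ∧
      ∀ᶠ x in 𝓝 y, ∃ J : Finset (Fin s), S x = ∑ i ∈ J, Pf x i := by
  obtain ⟨r, δ, ε, hδ, hε, hε1, hr1, hr, hru⟩ := exists_analytic_sqrt (E →L[𝕜] E)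
  -- At `y` this is a reflection, `R² = 1`. Nearby, `R (R²)^{-1/2}` has eigenvalues `±1`, and half
  -- of it plus `1` is a projection.
  let R : X → (E →L[𝕜] E) := fun x => T x + T x - 1
  have hR : AnalyticAt ℝ R y := (hT.add hT).sub analyticAt_const
  have hRy : R y * R y = 1 := by
    simp only [R, sub_mul, mul_sub, add_mul, mul_add, hy, one_mul, mul_one]
    abel
  have hRR : AnalyticAt ℝ (fun x => R x * R x) y := hR.mul hR
  have hrR : AnalyticAt ℝ (fun x => r (R x * R x)) y := by
    refine AnalyticAt.fun_comp (g := r) ?_ hRR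
    rw [hRy]
    exact (hr 1 (Metric.mem_ball_self hδ)).1
  have hinv : AnalyticAt ℝ (fun x => Ring.inverse (r (R x * R x))) y := by
    refine AnalyticAt.fun_comp ?_ hrR
    rw [hRy, hr1]
    exact analyticAt_inverse (𝕜 := ℝ) (1 : (E →L[𝕜] E)ˣ)
  refine ⟨fun x => (2⁻¹ : ℝ) • (1 + R x * Ring.inverse (r (R x * R x))),
    (analyticAt_const.add (hR.mul hinv)).fun_const_smul, ?_, ?_⟩
  · change (2⁻¹ : ℝ) • (1 + R y * Ring.inverse (r (R y * R y))) = T y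
    rw [hRy, hr1, Ring.inverse_one, mul_one]
    simp only [R, add_sub_cancel]
    rw [← two_smul ℝ, smul_smul]
    norm_num
  let η := min ε δ / 2
  have hη : 0 < η := by positivity
  have hηε : η < ε := (half_lt_self (by positivity)).trans_le (min_le_left _ _)
  have hnear : ∀ᶠ x in 𝓝 y, ‖R x * R x - 1‖ < min (η ^ 2) δ := by
    have : Tendsto (fun x => ‖R x * R x - 1‖) (𝓝 y) (𝓝 0) := by
      have h1 := (hRR.continuousAt.tendsto.sub (tendsto_const_nhds (x := (1 : E →L[𝕜] E)))).norm
      rwa [hRy, sub_self, norm_zero] at h1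
    exact this.eventually (gt_mem_nhds (by positivity))
  filter_upwards [h, hnear] with x ⟨hP, t, ht⟩ hx
  let ρ : Fin s → 𝕜 := fun i => t i + t i - 1
  have hRx : R x = ∑ i, ρ i • Pf x i := by
    simp only [R, ρ, ht, sub_smul, add_smul, Finset.sum_sub_distrib, Finset.sum_add_distrib]
    rw [← hP.one_eq]
  have hR2 : R x * R x - 1 = ∑ i, (ρ i * ρ i - 1) • Pf x i := by
    rw [hRx, hP.sum_smul_mul]
    simp only [sub_smul, Finset.sum_sub_distrib]
    rw [← hP.one_eq]
  -- Since `|ρ - 1| |ρ + 1| < η²`, one factor is at most `η`; the sign `σ` records which.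
  have hρ : ∀ i, ∃ σ : 𝕜, (σ = 1 ∨ σ = -1) ∧ ‖σ * ρ i - 1‖ ≤ η := by
    intro i
    have h1 : ‖(ρ i - 1) * (ρ i + 1)‖ < η ^ 2 := by
      have h2 := hP.norm_coeff_le (fun i => ρ i * ρ i - 1) i
      rw [← hR2] at h2
      rw [show (ρ i - 1) * (ρ i + 1) = ρ i * ρ i - 1 by ring]
      exact h2.trans_lt (hx.trans_le (min_le_left _ _))
    rw [norm_mul] at h1
    by_cases h3 : ‖ρ i - 1‖ ≤ η
    · exact ⟨1, Or.inl rfl, by rwa [one_mul]⟩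
    · refine ⟨-1, Or.inr rfl, ?_⟩
      rw [show -1 * ρ i - 1 = -(ρ i + 1) by ring, norm_neg]
      by_contra h4
      push Not at h3 h4
      nlinarith
  choose σ hσ hσρ using hρ
  -- `S` is an explicit square root of `R²` within `η < ε` of `1`, so uniqueness identifies it with
  -- `r (R²)`. Hence `R (R²)^{-1/2} = Σ σ_i P_i`.
  let S := ∑ i, (σ i * ρ i) • Pf x i
  have hσ2 : ∀ i, σ i * σ i = 1 := fun i => by rcases hσ i with h | h <;> rw [h] <;> ring
  have hSS : S * S = R x * R x := by
    rw [hP.sum_smul_mul, hRx, hP.sum_smul_mul]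
    refine Finset.sum_congr rfl fun i _ => ?_
    rw [mul_mul_mul_comm, hσ2, one_mul]
  have hS1 : ‖S - 1‖ ≤ η := by
    have : S - 1 = ∑ i, (σ i * ρ i - 1) • Pf x i := by
      simp only [sub_smul, Finset.sum_sub_distrib]
      rw [← hP.one_eq]
    rw [this]
    exact hP.norm_sum_smul_le _ hη.le hσρ
  have hrS : r (R x * R x) = S := by
    rw [← hSS]
    refine hru S ?_ ?_
    · rw [mem_ball_iff_norm]; exact hS1.trans_lt hηε
    · rw [hSS, mem_ball_iff_norm]; exact hx.trans_le (min_le_right _ _)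
  have hunit : IsUnit S := by
    have h1 : ‖1 - S‖ < 1 := by
      rw [norm_sub_rev]; exact hS1.trans_lt (hηε.trans_le hε1)
    have := isUnit_one_sub_of_norm_lt_one h1
    rwa [sub_sub_cancel] at this
  have hRS : R x = (∑ i, σ i • Pf x i) * S := by
    rw [hRx, hP.sum_smul_mul]
    refine Finset.sum_congr rfl fun i _ => ?_
    rw [← mul_assoc, hσ2, one_mul]
  refine ⟨Finset.univ.filter fun i => σ i = 1, ?_⟩
  rw [hrS, hRS, mul_assoc, Ring.mul_inverse_cancel _ hunit, mul_one, hP.one_eq,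
    ← Finset.sum_add_distrib, Finset.smul_sum, Finset.sum_filter]
  refine Finset.sum_congr rfl fun i _ => ?_
  rcases hσ i with h1 | h1
  · rw [if_pos h1, h1, one_smul, ← two_smul ℝ, smul_smul]
    norm_num
  · have : (-1 : 𝕜) ≠ 1 := by
      intro h2
      have : (2 : 𝕜) = 0 := by linear_combination -h2
      exact two_ne_zero this
    rw [h1, if_neg this, neg_smul, add_neg_cancel, smul_zero]

/-- Each deformed projection is the sum of the `Pf x l` over a set `J i`. It is non-zero near `y`,
so `J i` is non-empty; the products of different ones have norm below `1`, so the `J i` are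
disjoint. Hence `s` such subsets of `Fin s` are singletons. -/
theorem exists_analytic_resolution {y : X} {P₀ : Fin s → (E →L[𝕜] E)} (hP₀ : IsResolution P₀)
    {T : Fin s → X → (E →L[𝕜] E)} (hT : ∀ i, AnalyticAt ℝ (T i) y) (hy : ∀ i, T i y = P₀ i)
    {Pf : X → Fin s → (E →L[𝕜] E)}
    (h : ∀ᶠ x in 𝓝 y, IsResolution (Pf x) ∧ ∀ i, ∃ t : Fin s → 𝕜, T i x = ∑ j, t j • Pf x j) :
    ∃ S : Fin s → X → (E →L[𝕜] E), (∀ i, AnalyticAt ℝ (S i) y) ∧ (∀ i, S i y = P₀ i) ∧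
      ∀ᶠ x in 𝓝 y, ∃ τ : Equiv.Perm (Fin s), ∀ i, S i x = Pf x (τ i) := by
  have h1 : ∀ i, ∃ S : X → (E →L[𝕜] E), AnalyticAt ℝ S y ∧ S y = T i y ∧
      ∀ᶠ x in 𝓝 y, ∃ J : Finset (Fin s), S x = ∑ j ∈ J, Pf x j := by
    intro i
    refine exists_analytic_idempotent (hT i) ?_ (h.mono fun x hx => ⟨hx.1, hx.2 i⟩)
    rw [hy, hP₀.mul_eq, if_pos rfl]
  choose S hS hSy hSJ using h1
  refine ⟨S, hS, fun i => (hSy i).trans (hy i), ?_⟩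
  have hne : ∀ᶠ x in 𝓝 y, ∀ i, S i x ≠ 0 := by
    rw [eventually_all]
    intro i
    refine (hS i).continuousAt.eventually_ne ?_
    rw [hSy, hy]
    exact hP₀.ne_zero i
  have hmul : ∀ᶠ x in 𝓝 y, ∀ i j, i ≠ j → ‖S i x * S j x‖ < 1 := by
    rw [eventually_all]; intro i
    rw [eventually_all]; intro j
    by_cases hij : i = j
    · exact Eventually.of_forall fun x hx => absurd hij hx
    have h2 := ((hS i).continuousAt.tendsto.mul (hS j).continuousAt.tendsto).norm
    rw [hSy, hSy, hy, hy, hP₀.mul_eq, if_neg hij, norm_zero] at h2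
    filter_upwards [h2.eventually (gt_mem_nhds one_pos)] with x hx _ using hx
  filter_upwards [h, eventually_all.2 hSJ, hne, hmul] with x ⟨hP, _⟩ hJ hne hmul
  choose J hJ using hJ
  have hdisj : ∀ i j l, l ∈ J i → l ∈ J j → i = j := by
    intro i j l hi hj
    by_contra hij
    have e1 : ∀ k, l ∈ J k → Pf x l * S k x = Pf x l := by
      intro k hk
      rw [hJ, Finset.mul_sum, Finset.sum_eq_single l]
      · rw [hP.mul_eq, if_pos rfl]
      · intro m _ hm
        rw [hP.mul_eq, if_neg hm.symm]
      · exact fun hc => absurd hk hc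
    have e2 : Pf x l = Pf x l * (S i x * S j x) := by rw [← mul_assoc, e1 i hi, e1 j hj]
    have e3 := norm_mul_le (Pf x l) (S i x * S j x)
    have e4 : ‖Pf x l‖ = 1 := le_antisymm (hP.norm_le_one l) (hP.one_le_norm l)
    rw [← e2, e4, one_mul] at e3
    exact absurd (hmul i j hij) (not_lt.2 e3)
  have hnonempty : ∀ i, ∃ l, l ∈ J i := by
    intro i
    by_contra! hc
    refine hne i ?_
    rw [hJ, Finset.eq_empty_of_forall_notMem hc, Finset.sum_empty]
  choose τ hτ using hnonempty
  have hinj : Function.Injective τ := fun i j hij => hdisj i j (τ i) (hτ i) (hij ▸ hτ j)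
  have hbij : Function.Bijective τ := Finite.injective_iff_bijective.1 hinj
  refine ⟨Equiv.ofBijective τ hbij, fun i => ?_⟩
  rw [hJ, Finset.sum_eq_single (τ i)]
  · rfl
  · intro l hl hne'
    obtain ⟨k, rfl⟩ := hbij.2 l
    exact absurd (congrArg τ (hdisj k i _ (hτ k) hl)) hne'
  · exact fun hc => absurd (hτ i) hc

end Split

end

end EigenBouquet

namespace EigenBouquet

noncomputable section

variable {𝕜 : Type*} [RCLike 𝕜] {u n : ℕ} {U : Set (Base u)} {L : OpFamily 𝕜 u n}

/-! ### Resolutions compatible with the reduced eigen-bouquet -/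

/-- A resolution into spaces of eigenvectors whose union is the reduced eigen-bouquet. -/
structure IsBouquet (U : Set (Base u)) (L : OpFamily 𝕜 u n) (x : Base u) {s : ℕ}
    (P : Fin s → (Fib 𝕜 n →L[𝕜] Fib 𝕜 n)) : Prop where
  res : IsResolution P
  eig : ∃ lam : Fin s → 𝕜, ∀ i, L x * P i = lam i • P i
  mem_iff : ∀ v, v ∈ EV' U L x ↔ v ≠ 0 ∧ ∃ i, P i v = v

/-- The range of the projection `p` consists of the quadratic forms which vanish on the ranges of
the `P i`. -/
structure IsAdapted {s : ℕ} (p : Quad 𝕜 n →ₗ[𝕜] Quad 𝕜 n)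
    (P : Fin s → (Fib 𝕜 n →L[𝕜] Fib 𝕜 n)) : Prop where
  qev_eq : ∀ i v R, qev (P i v) (p R) = 0
  map_eq : ∀ i j, i ≠ j → ∀ k l, p (prodForm (P i) (P j) k l) = prodForm (P i) (P j) k l

theorem prodForm_eq_sum (S T : Fib 𝕜 n →L[𝕜] Fib 𝕜 n) (k l : Fin n) :
    prodForm S T k l = ∑ a, ∑ b, (S (EuclideanSpace.single a 1) k *
      T (EuclideanSpace.single b 1) l) • prodForm 1 1 a b := by
  refine quad_ext fun v => ?_
  rw [qev_prodForm, apply_coord S, apply_coord T, Finset.sum_mul_sum]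
  simp only [map_sum, map_smul, qev_prodForm, smul_eq_mul, one_apply_eq_self]
  refine Finset.sum_congr rfl fun a _ => Finset.sum_congr rfl fun b _ => ?_
  ring

theorem qev_eq_sum_repr {ι : Type*} [Fintype ι] (e : Module.Basis ι 𝕜 (Quad 𝕜 n)) (v : Fib 𝕜 n)
    (R : Quad 𝕜 n) : qev v R = ∑ k, e.coord k R * qev v (e k) := by
  conv_lhs => rw [← e.sum_repr R]
  simp only [map_sum, map_smul, smul_eq_mul, Module.Basis.coord_apply]

/-- The spectral resolutions at generic points converge along an ultrafilter tending to `y`. That `p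
x` has range `J₂` there is a family of closed identities, which survive as adaptedness to `p y`. -/
theorem LocalReduction.exists_resolution {W : Set (Base u)}
    {p : Base u → Quad 𝕜 n →ₗ[𝕜] Quad 𝕜 n} (h : LocalReduction U L W p) (hN : IsNormalFamily U L)
    (hL : AnalyticOnNhd ℝ L U) {y : Base u} (hy : y ∈ W) :
    ∃ (P : Fin (sMax U L) → (Fib 𝕜 n →L[𝕜] Fib 𝕜 n)) (lam : Fin (sMax U L) → 𝕜),
      IsResolution P ∧ (∀ i, L y * P i = lam i • P i) ∧ IsAdapted (p y) P := by
  set G : Set (Base u) := {x | x ∈ W ∧ x ∉ discLocus U L ∧ (∀ P, p x P ∈ J₂ L x) ∧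
    ∀ P ∈ J₂ L x, p x P = P} with hG
  have hex : ∀ x, ∃ (P : Fin (sMax U L) → (Fib 𝕜 n →L[𝕜] Fib 𝕜 n)) (lam : Fin (sMax U L) → 𝕜),
      x ∈ G → IsResolution P ∧ Function.Injective lam ∧ ∀ i, L x * P i = lam i • P i := by
    intro x
    by_cases hx : x ∈ G
    · obtain ⟨P, lam, h1⟩ := hN.exists_resolution_of_notMem (h.subset hx.1) hx.2.1
      exact ⟨P, lam, fun _ => h1⟩
    · exact ⟨0, 0, fun h1 => absurd h1 hx⟩
  choose Pf lamf hPf using hex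
  have hne : (𝓝 y ⊓ 𝓟 G).NeBot := frequently_mem_iff_neBot.1 (h.frequently y hy)
  let l : Ultrafilter (Base u) := Ultrafilter.of (𝓝 y ⊓ 𝓟 G)
  have hly : (l : Filter (Base u)) ≤ 𝓝 y := (Ultrafilter.of_le _).trans inf_le_left
  have hlG : ∀ᶠ x in l, x ∈ G := le_principal_iff.1 ((Ultrafilter.of_le _).trans inf_le_right)
  obtain ⟨P, lam, hlim, hP, hT⟩ := exists_limit_resolution l
    (((hL y (h.subset hy)).continuousAt.tendsto).mono_left hly)
    (hlG.mono fun x hx => ⟨(hPf x hx).1, (hPf x hx).2.2⟩)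
  have happ : ∀ i v, Tendsto (fun x => Pf x i v) l (𝓝 (P i v)) := fun i v =>
    ((ContinuousLinearMap.apply 𝕜 (Fib 𝕜 n) v).continuous.tendsto _).comp (hlim i)
  have hcoord : ∀ i v k, Tendsto (fun x => Pf x i v k) l (𝓝 (P i v k)) := fun i v k =>
    ((EuclideanSpace.proj k : Fib 𝕜 n →L[𝕜] 𝕜).continuous.tendsto _).comp (happ i v)
  have hp : ∀ (ℓ : Module.Dual 𝕜 (Quad 𝕜 n)) R, Tendsto (fun x => ℓ (p x R)) l (𝓝 (ℓ (p y R))) :=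
    fun ℓ R => ((h.analytic ℓ R y hy).continuousAt.tendsto).mono_left hly
  refine ⟨P, lam, hP, hT, fun i v R => ?_, fun i j hij k m => ?_⟩
  · let e := Module.finBasis 𝕜 (Quad 𝕜 n)
    have h1 : Tendsto (fun x => qev (Pf x i v) (p x R)) l (𝓝 (qev (P i v) (p y R))) := by
      rw [qev_eq_sum_repr e (P i v), show (fun x => qev (Pf x i v) (p x R)) =
        fun x => ∑ k, e.coord k (p x R) * qev (Pf x i v) (e k) from
          funext fun x => qev_eq_sum_repr e _ _]
      exact tendsto_finsetSum _ fun k _ => (hp _ _).mul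
        (((continuous_qev (e k)).tendsto _).comp (happ i v))
    refine tendsto_nhds_unique h1 (tendsto_const_nhds.congr' ?_)
    filter_upwards [hlG] with x hx
    exact (qev_proj_eq_zero (hPf x hx).1 (hPf x hx).2.2 (hx.2.2.1 R) i v).symm
  · rw [← sub_eq_zero, ← Module.forall_dual_apply_eq_zero_iff 𝕜]
    intro ℓ
    have key : ∀ x (S T : Fib 𝕜 n →L[𝕜] Fib 𝕜 n),
        ℓ (p x (prodForm S T k m) - prodForm S T k m) = ∑ a, ∑ b,
          (S (EuclideanSpace.single a 1) k * T (EuclideanSpace.single b 1) m) *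
            (ℓ (p x (prodForm 1 1 a b)) - ℓ (prodForm 1 1 a b)) := by
      intro x S T
      rw [prodForm_eq_sum S T]
      simp only [map_sub, map_sum, map_smul, smul_eq_mul, ← Finset.sum_sub_distrib, mul_sub]
    have h1 : Tendsto (fun x => ℓ (p x (prodForm (Pf x i) (Pf x j) k m) -
        prodForm (Pf x i) (Pf x j) k m)) l
        (𝓝 (ℓ (p y (prodForm (P i) (P j) k m) - prodForm (P i) (P j) k m))) := by
      simp only [key]
      exact tendsto_finsetSum _ fun a _ => tendsto_finsetSum _ fun b _ =>
        ((hcoord i _ _).mul (hcoord j _ _)).mul ((hp _ _).sub tendsto_const_nhds)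
    refine tendsto_nhds_unique h1 (tendsto_const_nhds.congr' ?_)
    filter_upwards [hlG] with x hx
    rw [hx.2.2.2 _ (prodForm_mem_J₂ (hPf x hx).1 (hPf x hx).2.2 (hPf x hx).2.1 hij k m), sub_self,
      map_zero]

/-! ### The operators which are scalar on each component -/

section Adapted

variable {s : ℕ} {p : Quad 𝕜 n →ₗ[𝕜] Quad 𝕜 n} {P : Fin s → (Fib 𝕜 n →L[𝕜] Fib 𝕜 n)}

/-- A common zero of the forms `(P_i v)_k (P_j v)_l` with `i ≠ j` can have only one non-zero
component `P_i v`, and is then equal to it. -/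
theorem IsAdapted.mem_EV'_iff (h : IsAdapted p P) (hP : IsResolution P) {x : Base u}
    (hp : ∀ R, R ∈ J₂' U L x ↔ p R = R) (v : Fib 𝕜 n) :
    v ∈ EV' U L x ↔ v ≠ 0 ∧ ∃ i, P i v = v := by
  refine and_congr_right fun h0 => ⟨fun hv => ?_, ?_⟩
  · have h1 : ∀ i j, i ≠ j → ∀ k l, P i v k * P j v l = 0 := fun i j hij k l => by
      rw [← qev_prodForm]
      exact hv _ ((hp _).2 (h.map_eq i j hij k l))
    have h2 : ∃ i, P i v ≠ 0 := by
      by_contra! hc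
      exact h0 (by rw [← hP.sum_proj v]; simp [hc])
    obtain ⟨i, hi⟩ := h2
    obtain ⟨k, hk⟩ : ∃ k, P i v k ≠ 0 := by
      by_contra! hc
      exact hi (by ext k; simpa using hc k)
    refine ⟨i, ?_⟩
    conv_rhs => rw [← hP.sum_proj v]
    symm
    refine Finset.sum_eq_single i (fun j _ hj => ?_) (by simp)
    ext l
    simpa [hk] using h1 i j hj.symm k l
  · rintro ⟨i, hi⟩ R hR
    have := h.qev_eq i v R
    rwa [(hp R).1 hR, hi] at this

variable (n) in
/-- The components of `v ↦ T v ∧ v`, as a linear function of `T`. -/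
def wedgeForm (kl : Fin n × Fin n) : (Fib 𝕜 n →L[𝕜] Fib 𝕜 n) →ₗ[𝕜] Quad 𝕜 n where
  toFun T := prodForm T 1 kl.1 kl.2 - prodForm T 1 kl.2 kl.1
  map_add' S T := quad_ext fun v => by simp; ring
  map_smul' c T := quad_ext fun v => by simp; ring

/-- The equations of the algebra of the operators which are scalar on the components. -/
def scalarEq (p : Quad 𝕜 n →ₗ[𝕜] Quad 𝕜 n) :
    (Fib 𝕜 n →L[𝕜] Fib 𝕜 n) →ₗ[𝕜] (Fin n × Fin n → Quad 𝕜 n) :=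
  LinearMap.pi fun kl => (p - LinearMap.id).comp (wedgeForm n kl)

theorem qev_wedgeForm (T : Fib 𝕜 n →L[𝕜] Fib 𝕜 n) (kl : Fin n × Fin n) (v : Fib 𝕜 n) :
    qev v (wedgeForm n kl T) = T v kl.1 * v kl.2 - T v kl.2 * v kl.1 := by
  simp [wedgeForm]

/-- Indeed `P_i v ∧ v = Σ_{j ≠ i} P_i v ∧ P_j v`, and `p` fixes the components of each summand. -/
theorem IsAdapted.scalarEq_proj (h : IsAdapted p P) (hP : IsResolution P) (i : Fin s) :
    scalarEq p (P i) = 0 := by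
  funext kl
  have key : wedgeForm n kl (P i) = ∑ j, if i = j then 0 else
      prodForm (P i) (P j) kl.1 kl.2 - prodForm (P i) (P j) kl.2 kl.1 := by
    refine quad_ext fun v => ?_
    have e1 : ∀ k, v k = ∑ j, P j v k := by
      intro k
      conv_lhs => rw [← hP.sum_proj v]
      simp
    rw [qev_wedgeForm, e1 kl.2, e1 kl.1, Finset.mul_sum, Finset.mul_sum,
      ← Finset.sum_sub_distrib, map_sum]
    refine Finset.sum_congr rfl fun j _ => ?_
    split_ifs with hij
    · subst hij; rw [map_zero]; ring
    · simp
  change p (wedgeForm n kl (P i)) - wedgeForm n kl (P i) = 0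
  rw [key, map_sum, sub_eq_zero]
  refine Finset.sum_congr rfl fun j _ => ?_
  split_ifs with hij
  · rw [map_zero]
  · rw [map_sub, h.map_eq i j hij, h.map_eq i j hij]

/-- The components of `T v ∧ v` are fixed by `p`, so they vanish on the range of `P i`: each vector
there is an eigenvector of `T`. An operator with this property is scalar. -/
theorem IsAdapted.exists_mul_eq_smul (h : IsAdapted p P) (hP : IsResolution P)
    {T : Fib 𝕜 n →L[𝕜] Fib 𝕜 n} (hT : scalarEq p T = 0) (i : Fin s) :
    ∃ c : 𝕜, ∀ v, T (P i v) = c • P i v := by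
  have h1 : ∀ v, P i v = v → ∃ c : 𝕜, T v = c • v := by
    intro v hv
    by_cases h0 : v = 0
    · exact ⟨0, by simp [h0]⟩
    obtain ⟨l, hl⟩ : ∃ l, v l ≠ 0 := by
      by_contra! hc
      exact h0 (by ext k; simpa using hc k)
    refine ⟨T v l / v l, ?_⟩
    ext k
    have h2 : p (wedgeForm n (k, l) T) - wedgeForm n (k, l) T = 0 := congrFun hT (k, l)
    have h3 := h.qev_eq i v (wedgeForm n (k, l) T)
    rw [sub_eq_zero.1 h2, hv, qev_wedgeForm] at h3
    simp only [PiLp.smul_apply, smul_eq_mul]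
    rw [div_mul_eq_mul_div, eq_div_iff hl]
    exact sub_eq_zero.1 h3
  let V := LinearMap.range (P i : Fib 𝕜 n →ₗ[𝕜] Fib 𝕜 n)
  let f : V →ₗ[𝕜] V := LinearMap.restrict (T : Fib 𝕜 n →ₗ[𝕜] Fib 𝕜 n) (fun v hv => by
    obtain ⟨c, hc⟩ := h1 v ((hP.mem_range_iff i v).1 hv)
    change T v ∈ V
    rw [hc]
    exact Submodule.smul_mem _ _ hv)
  obtain ⟨c, hc⟩ := f.exists_eq_smul_id_of_forall_notLinearIndependent fun v hli => by
    obtain ⟨c, hc⟩ := h1 v ((hP.mem_range_iff i v).1 v.2)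
    rw [LinearIndependent.pair_iff] at hli
    have := hli (-c) 1 (Subtype.ext (by
      change -c • (v : Fib 𝕜 n) + (1 : 𝕜) • T v = 0
      rw [hc]; module))
    exact one_ne_zero this.2
  refine ⟨c, fun v => ?_⟩
  exact congrArg Subtype.val (congrArg (fun g => g ⟨P i v, v, rfl⟩) hc)

/-- The kernel has dimension `s` at every point of `W`, including the discriminant locus. This
constancy of rank allows analytic sections, although the resolutions were obtained point by point.
-/
theorem IsAdapted.ker_scalarEq (h : IsAdapted p P) (hP : IsResolution P) :
    LinearMap.ker (scalarEq p) = Submodule.span 𝕜 (range P) := by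
  refine le_antisymm (fun T hT => ?_) (Submodule.span_le.2 ?_)
  · choose c hc using h.exists_mul_eq_smul hP hT
    refine (Submodule.mem_span_range_iff_exists_fun 𝕜).2 ⟨c, ?_⟩
    ext1 v
    conv_rhs => rw [← hP.sum_proj v, map_sum]
    rw [sum_apply]
    exact Finset.sum_congr rfl fun i _ => (hc i v).symm
  · rintro _ ⟨i, rfl⟩
    exact h.scalarEq_proj hP i

theorem linearIndependent_resolution {E : Type*} [NormedAddCommGroup E] [InnerProductSpace 𝕜 E]
    [FiniteDimensional 𝕜 E] [CompleteSpace E] [NormedSpace ℝ E] [IsScalarTower ℝ 𝕜 E]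
    {P : Fin s → (E →L[𝕜] E)} (hP : IsResolution P) :
    LinearIndependent 𝕜 P := by
  rw [Fintype.linearIndependent_iff]
  intro g hg i
  have := hP.norm_coeff_le g i
  rw [hg, norm_zero] at this
  exact norm_le_zero_iff.1 this

theorem IsAdapted.finrank_ker (h : IsAdapted p P) (hP : IsResolution P) :
    Module.finrank 𝕜 (LinearMap.ker (scalarEq p)) = s := by
  rw [h.ker_scalarEq hP]
  simpa using finrank_span_eq_card (linearIndependent_resolution hP)

end Adapted

theorem LocalReduction.analyticAt_scalarEq {W : Set (Base u)}
    {p : Base u → Quad 𝕜 n →ₗ[𝕜] Quad 𝕜 n} (h : LocalReduction U L W p) {y : Base u} (hy : y ∈ W)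
    (ℓ : Module.Dual 𝕜 (Fin n × Fin n → Quad 𝕜 n)) (T : Fib 𝕜 n →L[𝕜] Fib 𝕜 n) :
    AnalyticAt ℝ (fun x => ℓ (scalarEq (p x) T)) y := by
  have key : ∀ x, ℓ (scalarEq (p x) T) = ∑ kl,
      ((ℓ.comp (LinearMap.single 𝕜 _ kl)) (p x (wedgeForm n kl T)) -
        (ℓ.comp (LinearMap.single 𝕜 _ kl)) (wedgeForm n kl T)) := by
    intro x
    conv_lhs => rw [← LinearMap.sum_single_apply (v := scalarEq (p x) T) (φ := fun _ => Quad 𝕜 n)]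
    rw [map_sum]
    refine Finset.sum_congr rfl fun kl _ => ?_
    rw [← map_sub]
    rfl
  simp only [key]
  exact Finset.analyticAt_fun_sum _ fun kl _ => (h.analytic _ _ y hy).sub analyticAt_const

theorem IsBouquet.perm {s : ℕ} {x : Base u} {P : Fin s → (Fib 𝕜 n →L[𝕜] Fib 𝕜 n)}
    (h : IsBouquet U L x P) (τ : Equiv.Perm (Fin s)) : IsBouquet U L x (fun i => P (τ i)) where
  res := h.res.perm τ
  eig := by
    obtain ⟨lam, hlam⟩ := h.eig
    exact ⟨fun i => lam (τ i), fun i => hlam _⟩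
  mem_iff v := by
    rw [h.mem_iff]
    exact and_congr_right fun _ => ⟨fun ⟨i, hi⟩ => ⟨τ.symm i, by simpa using hi⟩,
      fun ⟨i, hi⟩ => ⟨τ i, hi⟩⟩

/-- Near each point the reduced eigen-bouquet is given by an analytic family of resolutions. -/
theorem LocalReduction.exists_analytic_bouquet {W : Set (Base u)}
    {p : Base u → Quad 𝕜 n →ₗ[𝕜] Quad 𝕜 n} (h : LocalReduction U L W p) (hN : IsNormalFamily U L)
    (hL : AnalyticOnNhd ℝ L U) {y : Base u} (hy : y ∈ W) :
    ∃ W' : Set (Base u), IsOpen W' ∧ y ∈ W' ∧ W' ⊆ U ∧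
      ∃ S : Fin (sMax U L) → Base u → (Fib 𝕜 n →L[𝕜] Fib 𝕜 n), (∀ i, AnalyticOnNhd ℝ (S i) W') ∧
        ∀ x ∈ W', IsBouquet U L x (fun i => S i x) := by
  have hex : ∀ x, ∃ (P : Fin (sMax U L) → (Fib 𝕜 n →L[𝕜] Fib 𝕜 n)),
      x ∈ W → IsResolution P ∧ IsAdapted (p x) P ∧ IsBouquet U L x P := by
    intro x
    by_cases hx : x ∈ W
    · obtain ⟨P, lam, hP, hT, hA⟩ := h.exists_resolution hN hL hx
      exact ⟨P, fun _ => ⟨hP, hA, hP, ⟨lam, hT⟩, hA.mem_EV'_iff hP (h.mem_iff x hx)⟩⟩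
    · exact ⟨0, fun h1 => absurd h1 hx⟩
  -- `Pf` is an arbitrary pointwise choice, with no continuity in `x`; its value outside `W` is
  -- irrelevant.
  choose Pf hPf using hex
  have hWev : ∀ᶠ x in 𝓝 y, x ∈ W := h.isOpen.eventually_mem hy
  have hsec : ∀ i, ∃ f : Base u → (Fib 𝕜 n →L[𝕜] Fib 𝕜 n), AnalyticAt ℝ f y ∧ f y = Pf y i ∧
      ∀ᶠ x in 𝓝 y, scalarEq (p x) (f x) = 0 := by
    intro i
    refine exists_analytic_section (𝕜 := 𝕜) (N := fun x => scalarEq (p x))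
      (h.analyticAt_scalarEq hy) ?_ ((hPf y hy).2.1.scalarEq_proj (hPf y hy).1 i)
    filter_upwards [hWev] with x hx
    rw [(hPf x hx).2.1.finrank_ker (hPf x hx).1, (hPf y hy).2.1.finrank_ker (hPf y hy).1]
  choose T hT hTy hTker using hsec
  obtain ⟨S, hS, -, hSτ⟩ := exists_analytic_resolution (hPf y hy).1 hT hTy (Pf := Pf) (by
    filter_upwards [hWev, eventually_all.2 hTker] with x hx hk
    refine ⟨(hPf x hx).1, fun i => ?_⟩
    have h1 : T i x ∈ LinearMap.ker (scalarEq (p x)) := hk i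
    rw [(hPf x hx).2.1.ker_scalarEq (hPf x hx).1] at h1
    obtain ⟨t, ht⟩ := (Submodule.mem_span_range_iff_exists_fun 𝕜).1 h1
    exact ⟨t, ht.symm⟩)
  obtain ⟨W', hW', hW'o, hyW'⟩ := eventually_nhds_iff.1 (hWev.and (hSτ.and
    (eventually_all.2 fun i => (hS i).eventually_analyticAt)))
  refine ⟨W', hW'o, hyW', fun x hx => h.subset (hW' x hx).1, S,
    fun i x hx => (hW' x hx).2.2 i, fun x hx => ?_⟩
  obtain ⟨hxW, ⟨τ, hτ⟩, -⟩ := hW' x hx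
  have := (hPf x hxW).2.2.perm τ
  simpa only [← hτ] using this

end

end EigenBouquet

namespace EigenBouquet

noncomputable section

variable {𝕜 : Type*} [RCLike 𝕜]

/-! ### Unitary transport along an analytic family of resolutions -/

section Transport

variable {E : Type*} [NormedAddCommGroup E] [InnerProductSpace 𝕜 E]
  [FiniteDimensional 𝕜 E] [CompleteSpace E] [NormedSpace ℝ E] [IsScalarTower ℝ 𝕜 E]
  {X : Type*} [NormedAddCommGroup X] [NormedSpace ℝ X] {s : ℕ}

theorem IsResolution.reflection_mem_unitary {P : Fin s → (E →L[𝕜] E)} (h : IsResolution P)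
    (i : Fin s) : P i + P i - 1 ∈ unitary (E →L[𝕜] E) := by
  have h1 : P i * P i = P i := by rw [h.mul_eq, if_pos rfl]
  have h2 : (P i + P i - 1) * (P i + P i - 1) = 1 := by
    simp only [sub_mul, mul_sub, add_mul, mul_add, h1, one_mul, mul_one]
    abel
  have h3 : star (P i + P i - 1) = P i + P i - 1 := by
    rw [star_sub, star_add, star_one, h.star_eq]
  rw [Unitary.mem_iff, h3]
  exact ⟨h2, h2⟩

/-- The operator `C = Σ S_i(x) S_i(y)` intertwines the two resolutions and is `1` at `y`. Its
unitary part `C (C* C)^{-1/2}` intertwines them too, because the square root commutes with the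
`S_i(y)`. -/
theorem exists_unitary_transport {y : X} {S : Fin s → X → (E →L[𝕜] E)}
    (hS : ∀ i, AnalyticAt ℝ (S i) y) (h : ∀ᶠ x in 𝓝 y, IsResolution fun i => S i x) :
    ∃ T : X → (E →L[𝕜] E), AnalyticAt ℝ T y ∧ T y = 1 ∧ ∀ᶠ x in 𝓝 y,
      star (T x) * T x = 1 ∧ T x * star (T x) = 1 ∧ ∀ i, T x * S i y = S i x * T x := by
  obtain ⟨r, δ, ε, hδ, hε, hε1, hr1, hr, hru⟩ := exists_analytic_sqrt (E →L[𝕜] E)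
  have hRy : IsResolution fun i => S i y := h.self_of_nhds
  let C : X → (E →L[𝕜] E) := fun x => ∑ i, S i x * S i y
  have hC : AnalyticAt ℝ C y :=
    Finset.analyticAt_fun_sum _ fun i _ => (hS i).mul analyticAt_const
  have hCy : C y = 1 := by
    simp only [C]
    rw [← hRy.sum_eq]
    refine Finset.sum_congr rfl fun i _ => ?_
    have := hRy.mul_eq i i
    rwa [if_pos rfl] at this
  let D : X → (E →L[𝕜] E) := fun x => star (C x) * C x
  have hD : AnalyticAt ℝ D y := (analyticAt_star hC).mul hC
  have hDy : D y = 1 := by simp only [D, hCy, star_one, one_mul]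
  have hrD : AnalyticAt ℝ (fun x => r (D x)) y := by
    refine AnalyticAt.fun_comp (g := r) ?_ hD
    rw [hDy]
    exact (hr 1 (Metric.mem_ball_self hδ)).1
  have hinv : AnalyticAt ℝ (fun x => Ring.inverse (r (D x))) y := by
    refine AnalyticAt.fun_comp ?_ hrD
    rw [hDy, hr1]
    exact analyticAt_inverse (𝕜 := ℝ) (1 : (E →L[𝕜] E)ˣ)
  refine ⟨fun x => C x * Ring.inverse (r (D x)), hC.mul hinv, ?_, ?_⟩
  · simp only [hDy, hr1, Ring.inverse_one, mul_one, hCy]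
  have hball : ∀ᶠ x in 𝓝 y, D x ∈ Metric.ball 1 δ := by
    refine hD.continuousAt.eventually (Metric.isOpen_ball.mem_nhds ?_)
    rw [hDy]
    exact Metric.mem_ball_self hδ
  have hunit : ∀ᶠ x in 𝓝 y, IsUnit (C x) := by
    refine hC.continuousAt.eventually (Units.isOpen.mem_nhds ?_)
    rw [hCy]
    exact isUnit_one
  filter_upwards [h, hball, hunit] with x hR hDx hCu
  obtain ⟨-, hrr, hrε⟩ := hr _ hDx
  set q := r (D x) with hq
  -- The adjoint of `q` is another square root of the self-adjoint `D x`, equally close to `1`.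
  have hqstar : star q = q := by
    have e1 : star q * star q = D x := by
      rw [← star_mul, hrr, star_mul, star_star]
    have e2 : star q ∈ Metric.ball (1 : E →L[𝕜] E) ε := by
      rw [mem_ball_iff_norm] at hrε ⊢
      rwa [← star_one, ← star_sub, norm_star]
    have := hru _ e2 (by rwa [e1])
    rw [e1] at this
    exact this.symm
  have hCS : ∀ j, C x * S j y = S j x * C x := by
    intro j
    simp only [C]
    rw [Finset.sum_mul, Finset.mul_sum]
    refine Finset.sum_congr rfl fun i _ => ?_
    have e1 := hRy.mul_eq i j
    have e2 := hR.mul_eq j i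
    rw [mul_assoc, e1, ← mul_assoc, e2]
    by_cases hij : i = j
    · subst hij; rw [if_pos rfl, if_pos rfl]
    · rw [if_neg hij, if_neg (Ne.symm hij), mul_zero, zero_mul]
  have hSC : ∀ j, S j y * star (C x) = star (C x) * S j x := by
    intro j
    have := congrArg star (hCS j)
    rwa [star_mul, star_mul, hRy.star_eq, hR.star_eq] at this
  have hDS : ∀ j, D x * S j y = S j y * D x := by
    intro j
    simp only [D]
    rw [mul_assoc, hCS, ← mul_assoc, ← hSC, mul_assoc]
  have hqS : ∀ j, q * S j y = S j y * q := by
    -- Conjugation by the reflection `V = 2 S_j(y) - 1` fixes `D x` and preserves the distance to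
    -- `1`, so by uniqueness it fixes the square root `q`.
    intro j
    let V : unitary (E →L[𝕜] E) := ⟨_, hRy.reflection_mem_unitary j⟩
    have hVV : (V : E →L[𝕜] E) * V = 1 := by
      have := (Unitary.mem_iff.1 V.2).1
      rwa [show star (V : E →L[𝕜] E) = V by
        simp only [V]
        rw [star_sub, star_add, star_one, hRy.star_eq]] at this
    have hVD : (V : E →L[𝕜] E) * D x = D x * V := by
      simp only [V, sub_mul, mul_sub, add_mul, mul_add, hDS, one_mul, mul_one]
    have e1 : (V * q * V : E →L[𝕜] E) * (V * q * V) = D x := by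
      calc (V * q * V : E →L[𝕜] E) * (V * q * V) = V * q * (V * V) * q * V := by
            simp only [mul_assoc]
        _ = V * (q * q) * V := by rw [hVV, mul_one]; simp only [mul_assoc]
        _ = D x := by rw [hrr, hVD, mul_assoc, hVV, mul_one]
    have e2 : (V * q * V : E →L[𝕜] E) ∈ Metric.ball (1 : E →L[𝕜] E) ε := by
      rw [mem_ball_iff_norm] at hrε ⊢
      have : (V * q * V : E →L[𝕜] E) - 1 = V * (q - 1) * V := by
        rw [mul_sub (V : E →L[𝕜] E) q 1, sub_mul ((V : E →L[𝕜] E) * q), mul_one, hVV]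
      rwa [this, CStarRing.norm_mul_coe_unitary, CStarRing.norm_coe_unitary_mul]
    have e3 := hru _ e2 (by rwa [e1])
    rw [e1] at e3
    have e4 : q * V = V * q := by
      calc q * V = V * q * V * V := by rw [← e3]
        _ = V * q := by rw [mul_assoc, hVV, mul_one]
    simp only [V, mul_sub, sub_mul, mul_add, add_mul, mul_one, one_mul] at e4
    have e5 := sub_left_inj.1 e4
    rw [← two_smul ℝ, ← two_smul ℝ] at e5
    exact smul_right_injective _ (two_ne_zero (α := ℝ)) e5
  have hqu : IsUnit q := by
    have h1 : ‖1 - q‖ < 1 := by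
      rw [norm_sub_rev]
      rw [mem_ball_iff_norm] at hrε
      exact hrε.trans_le hε1
    have := isUnit_one_sub_of_norm_lt_one h1
    rwa [sub_sub_cancel] at this
  obtain ⟨w, hw⟩ := hqu
  have hwi : Ring.inverse q = (w⁻¹ : (E →L[𝕜] E)ˣ) := by rw [← hw, Ring.inverse_unit]
  have hqi : q * Ring.inverse q = 1 := by rw [hwi, ← hw, w.mul_inv]
  have hiq : Ring.inverse q * q = 1 := by rw [hwi, ← hw, w.inv_mul]
  have hstar : star (Ring.inverse q) = Ring.inverse q := by
    have e1 : star (Ring.inverse q) * q = 1 := by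
      have := congrArg star hqi
      rwa [star_mul, star_one, hqstar] at this
    calc star (Ring.inverse q) = star (Ring.inverse q) * (q * Ring.inverse q) := by
          rw [hqi, mul_one]
      _ = Ring.inverse q := by rw [← mul_assoc, e1, one_mul]
  have hTT : star (C x * Ring.inverse q) * (C x * Ring.inverse q) = 1 := by
    calc star (C x * Ring.inverse q) * (C x * Ring.inverse q)
        = Ring.inverse q * D x * Ring.inverse q := by
          rw [star_mul, hstar]; simp only [D, mul_assoc]
      _ = (Ring.inverse q * q) * (q * Ring.inverse q) := by rw [← hrr]; simp only [mul_assoc]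
      _ = 1 := by rw [hiq, hqi, one_mul]
  refine ⟨hTT, ?_, fun j => ?_⟩
  -- An isometry that is invertible has its adjoint as a two-sided inverse.
  · have hu : IsUnit (C x * Ring.inverse q) := hCu.mul (hwi ▸ w⁻¹.isUnit)
    obtain ⟨z, hz⟩ := hu
    rw [← hz] at hTT ⊢
    rw [left_inv_eq_right_inv hTT z.mul_inv, z.mul_inv]
  · have e1 : Ring.inverse q * S j y = S j y * Ring.inverse q := by
      calc Ring.inverse q * S j y = Ring.inverse q * (S j y * q) * Ring.inverse q := by
            rw [mul_assoc, mul_assoc, hqi, mul_one]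
        _ = S j y * Ring.inverse q := by rw [← hqS, ← mul_assoc, hiq, one_mul]
    rw [mul_assoc, e1, ← mul_assoc, hCS, mul_assoc]

end Transport

end

end EigenBouquet

namespace EigenBouquet

noncomputable section

variable {𝕜 : Type*} [RCLike 𝕜] {u n : ℕ} {U : Set (Base u)} {L : OpFamily 𝕜 u n}

/-! ### Local frames of eigenvectors -/

/-- A local analytic family of resolutions which gives the reduced eigen-bouquet, with a unitary
transport from the fibre at `y`. -/
structure IsTrivialization {s : ℕ} (U : Set (Base u)) (L : OpFamily 𝕜 u n) (y : Base u)
    (W : Set (Base u)) (S : Fin s → Base u → (Fib 𝕜 n →L[𝕜] Fib 𝕜 n))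
    (T : Base u → (Fib 𝕜 n →L[𝕜] Fib 𝕜 n)) : Prop where
  isOpen : IsOpen W
  mem : y ∈ W
  subset : W ⊆ U
  analytic : ∀ i, AnalyticOnNhd ℝ (S i) W
  bouquet : ∀ x ∈ W, IsBouquet U L x (fun i => S i x)
  transport_analytic : AnalyticOnNhd ℝ T W
  star_mul : ∀ x ∈ W, star (T x) * T x = 1
  mul_star : ∀ x ∈ W, T x * star (T x) = 1
  transport : ∀ x ∈ W, ∀ i, T x * S i y = S i x * T x

theorem IsNormalFamily.exists_trivialization (h : IsNormalFamily U L) (hUo : IsOpen U)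
    (hUc : IsPreconnected U) (hL : AnalyticOnNhd ℝ L U) {y : Base u} (hy : y ∈ U)
    (hp : (fittingStalk U L y).IsPrincipal) :
    ∃ W, ∃ S : Fin (sMax U L) → Base u → (Fib 𝕜 n →L[𝕜] Fib 𝕜 n), ∃ T,
      IsTrivialization U L y W S T := by
  obtain ⟨W, p, hyW, hW⟩ := h.exists_localReduction hUo hUc hL hy hp
  obtain ⟨W', hW'o, hyW', hW'U, S, hS, hb⟩ := hW.exists_analytic_bouquet h hL hyW
  obtain ⟨T, hT, -, hTx⟩ := exists_unitary_transport (fun i => hS i y hyW')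
    ((hW'o.eventually_mem hyW').mono fun x hx => (hb x hx).res)
  obtain ⟨W₁, hW₁, hW₁o, hyW₁⟩ := eventually_nhds_iff.1 (hT.eventually_analyticAt.and hTx)
  exact ⟨W' ∩ W₁, S, T, hW'o.inter hW₁o, ⟨hyW', hyW₁⟩, inter_subset_left.trans hW'U,
    fun i => (hS i).mono inter_subset_left, fun x hx => hb x hx.1,
    fun x hx => (hW₁ x hx.2).1, fun x hx => (hW₁ x hx.2).2.1, fun x hx => (hW₁ x hx.2).2.2.1,
    fun x hx => (hW₁ x hx.2).2.2.2⟩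

theorem IsResolution.exists_orthonormalBasis {E : Type*} [NormedAddCommGroup E]
    [InnerProductSpace 𝕜 E] [FiniteDimensional 𝕜 E] [CompleteSpace E] {s m : ℕ}
    {P : Fin s → (E →L[𝕜] E)} (h : IsResolution P) (hm : Module.finrank 𝕜 E = m) :
    ∃ b : OrthonormalBasis (Fin m) 𝕜 E, ∀ k, ∃ i, P i (b k) = b k := by
  -- The symmetric operator `Σ i P_i` has a different eigenvalue on each range, so its orthonormal
  -- eigenvectors lie in the ranges.
  let A : E →ₗ[𝕜] E := ((∑ i : Fin s, ((i : ℕ) : 𝕜) • P i : E →L[𝕜] E) : E →ₗ[𝕜] E)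
  have hA : A.IsSymmetric := by
    intro v w
    simp only [A, ContinuousLinearMap.coe_coe, sum_apply, smul_apply, sum_inner, inner_sum,
      inner_smul_left, inner_smul_right, h.inner_left]
    simp
  refine ⟨hA.eigenvectorBasis hm, fun k => ?_⟩
  set v := hA.eigenvectorBasis hm k with hv
  have hAv : A v = (hA.eigenvalues hm k : 𝕜) • v := hA.apply_eigenvectorBasis hm k
  obtain ⟨i, hi⟩ : ∃ i, P i v ≠ 0 := by
    by_contra! hc
    have h0 : v = 0 := by rw [← h.sum_proj v]; simp [hc]
    exact (hA.eigenvectorBasis hm).orthonormal.ne_zero k h0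
  have hcoef : ∀ j, P j v ≠ 0 → ((j : ℕ) : 𝕜) = hA.eigenvalues hm k := by
    intro j hj
    have h1 := congrArg (P j) hAv
    simp only [A, ContinuousLinearMap.coe_coe, sum_apply, smul_apply, map_sum, map_smul,
      h.apply_apply] at h1
    rw [Finset.sum_eq_single j] at h1
    · simp only [if_true] at h1
      exact smul_left_injective 𝕜 hj h1
    · intro m _ hm
      rw [if_neg hm.symm, smul_zero]
    · simp
  refine ⟨i, ?_⟩
  conv_rhs => rw [← h.sum_proj v]
  symm
  refine Finset.sum_eq_single i (fun j _ hj => ?_) (by simp)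
  by_contra hjv
  refine hj (Fin.ext ?_)
  exact_mod_cast (hcoef j hjv).trans (hcoef i hi).symm

section Isometry

variable {E : Type*} [NormedAddCommGroup E] [InnerProductSpace 𝕜 E] [CompleteSpace E]

theorem inner_map_of_star_mul {T : E →L[𝕜] E} (hT : star T * T = 1) (v w : E) :
    inner 𝕜 (T v) (T w) = inner 𝕜 v w := by
  rw [← ContinuousLinearMap.adjoint_inner_right, ← ContinuousLinearMap.star_eq_adjoint,
    ← mul_apply_eq_comp, hT, one_apply_eq_self]

end Isometry

/-- An orthonormal basis adapted to the resolution at `y` is moved by the unitary `T x`, which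
carries the ranges at `y` to those at `x`. -/
theorem IsTrivialization.exists_eigenbasis {s : ℕ} {y : Base u} {W : Set (Base u)}
    {S : Fin s → Base u → (Fib 𝕜 n →L[𝕜] Fib 𝕜 n)} {T : Base u → (Fib 𝕜 n →L[𝕜] Fib 𝕜 n)}
    (h : IsTrivialization U L y W S T) :
    ∃ b : Fin n → Base u → Fib 𝕜 n, (∀ i, AnalyticOnNhd ℝ (b i) W) ∧
      ∀ x ∈ W, Orthonormal 𝕜 (fun i => b i x) ∧
        ∀ i, ∃ μ : 𝕜, (endo L x).HasEigenvector μ (b i x) := by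
  obtain ⟨b, hb⟩ := (h.bouquet y h.mem).res.exists_orthonormalBasis (m := n) (by simp)
  refine ⟨fun i x => T x (b i),
    fun i x hx => analyticAt_apply (h.transport_analytic x hx) analyticAt_const,
    fun x hx => ?_⟩
  have hon : Orthonormal 𝕜 (fun i => T x (b i)) := by
    rw [orthonormal_iff_ite]
    intro i j
    rw [inner_map_of_star_mul (h.star_mul x hx)]
    exact orthonormal_iff_ite.1 b.orthonormal i j
  refine ⟨hon, fun k => ?_⟩
  obtain ⟨i, hi⟩ := hb k
  obtain ⟨lam, hlam⟩ := (h.bouquet x hx).eig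
  refine ⟨lam i, hasEigenvector_of_mem hlam (i := i) ?_ (hon.ne_zero k)⟩
  have := congrArg (fun A : Fib 𝕜 n →L[𝕜] Fib 𝕜 n => A (b k)) (h.transport x hx i)
  simp only [mul_apply_eq_comp] at this
  rw [hi] at this
  exact this.symm

/-- The eigenvalues are the Rayleigh quotients `⟨b_i, L b_i⟩`, hence analytic; the matrix of `L x`
in the basis is diagonal, which accounts for multiplicities. -/
theorem exists_analytic_eigenvalues {W : Set (Base u)} (hL : AnalyticOnNhd ℝ L W)
    {b : Fin n → Base u → Fib 𝕜 n} (hb : ∀ i, AnalyticOnNhd ℝ (b i) W)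
    (h : ∀ x ∈ W, Orthonormal 𝕜 (fun i => b i x) ∧
      ∀ i, ∃ μ : 𝕜, (endo L x).HasEigenvector μ (b i x)) :
    ∃ lam : Fin n → Base u → 𝕜, (∀ i, AnalyticOnNhd ℝ (lam i) W) ∧
      ∀ x ∈ W, (endo L x).charpoly = ∏ i, (Polynomial.X - Polynomial.C (lam i x)) := by
  refine ⟨fun i x => inner 𝕜 (b i x) (L x (b i x)),
    fun i x hx => analyticAt_inner (hb i x hx) (analyticAt_apply (hL x hx) (hb i x hx)),
    fun x hx => ?_⟩
  obtain ⟨hon, hev⟩ := h x hx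
  choose μ hμ using hev
  have happ : ∀ i, L x (b i x) = μ i • b i x := fun i => (hμ i).apply_eq_smul
  let B := Module.Basis.mk hon.linearIndependent
    (hon.linearIndependent.span_eq_top_of_card_eq_finrank' (by simp)).ge
  have hB : ∀ i, B i = b i x := fun i => by simp [B]
  rw [← LinearMap.charpoly_toMatrix (endo L x) B]
  have hdiag : LinearMap.toMatrix B B (endo L x) =
      Matrix.diagonal fun i => inner 𝕜 (b i x) (L x (b i x)) := by
    ext i j
    rw [LinearMap.toMatrix_apply, hB]
    change B.repr (L x (b j x)) i = _
    rw [happ, ← hB j, map_smul, B.repr_self, Finsupp.smul_apply, Finsupp.single_apply,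
      Matrix.diagonal_apply]
    by_cases hij : j = i
    · subst hij
      rw [if_pos rfl, if_pos rfl, happ, inner_smul_right, inner_self_eq_norm_sq_to_K, hon.1]
      simp
    · rw [if_neg hij, if_neg (Ne.symm hij), smul_zero]
  rw [hdiag, Matrix.charpoly_diagonal]

/-! ### The dimensions of the components -/

/-- The dimension of the range of an operator. -/
def rk {E : Type*} [NormedAddCommGroup E] [InnerProductSpace 𝕜 E] (P : E →L[𝕜] E) : ℕ :=
  Module.finrank 𝕜 (LinearMap.range (P : E →ₗ[𝕜] E))

theorem rk_eq_of_intertwine {E : Type*} [NormedAddCommGroup E] [InnerProductSpace 𝕜 E]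
    [CompleteSpace E] {T P P' : E →L[𝕜] E} (h : star T * T = 1) (h' : T * star T = 1)
    (hT : T * P = P' * T) : rk P' = rk P := by
  have e : ∀ v, star T (T v) = v := fun v => congrArg (fun A : E →L[𝕜] E => A v) h
  have e' : ∀ v, T (star T v) = v := fun v => congrArg (fun A : E →L[𝕜] E => A v) h'
  have eT : ∀ v, T (P v) = P' (T v) := fun v => congrArg (fun A : E →L[𝕜] E => A v) hT
  have key : LinearMap.range (P' : E →ₗ[𝕜] E) =
      (LinearMap.range (P : E →ₗ[𝕜] E)).map (T : E →ₗ[𝕜] E) := by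
    ext w
    constructor
    · rintro ⟨v, rfl⟩
      refine ⟨P (star T v), ⟨_, rfl⟩, ?_⟩
      change T (P (star T v)) = P' v
      rw [eT, e']
    · rintro ⟨_, ⟨v, rfl⟩, rfl⟩
      exact ⟨T v, (eT v).symm⟩
  rw [rk, rk, key]
  exact LinearEquiv.finrank_eq (Submodule.equivMapOfInjective _
    (Function.LeftInverse.injective (g := fun v => (star T : E →L[𝕜] E) v) e) _).symm

/-- The reduced eigen-bouquet at `x` consists of spaces of dimensions `e i`. -/
def HasRanks (U : Set (Base u)) (L : OpFamily 𝕜 u n) (x : Base u) {s : ℕ} (e : Fin s → ℕ) : Prop :=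
  ∃ P : Fin s → (Fib 𝕜 n →L[𝕜] Fib 𝕜 n), IsBouquet U L x P ∧ ∀ i, rk (P i) = e i

theorem IsBouquet.exists_perm {s : ℕ} {x : Base u} {P P' : Fin s → (Fib 𝕜 n →L[𝕜] Fib 𝕜 n)}
    (h : IsBouquet U L x P) (h' : IsBouquet U L x P') :
    ∃ τ : Equiv.Perm (Fin s), ∀ i, P' i = P (τ i) :=
  h.res.exists_perm h'.res fun v h0 => by
    have := (h.mem_iff v).symm.trans (h'.mem_iff v)
    simpa [h0] using this

theorem IsTrivialization.rk_eq {s : ℕ} {y : Base u} {W : Set (Base u)}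
    {S : Fin s → Base u → (Fib 𝕜 n →L[𝕜] Fib 𝕜 n)} {T : Base u → (Fib 𝕜 n →L[𝕜] Fib 𝕜 n)}
    (h : IsTrivialization U L y W S T) {x : Base u} (hx : x ∈ W) (i : Fin s) :
    rk (S i x) = rk (S i y) :=
  rk_eq_of_intertwine (h.star_mul x hx) (h.mul_star x hx) (h.transport x hx i)

theorem IsTrivialization.hasRanks_iff {s : ℕ} {y : Base u} {W : Set (Base u)}
    {S : Fin s → Base u → (Fib 𝕜 n →L[𝕜] Fib 𝕜 n)} {T : Base u → (Fib 𝕜 n →L[𝕜] Fib 𝕜 n)}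
    (h : IsTrivialization U L y W S T) {x : Base u} (hx : x ∈ W) (e : Fin s → ℕ) :
    HasRanks U L x e ↔ HasRanks U L y e := by
  constructor
  · rintro ⟨P, hP, hr⟩
    obtain ⟨τ, hτ⟩ := (h.bouquet x hx).exists_perm hP
    refine ⟨fun i => S (τ i) y, (h.bouquet y h.mem).perm τ, fun i => ?_⟩
    rw [← hr, hτ, h.rk_eq hx]
  · rintro ⟨P, hP, hr⟩
    obtain ⟨τ, hτ⟩ := (h.bouquet y h.mem).exists_perm hP
    refine ⟨fun i => S (τ i) x, (h.bouquet x hx).perm τ, fun i => ?_⟩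
    rw [← hr, hτ, h.rk_eq hx]

/-- `U` has local trivializations of the reduced eigen-bouquet. -/
def HasTrivializations (U : Set (Base u)) (L : OpFamily 𝕜 u n) (s : ℕ) : Prop :=
  ∀ y ∈ U, ∃ W, ∃ S : Fin s → Base u → (Fib 𝕜 n →L[𝕜] Fib 𝕜 n), ∃ T, IsTrivialization U L y W S T

/-- The ranks are those at a base point, sorted. Since `HasRanks` allows any labelling, it is a
locally constant condition and spreads over the connected set `U`. -/
theorem HasTrivializations.exists_ranks {s : ℕ} (h : HasTrivializations U L s)
    (hU : IsConnected U) :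
    ∃ e : Fin s → ℕ, Monotone e ∧ ∀ x ∈ U, HasRanks U L x e := by
  obtain ⟨y, hy⟩ := hU.nonempty
  obtain ⟨W, S, T, hW⟩ := h y hy
  let e₀ : Fin s → ℕ := fun i => rk (S i y)
  refine ⟨e₀ ∘ Tuple.sort e₀, Tuple.monotone_sort e₀, fun x hx => ?_⟩
  have h1 : HasRanks U L y (e₀ ∘ Tuple.sort e₀) :=
    ⟨fun i => S (Tuple.sort e₀ i) y, (hW.bouquet y hW.mem).perm _, fun i => rfl⟩
  refine (hU.isPreconnected.induction₂
    (fun a b => HasRanks U L a (e₀ ∘ Tuple.sort e₀) ↔ HasRanks U L b (e₀ ∘ Tuple.sort e₀))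
    (fun z hz => ?_) (fun _ _ _ _ _ _ => Iff.trans) (fun _ _ _ _ => Iff.symm) hy hx).1 h1
  obtain ⟨W, S, T, hW⟩ := h z hz
  filter_upwards [mem_nhdsWithin_of_mem_nhds (hW.isOpen.mem_nhds hW.mem)] with x hx
  exact (hW.hasRanks_iff hx _).symm

theorem HasRanks.hasEigDims {x : Base u} {s : ℕ} {e : Fin s → ℕ} (h : HasRanks U L x e)
    (hs : numEig L x = s) : HasEigDims L x e := by
  obtain ⟨P, hP, hr⟩ := h
  obtain ⟨lam, hlam⟩ := hP.eig
  have hinj : Function.Injective lam := injective_of_ncard hP.res hlam hs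
  have hbij : Function.Bijective fun i => (⟨lam i, (hasEigenvalue_iff hP.res hlam _).2 ⟨i, rfl⟩⟩ :
      {μ : 𝕜 // (endo L x).HasEigenvalue μ}) := by
    refine ⟨fun i j hij => hinj (congrArg Subtype.val hij), fun ⟨μ, hμ⟩ => ?_⟩
    obtain ⟨i, rfl⟩ := (hasEigenvalue_iff hP.res hlam μ).1 hμ
    exact ⟨i, rfl⟩
  refine ⟨Equiv.ofBijective _ hbij, fun i => ?_⟩
  have key : (endo L x).eigenspace (lam i) = LinearMap.range (P i : Fib 𝕜 n →ₗ[𝕜] Fib 𝕜 n) := by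
    ext v
    rw [hP.res.mem_range_iff]
    exact mem_eigenspace_iff_of_injective hP.res hlam hinj i v
  change Module.finrank 𝕜 ((endo L x).eigenspace (lam i)) = e i
  rw [← hr i, rk, key]

end

end EigenBouquet

namespace EigenBouquet

noncomputable section

variable {𝕜 : Type*} [RCLike 𝕜] {u n : ℕ} {U : Set (Base u)} {L : OpFamily 𝕜 u n}

/-! ### Global sections over simply connected open sets -/

/-- The covering space of the components of the reduced eigen-bouquet over `V`. -/
def Sheets (U V : Set (Base u)) (L : OpFamily 𝕜 u n) (s : ℕ) : Type _ :=
  {p : V × (Fib 𝕜 n →L[𝕜] Fib 𝕜 n) //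
    ∃ P : Fin s → (Fib 𝕜 n →L[𝕜] Fib 𝕜 n), IsBouquet U L p.1 P ∧ ∃ i, P i = p.2}

instance (U V : Set (Base u)) (L : OpFamily 𝕜 u n) (s : ℕ) : TopologicalSpace (Sheets U V L s) :=
  inferInstanceAs (TopologicalSpace (Subtype _))

/-- The projection of the covering space of the components. -/
def sheetsProj (U V : Set (Base u)) (L : OpFamily 𝕜 u n) (s : ℕ) (p : Sheets U V L s) : V := p.1.1

theorem continuous_sheetsProj (U V : Set (Base u)) (L : OpFamily 𝕜 u n) (s : ℕ) :
    Continuous (sheetsProj U V L s) := continuous_fst.comp continuous_subtype_val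

theorem IsBouquet.exists_eq {s : ℕ} {x : Base u} {P P' : Fin s → (Fib 𝕜 n →L[𝕜] Fib 𝕜 n)}
    (h : IsBouquet U L x P) (h' : IsBouquet U L x P') (i : Fin s) : ∃ j, P' i = P j := by
  obtain ⟨τ, hτ⟩ := h.exists_perm h'
  exact ⟨τ i, hτ i⟩

theorem IsResolution.injective {E : Type*} [NormedAddCommGroup E] [InnerProductSpace 𝕜 E]
    [CompleteSpace E] {s : ℕ} {P : Fin s → (E →L[𝕜] E)} (h : IsResolution P) :
    Function.Injective P := by
  intro i j hij
  by_contra hne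
  have := h.mul_eq i j
  rw [if_neg hne, ← hij, h.mul_eq, if_pos rfl] at this
  exact h.ne_zero i this

theorem IsTrivialization.isEvenlyCovered {s : ℕ} {y : Base u} {W V : Set (Base u)}
    {S : Fin s → Base u → (Fib 𝕜 n →L[𝕜] Fib 𝕜 n)} {T : Base u → (Fib 𝕜 n →L[𝕜] Fib 𝕜 n)}
    (h : IsTrivialization U L y W S T) (hy : y ∈ V) :
    IsEvenlyCovered (sheetsProj U V L s) ⟨y, hy⟩ (Fin s) := by
  have hopen : IsOpen ((↑) ⁻¹' W : Set V) := h.isOpen.preimage continuous_subtype_val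
  have hmem : (⟨y, hy⟩ : V) ∈ ((↑) ⁻¹' W : Set V) := h.mem
  refine ⟨inferInstance, ((↑) ⁻¹' W : Set V), hmem, hopen, hopen.preimage (continuous_sheetsProj ..), ?_⟩
  have hidx : ∀ p : (sheetsProj U V L s) ⁻¹' ((↑) ⁻¹' W : Set V),
      ∃ i, p.1.1.2 = S i p.1.1.1 := by
    rintro ⟨⟨⟨x, A⟩, P, hP, i, hi⟩, hx⟩
    obtain ⟨j, hj⟩ := (h.bouquet x hx).exists_eq hP i
    exact ⟨j, hi.symm.trans hj⟩
  choose idx hidx using hidx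
  have hScont : ∀ i, ContinuousOn (S i) W := fun i => (h.analytic i).continuousOn
  -- The sheet index is detected by a non-vanishing product, an open condition; this is what makes
  -- it continuous.
  have huniq : ∀ (p : (sheetsProj U V L s) ⁻¹' ((↑) ⁻¹' W : Set V)) i,
      idx p = i ↔ p.1.1.2 * S i p.1.1.1 ≠ 0 := by
    intro p i
    have hres := (h.bouquet p.1.1.1 p.2).res
    rw [hidx p, hres.mul_eq]
    split_ifs with hi
    · exact iff_of_true hi (hres.ne_zero _)
    · simp [hi]
  have hpx : Continuous fun p : (sheetsProj U V L s) ⁻¹' ((↑) ⁻¹' W : Set V) =>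
      (p.1.1.1 : Base u) :=
    continuous_subtype_val.comp
      ((continuous_sheetsProj U V L s).comp continuous_subtype_val)
  have hpP : Continuous fun p : (sheetsProj U V L s) ⁻¹' ((↑) ⁻¹' W : Set V) => p.1.1.2 :=
    continuous_snd.comp (continuous_subtype_val.comp continuous_subtype_val)
  have hidxc : Continuous idx := by
    rw [continuous_discrete_rng]
    intro i
    have : idx ⁻¹' {i} = {p | p.1.1.2 * S i p.1.1.1 ≠ 0} := by
      ext p
      exact huniq p i
    rw [this]
    exact isOpen_ne_fun (hpP.mul ((hScont i).comp_continuous hpx fun p => p.2)) continuous_const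
  let inv : ((↑) ⁻¹' W : Set V) × Fin s → (sheetsProj U V L s) ⁻¹' ((↑) ⁻¹' W : Set V) := fun q =>
    ⟨⟨(q.1.1, S q.2 q.1.1), fun i => S i q.1.1, h.bouquet _ q.1.2, q.2, rfl⟩, q.1.2⟩
  have hinv : Continuous inv := by
    refine Continuous.subtype_mk (Continuous.subtype_mk (Continuous.prodMk ?_ ?_) _) _
    · exact continuous_subtype_val.comp continuous_fst
    · rw [continuous_prod_of_discrete_right]
      intro i
      exact (hScont i).comp_continuous (continuous_subtype_val.comp continuous_subtype_val)
        fun q => q.2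
  refine ⟨⟨⟨fun p => (⟨p.1.1.1, p.2⟩, idx p), inv, fun p => ?_, fun q => ?_⟩, ?_, hinv⟩,
    fun p => rfl⟩
  · refine Subtype.ext (Subtype.ext (Prod.ext rfl ?_))
    exact (hidx p).symm
  · refine Prod.ext rfl ?_
    change idx (inv q) = q.2
    rw [huniq]
    have hres := (h.bouquet q.1.1 q.1.2).res
    change S q.2 q.1.1 * S q.2 q.1.1 ≠ 0
    have := hres.mul_eq q.2 q.2
    rw [if_pos rfl] at this
    rw [this]
    exact hres.ne_zero q.2
  · refine Continuous.prodMk (Continuous.subtype_mk ?_ _) hidxc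
    exact (continuous_sheetsProj U V L s).comp continuous_subtype_val

theorem HasTrivializations.isCoveringMap {s : ℕ} (h : HasTrivializations U L s) {V : Set (Base u)}
    (hV : V ⊆ U) : IsCoveringMap (sheetsProj U V L s) := by
  rintro ⟨y, hy⟩
  obtain ⟨W, S, T, hW⟩ := h y (hV hy)
  exact (hW.isEvenlyCovered hy).to_isEvenlyCovered_preimage

/-- A global labelling over `V` of the components of the reduced eigen-bouquet. -/
structure IsGlobalBouquet {s : ℕ} (U : Set (Base u)) (L : OpFamily 𝕜 u n) (V : Set (Base u))
    (σ : Fin s → Base u → (Fib 𝕜 n →L[𝕜] Fib 𝕜 n)) (e : Fin s → ℕ) : Prop where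
  bouquet : ∀ x ∈ V, IsBouquet U L x (fun i => σ i x)
  rk_eq : ∀ x ∈ V, ∀ i, rk (σ i x) = e i
  transport : ∀ y ∈ V, ∃ W, IsOpen W ∧ y ∈ W ∧ W ⊆ V ∧
    ∃ T : Base u → (Fib 𝕜 n →L[𝕜] Fib 𝕜 n), AnalyticOnNhd ℝ T W ∧
      ∀ x ∈ W, star (T x) * T x = 1 ∧ T x * star (T x) = 1 ∧ ∀ i, T x * σ i y = σ i x * T x

/-- The identity of `V` lifts through the covering of sheets, once from each projection of a
resolution at `x₀`. The lifts remain distinct, so they form a complete resolution at every point. -/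
theorem HasTrivializations.exists_globalBouquet {s : ℕ} (h : HasTrivializations U L s)
    {V : Set (Base u)} (hV : V ⊆ U) (hVo : IsOpen V) [SimplyConnectedSpace V] {e : Fin s → ℕ}
    (he : ∀ x ∈ U, HasRanks U L x e) :
    ∃ σ : Fin s → Base u → (Fib 𝕜 n →L[𝕜] Fib 𝕜 n), IsGlobalBouquet U L V σ e := by
  have hlpc : LocallyPathConnectedSpace V := hVo.locallyPathConnectedSpace
  have hpc : PathConnectedSpace V := inferInstance
  have hVp : IsPreconnected V := isPreconnected_iff_preconnectedSpace.2 inferInstance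
  obtain ⟨x₀⟩ : Nonempty V := inferInstance
  obtain ⟨P, hP, hr⟩ := he x₀ (hV x₀.2)
  have hlift : ∀ i, ∃ F : C(V, Sheets U V L s), F x₀ = ⟨(x₀, P i), P, hP, i, rfl⟩ ∧
      sheetsProj U V L s ∘ F = ContinuousMap.id V := fun i =>
    ((h.isCoveringMap hV).existsUnique_continuousMap_lifts (ContinuousMap.id V) x₀
      ⟨(x₀, P i), P, hP, i, rfl⟩ rfl).exists
  choose F hF₀ hF using hlift
  have hF' : ∀ i x, (F i x).1.1 = x := fun i x => congrFun (hF i) x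
  classical
  let σ : Fin s → Base u → (Fib 𝕜 n →L[𝕜] Fib 𝕜 n) := fun i x =>
    if hx : x ∈ V then (F i ⟨x, hx⟩).1.2 else 0
  have hσ : ∀ i (x : V), σ i x = (F i x).1.2 := fun i x => dif_pos x.2
  have hσc : ∀ i, ContinuousOn (σ i) V := by
    intro i
    rw [continuousOn_iff_continuous_domRestrict]
    have : V.domRestrict (σ i) = fun x => (F i x).1.2 := funext fun x => hσ i x
    rw [this]
    exact continuous_snd.comp (continuous_subtype_val.comp (F i).continuous)
  have hσm : ∀ i, ∀ x ∈ V, ∃ P : Fin s → (Fib 𝕜 n →L[𝕜] Fib 𝕜 n), IsBouquet U L x P ∧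
      ∃ j, P j = σ i x := by
    intro i x hx
    obtain ⟨P, hP, j, hj⟩ := (F i ⟨x, hx⟩).2
    rw [hF' i ⟨x, hx⟩] at hP
    exact ⟨P, hP, j, hj.trans (hσ i ⟨x, hx⟩).symm⟩
  -- By continuity the index of a lift in a local trivialization does not change near `y`.
  have hloc : ∀ y ∈ V, ∀ W S T, IsTrivialization U L y W S T → ∃ τ : Fin s → Fin s,
      ∀ᶠ x in 𝓝 y, ∀ i, σ i x = S (τ i) x := by
    intro y hy W S T hW
    have hex : ∀ i, ∀ x ∈ V ∩ W, ∃ j, σ i x = S j x := by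
      intro i x hx
      obtain ⟨P, hP, j, hj⟩ := hσm i x hx.1
      obtain ⟨k, hk⟩ := (hW.bouquet x hx.2).exists_eq hP j
      exact ⟨k, hj.symm.trans hk⟩
    choose τ hτ using fun i => hex i y ⟨hy, hW.mem⟩
    refine ⟨τ, eventually_all.2 fun i => ?_⟩
    have hne : σ i y * S (τ i) y ≠ 0 := by
      have hres := (hW.bouquet y hW.mem).res
      have := hres.mul_eq (τ i) (τ i)
      rw [if_pos rfl] at this
      rw [hτ, this]
      exact hres.ne_zero _
    have hcont : ContinuousAt (fun x => σ i x * S (τ i) x) y :=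
      ((hσc i).continuousAt (hVo.mem_nhds hy)).mul (hW.analytic (τ i) y hW.mem).continuousAt
    filter_upwards [hcont.eventually_ne hne, hVo.mem_nhds hy, hW.isOpen.mem_nhds hW.mem]
      with x hx hxV hxW
    obtain ⟨j, hj⟩ := hex i x ⟨hxV, hxW⟩
    have hres := (hW.bouquet x hxW).res
    have hjτ : j = τ i := by
      by_contra hc
      refine hx ?_
      have := hres.mul_eq j (τ i)
      rwa [if_neg hc, ← hj] at this
    rw [hj, hjτ]
  -- Whether two lifts agree is locally constant, and they differ at `x₀`.
  have hinj : ∀ i j, i ≠ j → ∀ x ∈ V, σ i x ≠ σ j x := by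
    intro i j hij x hx
    have hx₀ : σ i x₀ ≠ σ j x₀ := by
      rw [hσ, hσ, hF₀, hF₀]
      exact fun hc => hij (hP.res.injective hc)
    refine (hVp.induction₂ (fun a b => (σ i a ≠ σ j a) ↔ (σ i b ≠ σ j b))
      (fun z hz => ?_) (fun _ _ _ _ _ _ => Iff.trans) (fun _ _ _ _ => Iff.symm) x₀.2 hx).1 hx₀
    obtain ⟨W, S, T, hW⟩ := h z (hV hz)
    obtain ⟨τ, hτ⟩ := hloc z hz W S T hW
    have key : ∀ x ∈ W, (∀ i, σ i x = S (τ i) x) → ((σ i x ≠ σ j x) ↔ τ i ≠ τ j) := by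
      intro x hx hs
      rw [hs, hs]
      exact (hW.bouquet x hx).res.injective.ne_iff
    refine mem_nhdsWithin_of_mem_nhds ?_
    filter_upwards [hτ, hW.isOpen.mem_nhds hW.mem] with x hx hxW
    rw [key z hW.mem hτ.self_of_nhds, key x hxW hx]
  have hbq : ∀ x ∈ V, IsBouquet U L x (fun i => σ i x) := by
    intro x hx
    obtain ⟨W, S, T, hW⟩ := h x (hV hx)
    obtain ⟨τ, hτ⟩ := hloc x hx W S T hW
    have hτx := hτ.self_of_nhds
    have hτinj : Function.Injective τ := by
      intro i j hij
      by_contra hne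
      exact hinj i j hne x hx (by rw [hτx, hτx, hij])
    have := (hW.bouquet x hW.mem).perm
      (Equiv.ofBijective τ (Finite.injective_iff_bijective.1 hτinj))
    rw [show (fun i => σ i x) = fun i => S (τ i) x from funext hτx]
    exact this
  have htr : ∀ y ∈ V, ∃ W, IsOpen W ∧ y ∈ W ∧ W ⊆ V ∧
      ∃ T : Base u → (Fib 𝕜 n →L[𝕜] Fib 𝕜 n), AnalyticOnNhd ℝ T W ∧
      ∀ x ∈ W, star (T x) * T x = 1 ∧ T x * star (T x) = 1 ∧ ∀ i, T x * σ i y = σ i x * T x := by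
    intro y hy
    obtain ⟨W, S, T, hW⟩ := h y (hV hy)
    obtain ⟨τ, hτ⟩ := hloc y hy W S T hW
    obtain ⟨W', hW', hW'o, hyW'⟩ := eventually_nhds_iff.1 hτ
    refine ⟨W ∩ W' ∩ V, (hW.isOpen.inter hW'o).inter hVo, ⟨⟨hW.mem, hyW'⟩, hy⟩, inter_subset_right,
      T, hW.transport_analytic.mono fun x hx => hx.1.1, fun x hx => ⟨hW.star_mul x hx.1.1,
        hW.mul_star x hx.1.1, fun i => ?_⟩⟩
    rw [hW' y hyW' i, hW' x hx.1.2 i]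
    exact hW.transport x hx.1.1 (τ i)
  refine ⟨σ, hbq, fun x hx i => ?_, htr⟩
  have hx₀ : rk (σ i x₀) = e i := by rw [hσ, hF₀, hr]
  rw [← hx₀]
  refine hVp.induction₂ (fun a b => rk (σ i a) = rk (σ i b)) (fun z hz => ?_)
    (fun _ _ _ _ _ _ => Eq.trans) (fun _ _ _ _ => Eq.symm) hx x₀.2
  obtain ⟨W, hWo, hzW, -, T, -, hT⟩ := htr z hz
  filter_upwards [mem_nhdsWithin_of_mem_nhds (hWo.mem_nhds hzW)] with x hx
  exact (rk_eq_of_intertwine (hT x hx).1 (hT x hx).2.1 ((hT x hx).2.2 i)).symm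

end

end EigenBouquet

namespace EigenBouquet

noncomputable section

variable {𝕜 : Type*} [RCLike 𝕜] {u n : ℕ} {U : Set (Base u)} {L : OpFamily 𝕜 u n}

/-! ### The topology of projective space -/

/-- The saturation of an open set is the union of its preimages under scalings by units, each open.
-/
theorem isOpenQuotientMap_mk (𝕜 : Type*) [RCLike 𝕜] (n : ℕ) :
    IsOpenQuotientMap (fun v : {v : Fib 𝕜 n // v ≠ 0} => Projectivization.mk 𝕜 v.1 v.2) where
  surjective := fun l => ⟨⟨l.rep, l.rep_nonzero⟩, l.mk_rep⟩
  continuous := continuous_coinduced_rng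
  isOpenMap O hO := by
    rw [isOpen_coinduced]
    have : (fun v : {v : Fib 𝕜 n // v ≠ 0} => Projectivization.mk 𝕜 v.1 v.2) ⁻¹'
        ((fun v : {v : Fib 𝕜 n // v ≠ 0} => Projectivization.mk 𝕜 v.1 v.2) '' O) =
        ⋃ c : 𝕜ˣ, (fun v : {v : Fib 𝕜 n // v ≠ 0} =>
          (⟨c • v.1, (smul_ne_zero_iff_ne c).2 v.2⟩ : {v : Fib 𝕜 n // v ≠ 0})) ⁻¹' O := by
      ext v
      simp only [mem_preimage, mem_image, mem_iUnion]
      constructor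
      · rintro ⟨w, hw, h⟩
        obtain ⟨c, hc⟩ := (Projectivization.mk_eq_mk_iff 𝕜 _ _ w.2 v.2).1 h
        exact ⟨c, by convert hw⟩
      · rintro ⟨c, hc⟩
        exact ⟨_, hc, (Projectivization.mk_eq_mk_iff 𝕜 _ _ _ _).2 ⟨c, rfl⟩⟩
    rw [this]
    refine isOpen_iUnion fun c => hO.preimage (Continuous.subtype_mk ?_ _)
    exact continuous_subtype_val.const_smul c

theorem continuous_mk {X : Type*} [TopologicalSpace X] {f : X → Fib 𝕜 n} (hf : Continuous f)
    (h0 : ∀ x, f x ≠ 0) : Continuous fun x => Projectivization.mk 𝕜 (f x) (h0 x) :=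
  (isOpenQuotientMap_mk 𝕜 n).continuous.comp (hf.subtype_mk h0)

/-! ### The projective bundle of an analytic family of projections -/

/-- A family of projections of rank `e` which is locally conjugate to a constant one by analytic
families of unitary operators. -/
structure IsProjFamily (V : Set (Base u)) (σ : Base u → (Fib 𝕜 n →L[𝕜] Fib 𝕜 n)) (e : ℕ) :
    Prop where
  idem : ∀ x ∈ V, ∀ v, σ x (σ x v) = σ x v
  ne_zero : ∀ x ∈ V, σ x ≠ 0
  rk_eq : ∀ x ∈ V, rk (σ x) = e
  transport : ∀ y ∈ V, ∃ W, IsOpen W ∧ y ∈ W ∧ W ⊆ V ∧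
    ∃ N : Base u → (Fib 𝕜 n →L[𝕜] Fib 𝕜 n), AnalyticOnNhd ℝ N W ∧ N y = 1 ∧
      ∀ x ∈ W, (∀ v, star (N x) (N x v) = v) ∧ (∀ v, N x (star (N x) v) = v) ∧
        ∀ v, σ x (N x v) = N x (σ y v)

theorem IsGlobalBouquet.isProjFamily {s : ℕ} {V : Set (Base u)}
    {σ : Fin s → Base u → (Fib 𝕜 n →L[𝕜] Fib 𝕜 n)} {e : Fin s → ℕ}
    (h : IsGlobalBouquet U L V σ e) (i : Fin s) : IsProjFamily V (σ i) (e i) where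
  idem x hx v := (h.bouquet x hx).res.apply_self i v
  ne_zero x hx := (h.bouquet x hx).res.ne_zero i
  rk_eq x hx := h.rk_eq x hx i
  transport y hy := by
    obtain ⟨W, hWo, hyW, hWV, T, hT, hTx⟩ := h.transport y hy
    have e1 : ∀ x ∈ W, ∀ v, star (T x) (T x v) = v := fun x hx v =>
      congrArg (fun A : Fib 𝕜 n →L[𝕜] Fib 𝕜 n => A v) (hTx x hx).1
    have e2 : ∀ x ∈ W, ∀ v, T x (star (T x) v) = v := fun x hx v =>
      congrArg (fun A : Fib 𝕜 n →L[𝕜] Fib 𝕜 n => A v) (hTx x hx).2.1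
    have e3 : ∀ x ∈ W, ∀ v, T x (σ i y v) = σ i x (T x v) := fun x hx v =>
      congrArg (fun A : Fib 𝕜 n →L[𝕜] Fib 𝕜 n => A v) ((hTx x hx).2.2 i)
    -- The factor `star (T y)` normalises the transport to be `1` at `y`.
    refine ⟨W, hWo, hyW, hWV, fun x => T x * star (T y),
      fun x hx => analyticAt_comp_clm (hT x hx) analyticAt_const, (hTx y hyW).2.1,
      fun x hx => ⟨fun v => ?_, fun v => ?_, fun v => ?_⟩⟩
    · rw [star_mul, star_star]
      simp only [mul_apply_eq_comp]
      rw [e1 x hx, e2 y hyW]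
    · rw [star_mul, star_star]
      simp only [mul_apply_eq_comp]
      rw [e1 y hyW, e2 x hx]
    · simp only [mul_apply_eq_comp]
      rw [← e3 x hx]
      congr 1
      have := e3 y hyW (star (T y) v)
      rw [e2 y hyW] at this
      rw [← this, e1 y hyW]

/-- The projective bundle of the ranges of a family of projections. -/
def projSet (V : Set (Base u)) (σ : Base u → (Fib 𝕜 n →L[𝕜] Fib 𝕜 n)) : Set (ProjTotal 𝕜 u n) :=
  {p | p.1 ∈ V ∧ ∃ (v : Fib 𝕜 n) (hv : v ≠ 0), σ p.1 v = v ∧ p.2 = Projectivization.mk 𝕜 v hv}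

theorem mk_mem_projSet {V : Set (Base u)} {σ : Base u → (Fib 𝕜 n →L[𝕜] Fib 𝕜 n)} {x : Base u}
    {v : Fib 𝕜 n} (hv : v ≠ 0) :
    (x, Projectivization.mk 𝕜 v hv) ∈ projSet V σ ↔ x ∈ V ∧ σ x v = v := by
  refine and_congr_right fun _ => ⟨?_, fun h => ⟨v, hv, h, rfl⟩⟩
  rintro ⟨w, hw, h, heq⟩
  obtain ⟨c, rfl⟩ := (Projectivization.mk_eq_mk_iff 𝕜 _ _ hv hw).1 heq
  change σ x ((c : 𝕜) • w) = (c : 𝕜) • w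
  rw [map_smul, h]

namespace IsProjFamily

variable {V : Set (Base u)} {σ : Base u → (Fib 𝕜 n →L[𝕜] Fib 𝕜 n)} {e : ℕ}

theorem exists_ne_zero (h : IsProjFamily V σ e) {x : Base u} (hx : x ∈ V) :
    ∃ v, v ≠ 0 ∧ σ x v = v := by
  by_contra! hc
  refine h.ne_zero x hx ?_
  ext1 v
  by_contra h0
  exact hc _ h0 (h.idem x hx v)

theorem mem_cone (h : IsProjFamily V σ e) (x : Base u) (v : Fib 𝕜 n) :
    (x, v) ∈ cone (projSet V σ) ↔ x ∈ V ∧ σ x v = v := by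
  constructor
  · rintro ⟨l, ⟨hx, w, hw, hσ, rfl⟩, hv⟩
    refine ⟨hx, ?_⟩
    obtain ⟨c, rfl⟩ := Submodule.mem_span_singleton.1 (by simpa using hv)
    rw [map_smul]
    exact congrArg (c • ·) hσ
  · rintro ⟨hx, hv⟩
    by_cases h0 : v = 0
    · obtain ⟨w, hw, hσ⟩ := h.exists_ne_zero hx
      exact ⟨Projectivization.mk 𝕜 w hw, (mk_mem_projSet hw).2 ⟨hx, hσ⟩, by
        change v ∈ _
        rw [h0]; exact zero_mem _⟩
    · exact ⟨Projectivization.mk 𝕜 v h0, (mk_mem_projSet h0).2 ⟨hx, hv⟩, by simp⟩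

/-- A linear isomorphism of `𝕜ᵉ` with the range at `y`, followed by the transport `N x`, gives the
frame. -/
theorem exists_frame (h : IsProjFamily V σ e) {y : Base u} (hy : y ∈ V) :
    ∃ W, IsOpen W ∧ y ∈ W ∧ W ⊆ V ∧ ∃ A : Base u → (Fib 𝕜 e →L[𝕜] Fib 𝕜 n),
      AnalyticOnNhd ℝ A W ∧ ∀ x ∈ W, Function.Injective (A x) ∧
        ∀ v, σ x v = v ↔ ∃ w, A x w = v := by
  obtain ⟨W, hWo, hyW, hWV, N, hN, -, hNx⟩ := h.transport y hy
  let R := LinearMap.range (σ y : Fib 𝕜 n →ₗ[𝕜] Fib 𝕜 n)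
  have hR : Module.finrank 𝕜 (Fib 𝕜 e) = Module.finrank 𝕜 R := by
    rw [show Module.finrank 𝕜 R = e from h.rk_eq y hy]; simp
  let φ : Fib 𝕜 e ≃ₗ[𝕜] R := LinearEquiv.ofFinrankEq _ _ hR
  let A₀ : Fib 𝕜 e →L[𝕜] Fib 𝕜 n := LinearMap.toContinuousLinearMap (R.subtype ∘ₗ φ.toLinearMap)
  have hA₀ : ∀ v, σ y v = v ↔ ∃ w, A₀ w = v := by
    intro v
    constructor
    · intro hv
      exact ⟨φ.symm ⟨v, v, hv⟩, by simp [A₀]⟩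
    · rintro ⟨w, rfl⟩
      obtain ⟨v, hv⟩ := (φ w).2
      change σ y (φ w) = φ w
      rw [← hv]
      exact h.idem y hy v
  refine ⟨W, hWo, hyW, hWV, fun x => (N x).comp A₀,
    fun x hx => analyticAt_comp_clm (hN x hx) analyticAt_const, fun x hx => ⟨?_, fun v => ?_⟩⟩
  · intro v w hvw
    have h1 : A₀ v = A₀ w := by
      rw [← (hNx x hx).1 (A₀ v), ← (hNx x hx).1 (A₀ w)]
      exact congrArg _ hvw
    exact φ.injective (Subtype.ext h1)
  · constructor
    · intro hv
      obtain ⟨w, hw⟩ := (hA₀ (star (N x) v)).1 (by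
        have := (hNx x hx).2.2 (star (N x) v)
        rw [(hNx x hx).2.1, hv] at this
        have h2 := congrArg (star (N x) : Fib 𝕜 n →L[𝕜] Fib 𝕜 n) this
        rw [(hNx x hx).1] at h2
        exact h2.symm)
      refine ⟨w, ?_⟩
      change N x (A₀ w) = v
      rw [hw, (hNx x hx).2.1]
    · rintro ⟨w, rfl⟩
      change σ x (N x (A₀ w)) = N x (A₀ w)
      rw [(hNx x hx).2.2, (hA₀ _).2 ⟨w, rfl⟩]

theorem isProjSubbundle (h : IsProjFamily V σ e) : IsProjSubbundle V (projSet V σ) e := by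
  refine ⟨fun p hp => hp.1, fun y hy => ?_⟩
  obtain ⟨W, hWo, hyW, hWV, A, hA, hAx⟩ := h.exists_frame hy
  refine ⟨W, hWo, hyW, hWV, A, hA, fun x hx => ⟨(hAx x hx).1, ?_⟩⟩
  ext l
  constructor
  · rintro ⟨-, v, hv, hσ, heq⟩
    obtain ⟨w, hw⟩ := ((hAx x hx).2 v).1 hσ
    have hw0 : w ≠ 0 := by rintro rfl; exact hv (by rw [← hw, map_zero])
    refine ⟨Projectivization.mk 𝕜 w hw0, ?_⟩
    rw [Projectivization.map_mk]
    change _ = l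
    rw [show l = Projectivization.mk 𝕜 v hv from heq]
    congr 1
  · rintro ⟨m, rfl⟩
    induction m using Projectivization.ind with
    | h w hw =>
      rw [Projectivization.map_mk]
      exact (mk_mem_projSet _).2 ⟨hWV hx, ((hAx x hx).2 _).2 ⟨w, rfl⟩⟩

theorem isVectorSubbundle (h : IsProjFamily V σ e) :
    IsVectorSubbundle V (cone (projSet V σ)) e := by
  refine ⟨fun p hp => ((h.mem_cone p.1 p.2).1 hp).1, fun y hy => ?_⟩
  obtain ⟨W, hWo, hyW, hWV, A, hA, hAx⟩ := h.exists_frame hy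
  refine ⟨W, hWo, hyW, hWV, fun i x => A x (EuclideanSpace.single i 1),
    fun i x hx => analyticAt_apply (hA x hx) analyticAt_const, fun x hx => ⟨?_, ?_⟩⟩
  · have h1 := (EuclideanSpace.basisFun (Fin e) 𝕜).toBasis.linearIndependent.map'
      (A x : Fib 𝕜 e →ₗ[𝕜] Fib 𝕜 n) (LinearMap.ker_eq_bot.2 (hAx x hx).1)
    have h2 : (fun i => A x (EuclideanSpace.single i (1 : 𝕜))) =
        (A x : Fib 𝕜 e →ₗ[𝕜] Fib 𝕜 n) ∘ (EuclideanSpace.basisFun (Fin e) 𝕜).toBasis := by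
      funext i
      simp
    rw [h2]
    exact h1
  · have h1 : Submodule.span 𝕜 (range fun i => A x (EuclideanSpace.single i (1 : 𝕜))) =
        LinearMap.range (A x : Fib 𝕜 e →ₗ[𝕜] Fib 𝕜 n) := by
      rw [LinearMap.range_eq_map, ← (EuclideanSpace.basisFun (Fin e) 𝕜).toBasis.span_eq,
        Submodule.map_span, ← range_comp]
      congr 2
      funext i
      simp
    ext v
    rw [h1]
    change (x, v) ∈ cone (projSet V σ) ↔ _
    rw [h.mem_cone, (hAx x hx).2]
    exact and_iff_right (hWV hx)

/-! ### Connectedness -/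

/-- If the lines of `v` and `w` differ, the real affine path from `v` to `w` avoids `0`, so it
projects to a path in the fibre, also when `𝕜 = ℝ`. -/
theorem isPreconnected_fibre {x : Base u} (hx : x ∈ V) {v w : Fib 𝕜 n} (hv : v ≠ 0) (hw : w ≠ 0)
    (hσv : σ x v = v) (hσw : σ x w = w) :
    ∃ t ⊆ projSet V σ, (x, Projectivization.mk 𝕜 v hv) ∈ t ∧ (x, Projectivization.mk 𝕜 w hw) ∈ t ∧
      IsPreconnected t := by
  by_cases hvw : Projectivization.mk 𝕜 v hv = Projectivization.mk 𝕜 w hw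
  · refine ⟨{(x, Projectivization.mk 𝕜 v hv)}, ?_, rfl, ?_, isPreconnected_singleton⟩
    · rintro _ rfl
      exact (mk_mem_projSet hv).2 ⟨hx, hσv⟩
    · rw [← hvw]; rfl
  have hne : ∀ t : ℝ, (1 - (t : 𝕜)) • v + (t : 𝕜) • w ≠ 0 := by
    intro t h0
    by_cases ht : (t : 𝕜) = 1
    · rw [ht, sub_self, zero_smul, zero_add, one_smul] at h0
      exact hw h0
    · refine hvw ((Projectivization.mk_eq_mk_iff' 𝕜 _ _ hv hw).2 ⟨-(t / (1 - t)), ?_⟩)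
      have h1 : (1 - (t : 𝕜)) ≠ 0 := sub_ne_zero.2 (Ne.symm ht)
      have h2 : (1 - (t : 𝕜)) • v = -((t : 𝕜) • w) := eq_neg_of_add_eq_zero_left h0
      rw [← smul_right_injective _ h1 |>.eq_iff]
      change (1 - (t : 𝕜)) • (-(t / (1 - t)) : 𝕜) • w = (1 - (t : 𝕜)) • v
      rw [h2, smul_smul, ← neg_smul]
      congr 1
      field_simp
  have hc : Continuous fun t : ℝ => (x, Projectivization.mk 𝕜 _ (hne t)) := by
    refine continuous_const.prodMk (continuous_mk ?_ hne)
    have := RCLike.continuous_ofReal (K := 𝕜)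
    fun_prop
  refine ⟨range fun t : ℝ => (x, Projectivization.mk 𝕜 _ (hne t)), ?_, ⟨0, ?_⟩, ⟨1, ?_⟩,
    isPreconnected_range hc⟩
  · rintro _ ⟨t, rfl⟩
    exact (mk_mem_projSet _).2 ⟨hx, by rw [map_add, map_smul, map_smul, hσv, hσw]⟩
  · simp
  · simp

/-- Over a ball, a line is carried by the transport from the fibre at the centre to any other fibre,
which is connected. Connectedness of `V` chains such steps. -/
theorem isPreconnected (h : IsProjFamily V σ e) (hV : IsPreconnected V) :
    IsPreconnected (projSet V σ) := by
  have htrans : ∀ {p q r : ProjTotal 𝕜 u n},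
      (∃ t ⊆ projSet V σ, p ∈ t ∧ q ∈ t ∧ IsPreconnected t) →
      (∃ t ⊆ projSet V σ, q ∈ t ∧ r ∈ t ∧ IsPreconnected t) →
      ∃ t ⊆ projSet V σ, p ∈ t ∧ r ∈ t ∧ IsPreconnected t := by
    rintro p q r ⟨t, ht, hp, hq, hc⟩ ⟨t', ht', hq', hr, hc'⟩
    exact ⟨t ∪ t', union_subset ht ht', Or.inl hp, Or.inr hr, hc.union q hq hq' hc'⟩
  refine isPreconnected_of_forall_pair fun p hp q hq => ?_
  refine hV.induction₂ (fun a b => ∀ p ∈ projSet V σ, ∀ q ∈ projSet V σ, p.1 = a → q.1 = b →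
    ∃ t ⊆ projSet V σ, p ∈ t ∧ q ∈ t ∧ IsPreconnected t) (fun y hy => ?_) ?_ ?_ hp.1 hq.1
    p hp q hq rfl rfl
  · obtain ⟨W, hWo, hyW, hWV, N, hN, hNy, hNx⟩ := h.transport y hy
    obtain ⟨ε, hε, hB⟩ := Metric.isOpen_iff.1 hWo y hyW
    filter_upwards [mem_nhdsWithin_of_mem_nhds (Metric.ball_mem_nhds y hε)] with x hx
    intro p hp q hq hpy hqx
    obtain ⟨-, v, hv, hσv, hpv⟩ := hp
    obtain ⟨-, w, hw, hσw, hqw⟩ := hq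
    obtain rfl : p = (y, Projectivization.mk 𝕜 v hv) := Prod.ext hpy hpv
    obtain rfl : q = (x, Projectivization.mk 𝕜 w hw) := Prod.ext hqx hqw
    have hne : ∀ z : Metric.ball y ε, N z v ≠ 0 := fun z h0 => hv (by
      rw [← (hNx z (hB z.2)).1 v, h0, map_zero])
    have hNσ : ∀ z ∈ W, σ z (N z v) = N z v := fun z hz => by
      rw [(hNx z hz).2.2]
      exact congrArg _ hσv
    have hc : Continuous fun z : Metric.ball y ε =>
        ((z : Base u), Projectivization.mk 𝕜 _ (hne z)) := by
      refine continuous_subtype_val.prodMk (continuous_mk ?_ hne)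
      have h1 : Continuous fun z : Metric.ball y ε => N z :=
        hN.continuousOn.comp_continuous continuous_subtype_val fun z => hB z.2
      exact h1.clm_apply continuous_const
    have hconn : PreconnectedSpace (Metric.ball y ε) :=
      isPreconnected_iff_preconnectedSpace.1 (convex_ball y ε).isPreconnected
    refine htrans ⟨range _, ?_, ⟨⟨y, Metric.mem_ball_self hε⟩, ?_⟩, ⟨⟨x, hx⟩, rfl⟩,
      isPreconnected_range hc⟩
      (isPreconnected_fibre (hWV (hB hx)) (hne ⟨x, hx⟩) hw (hNσ x (hB hx)) hσw)
    · rintro _ ⟨z, rfl⟩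
      exact (mk_mem_projSet _).2 ⟨hWV (hB z.2), hNσ z (hB z.2)⟩
    · simp [hNy]
  · rintro a b c ha hb hc hab hbc p hp q hq rfl rfl
    obtain ⟨v, hv, hσ⟩ := h.exists_ne_zero hb
    have hm : (b, Projectivization.mk 𝕜 v hv) ∈ projSet V σ := (mk_mem_projSet hv).2 ⟨hb, hσ⟩
    exact htrans (hab _ hp _ hm rfl rfl) (hbc _ hm _ hq rfl rfl)
  · intro a b _ _ hab p hp q hq ha hb
    obtain ⟨t, ht, h1, h2, h3⟩ := hab q hq p hp hb ha
    exact ⟨t, ht, h2, h1, h3⟩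

end IsProjFamily

end

end EigenBouquet

namespace EigenBouquet

noncomputable section

variable {𝕜 : Type*} [RCLike 𝕜] {u n : ℕ} {U : Set (Base u)} {L : OpFamily 𝕜 u n}

/-! ### Affine charts -/

/-- The vector with `k`-th coordinate `1` and the other coordinates `a`. -/
def chartLift (k : Fin n) (a : {j : Fin n // j ≠ k} → 𝕜) : Fib 𝕜 n :=
  WithLp.toLp 2 (fun j => if h : j = k then (1 : 𝕜) else a ⟨j, h⟩)

/-- The affine coordinates of the line spanned by `v`. -/
def chartProj (k : Fin n) (v : Fib 𝕜 n) : {j : Fin n // j ≠ k} → 𝕜 := fun j => v j / v k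

@[simp] theorem chartLift_self (k : Fin n) (a : {j : Fin n // j ≠ k} → 𝕜) :
    chartLift k a k = 1 := by simp [chartLift]

@[simp] theorem chartLift_of_ne (k : Fin n) (a : {j : Fin n // j ≠ k} → 𝕜) {j : Fin n}
    (h : j ≠ k) : chartLift k a j = a ⟨j, h⟩ := by simp [chartLift, h]

theorem chartLift_ne_zero (k : Fin n) (a : {j : Fin n // j ≠ k} → 𝕜) : chartLift k a ≠ 0 :=
  fun h0 => one_ne_zero (α := 𝕜) (by rw [← chartLift_self k a, h0]; rfl)

theorem chartProj_smul_chartLift (k : Fin n) {c : 𝕜} (hc : c ≠ 0)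
    (a : {j : Fin n // j ≠ k} → 𝕜) : chartProj k (c • chartLift k a) = a := by
  funext j
  simp [chartProj, j.2, hc]

theorem chartLift_chartProj (k : Fin n) {v : Fib 𝕜 n} (hv : v k ≠ 0) :
    chartLift k (chartProj k v) = (v k)⁻¹ • v := by
  ext j
  by_cases hj : j = k
  · subst hj
    simp [hv]
  · simp [hj, chartProj, div_eq_inv_mul]

/-- The difference of two lifts, as a linear map. -/
def chartDir (k : Fin n) : ({j : Fin n // j ≠ k} → 𝕜) →ₗ[𝕜] Fib 𝕜 n where
  toFun b := WithLp.toLp 2 (fun j => if h : j = k then (0 : 𝕜) else b ⟨j, h⟩)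
  map_add' a b := by
    ext j
    by_cases hj : j = k <;> simp [hj]
  map_smul' c b := by
    ext j
    by_cases hj : j = k <;> simp [hj]

theorem chartLift_add (k : Fin n) (a b : {j : Fin n // j ≠ k} → 𝕜) :
    chartLift k (a + b) = chartLift k a + chartDir k b := by
  ext j
  by_cases hj : j = k
  · subst hj; simp [chartDir]
  · simp [chartDir, hj]

theorem chartDir_injective (k : Fin n) :
    Function.Injective (chartDir k : ({j : Fin n // j ≠ k} → 𝕜) →ₗ[𝕜] Fib 𝕜 n) := by
  intro a b hab
  funext j
  have := congrArg (fun v : Fib 𝕜 n => v j) hab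
  simpa [chartDir, j.2] using this

theorem exists_chartDir_eq (k : Fin n) {v : Fib 𝕜 n} (hv : v k = 0) : ∃ b, chartDir k b = v := by
  refine ⟨fun j => v j, ?_⟩
  ext j
  by_cases hj : j = k
  · subst hj; simp [chartDir, hv]
  · simp [chartDir, hj]

section Analytic

variable {X : Type*} [NormedAddCommGroup X] [NormedSpace ℝ X]

theorem analyticAt_chartLift (k : Fin n) {f : X → {j : Fin n // j ≠ k} → 𝕜} {x : X}
    (hf : AnalyticAt ℝ f x) : AnalyticAt ℝ (fun x => chartLift k (f x)) x := by
  refine analyticAt_of_coord fun j => ?_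
  by_cases hj : j = k
  · subst hj
    simp only [chartLift_self]
    exact analyticAt_const
  · simp only [chartLift_of_ne k _ hj]
    exact (analyticAt_pi_iff.1 hf) ⟨j, hj⟩

theorem analyticAt_chartProj (k : Fin n) {f : X → Fib 𝕜 n} {x : X} (hf : AnalyticAt ℝ f x)
    (h0 : f x k ≠ 0) : AnalyticAt ℝ (fun x => chartProj k (f x)) x := by
  rw [analyticAt_pi_iff]
  intro j
  exact (analyticAt_coord hf j).div (analyticAt_coord hf k) h0

end Analytic

/-- The map of `ℝᵘ × ℙ(𝕜ⁿ)` given by a family of operators, in an affine chart. -/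
def chartMap (k : Fin n) (N : Base u → (Fib 𝕜 n →L[𝕜] Fib 𝕜 n))
    (p : Base u × ({j : Fin n // j ≠ k} → 𝕜)) : Base u × ({j : Fin n // j ≠ k} → 𝕜) :=
  (p.1, chartProj k (N p.1 (chartLift k p.2)))

/-- The domain of `chartMap`. -/
def chartDom (k : Fin n) (W : Set (Base u)) (N : Base u → (Fib 𝕜 n →L[𝕜] Fib 𝕜 n)) :
    Set (Base u × ({j : Fin n // j ≠ k} → 𝕜)) :=
  {p | p.1 ∈ W ∧ N p.1 (chartLift k p.2) k ≠ 0}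

theorem analyticOnNhd_apply_chartLift (k : Fin n) {W : Set (Base u)}
    {N : Base u → (Fib 𝕜 n →L[𝕜] Fib 𝕜 n)} (hN : AnalyticOnNhd ℝ N W)
    {p : Base u × ({j : Fin n // j ≠ k} → 𝕜)} (hp : p.1 ∈ W) :
    AnalyticAt ℝ (fun p : Base u × ({j : Fin n // j ≠ k} → 𝕜) => N p.1 (chartLift k p.2)) p :=
  analyticAt_apply (AnalyticAt.fun_comp (g := N) (hN p.1 hp) analyticAt_fst)
    (analyticAt_chartLift k analyticAt_snd)

theorem analyticOnNhd_chartMap (k : Fin n) {W : Set (Base u)}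
    {N : Base u → (Fib 𝕜 n →L[𝕜] Fib 𝕜 n)} (hN : AnalyticOnNhd ℝ N W) :
    AnalyticOnNhd ℝ (chartMap k N) (chartDom k W N) := fun _ hp =>
  analyticAt_fst.prod (analyticAt_chartProj k (analyticOnNhd_apply_chartLift k hN hp.1) hp.2)

theorem isOpen_chartDom (k : Fin n) {W : Set (Base u)} (hW : IsOpen W)
    {N : Base u → (Fib 𝕜 n →L[𝕜] Fib 𝕜 n)} (hN : AnalyticOnNhd ℝ N W) :
    IsOpen (chartDom k W N) := by
  rw [isOpen_iff_mem_nhds]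
  intro p hp
  have h1 := (analyticAt_coord (analyticOnNhd_apply_chartLift k hN hp.1) k).continuousAt
  filter_upwards [(hW.preimage continuous_fst).mem_nhds hp.1, h1.eventually_ne hp.2] with q h h'
  exact ⟨h, h'⟩

/-- Passing to affine coordinates and back only rescales a vector; `N'` respects the scalar and
`chartProj` forgets it. -/
theorem chartMap_mapsTo (k : Fin n) {W : Set (Base u)} {N N' : Base u → (Fib 𝕜 n →L[𝕜] Fib 𝕜 n)}
    (h : ∀ x ∈ W, ∀ v, N' x (N x v) = v) {p : Base u × ({j : Fin n // j ≠ k} → 𝕜)}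
    (hp : p ∈ chartDom k W N) :
    chartMap k N p ∈ chartDom k W N' ∧ chartMap k N' (chartMap k N p) = p := by
  have h1 : N' p.1 (chartLift k (chartProj k (N p.1 (chartLift k p.2)))) =
      (N p.1 (chartLift k p.2) k)⁻¹ • chartLift k p.2 := by
    rw [chartLift_chartProj k hp.2, map_smul, h _ hp.1]
  refine ⟨⟨hp.1, ?_⟩, Prod.ext rfl ?_⟩
  · change N' p.1 (chartLift k (chartProj k (N p.1 (chartLift k p.2)))) k ≠ 0
    rw [h1]
    simpa using hp.2
  · change chartProj k (N' p.1 (chartLift k (chartProj k (N p.1 (chartLift k p.2))))) = p.2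
    rw [h1, chartProj_smul_chartLift k (inv_ne_zero hp.2)]

/-- `chartMap` as a local homeomorphism. -/
def chartHomeomorph (k : Fin n) {W : Set (Base u)} (hW : IsOpen W)
    {N N' : Base u → (Fib 𝕜 n →L[𝕜] Fib 𝕜 n)} (hN : AnalyticOnNhd ℝ N W)
    (hN' : AnalyticOnNhd ℝ N' W) (h : ∀ x ∈ W, ∀ v, N' x (N x v) = v)
    (h' : ∀ x ∈ W, ∀ v, N x (N' x v) = v) :
    OpenPartialHomeomorph (Base u × ({j : Fin n // j ≠ k} → 𝕜))
      (Base u × ({j : Fin n // j ≠ k} → 𝕜)) where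
  toFun := chartMap k N
  invFun := chartMap k N'
  source := chartDom k W N
  target := chartDom k W N'
  map_source' _ hp := (chartMap_mapsTo k h hp).1
  map_target' _ hp := (chartMap_mapsTo k h' hp).1
  left_inv' _ hp := (chartMap_mapsTo k h hp).2
  right_inv' _ hp := (chartMap_mapsTo k h' hp).2
  open_source := isOpen_chartDom k hW hN
  open_target := isOpen_chartDom k hW hN'
  continuousOn_toFun := (analyticOnNhd_chartMap k hN).continuousOn
  continuousOn_invFun := (analyticOnNhd_chartMap k hN').continuousOn

/-! ### Submanifold and submersion properties in the affine charts -/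

namespace IsProjFamily

variable {V : Set (Base u)} {σ : Base u → (Fib 𝕜 n →L[𝕜] Fib 𝕜 n)} {e : ℕ}

theorem mem_chart_preimage (k : Fin n) (p : Base u × ({j : Fin n // j ≠ k} → 𝕜)) :
    p ∈ affineChart k ⁻¹' projSet V σ ↔ p.1 ∈ V ∧ σ p.1 (chartLift k p.2) = chartLift k p.2 :=
  mk_mem_projSet (chartLift_ne_zero k p.2)

/-- The kernel is identified with the vectors of the range of `σ x` whose `k`-th coordinate is `0`.
That coordinate is a non-zero functional on the range because of `v`, hence the loss of one
dimension. -/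
theorem finrank_chart (h : IsProjFamily V σ e) {x : Base u} (hx : x ∈ V) (k : Fin n)
    {v : Fib 𝕜 n} (hv : σ x v = v) (hvk : v k ≠ 0) :
    Module.finrank 𝕜 (LinearMap.ker (((σ x : Fib 𝕜 n →ₗ[𝕜] Fib 𝕜 n) - LinearMap.id).comp
      (chartDir k))) = e - 1 := by
  let R := LinearMap.range (σ x : Fib 𝕜 n →ₗ[𝕜] Fib 𝕜 n)
  let f : R →ₗ[𝕜] 𝕜 := ((EuclideanSpace.proj k : Fib 𝕜 n →L[𝕜] 𝕜) : Fib 𝕜 n →ₗ[𝕜] 𝕜) ∘ₗ R.subtype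
  have hR : ∀ w, w ∈ R ↔ σ x w = w := fun w =>
    ⟨by rintro ⟨z, rfl⟩; exact h.idem x hx z, fun hw => ⟨w, hw⟩⟩
  have hf : LinearMap.range f = ⊤ := by
    rw [LinearMap.range_eq_top]
    intro c
    refine ⟨(c / v k) • ⟨v, (hR v).2 hv⟩, ?_⟩
    change (c / v k) • v k = c
    rw [smul_eq_mul, div_mul_cancel₀ _ hvk]
  have h1 := LinearMap.finrank_range_add_finrank_ker f
  rw [hf, finrank_top, Module.finrank_self, show Module.finrank 𝕜 R = e from h.rk_eq x hx] at h1
  let K := LinearMap.ker (((σ x : Fib 𝕜 n →ₗ[𝕜] Fib 𝕜 n) - LinearMap.id).comp (chartDir k))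
  have hK : ∀ b, b ∈ K ↔ σ x (chartDir k b) = chartDir k b := fun b => by
    simp [K, sub_eq_zero]
  have h2 : K.map (chartDir k) = (LinearMap.ker f).map R.subtype := by
    ext w
    constructor
    · rintro ⟨b, hb, rfl⟩
      refine ⟨⟨chartDir k b, (hR _).2 ((hK b).1 hb)⟩, ?_, rfl⟩
      change chartDir k b k = 0
      simp [chartDir]
    · rintro ⟨⟨w, hw⟩, hwk, rfl⟩
      obtain ⟨b, rfl⟩ := exists_chartDir_eq k (v := w) hwk
      exact ⟨b, (hK b).2 ((hR _).1 hw), rfl⟩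
  have h3 := LinearEquiv.finrank_eq (Submodule.equivMapOfInjective _ (chartDir_injective k) K)
  have h4 := LinearEquiv.finrank_eq
    (Submodule.equivMapOfInjective _ R.injective_subtype (LinearMap.ker f))
  change Module.finrank 𝕜 K = _
  rw [h3, h2, ← h4]
  omega

/-- Applying `star (N x)` in the fibre over `x` straightens the bundle to a product with the fibre
over `p.1`, which in the chart is an affine subspace through `p.2`. -/
theorem isAnalyticSubmanifoldProj (h : IsProjFamily V σ e) :
    IsAnalyticSubmanifoldProj (projSet V σ) (u + Module.finrank ℝ 𝕜 * (e - 1)) := by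
  intro k p hp
  rw [mem_chart_preimage] at hp
  obtain ⟨hpV, hpσ⟩ := hp
  obtain ⟨W, hWo, hyW, hWV, N, hN, hNy, hNx⟩ := h.transport p.1 hpV
  have hN' : AnalyticOnNhd ℝ (fun x => star (N x)) W := fun x hx => analyticAt_star (hN x hx)
  let Φ₀ := chartHomeomorph k hWo hN' hN (fun x hx => (hNx x hx).2.1) (fun x hx => (hNx x hx).1)
  -- Translation by `p.2` makes the affine fibre linear; the base factor occurs in full and needs no
  -- shift.
  let c : Base u × ({j : Fin n // j ≠ k} → 𝕜) := (0, p.2)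
  let Φ := Φ₀.transHomeomorph (Homeomorph.subRight c)
  let K := LinearMap.ker (((σ p.1 : Fib 𝕜 n →ₗ[𝕜] Fib 𝕜 n) - LinearMap.id).comp (chartDir k))
  let T : (Base u × K.restrictScalars ℝ) →ₗ[ℝ] Base u × ({j : Fin n // j ≠ k} → 𝕜) :=
    LinearMap.prodMap LinearMap.id (K.restrictScalars ℝ).subtype
  have hTinj : Function.Injective T := by
    rintro ⟨a, b⟩ ⟨a', b'⟩ hab
    have hab' : (a, (b : {j : Fin n // j ≠ k} → 𝕜)) = (a', (b' : {j : Fin n // j ≠ k} → 𝕜)) := hab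
    exact Prod.ext (Prod.ext_iff.1 hab').1 (Subtype.ext (Prod.ext_iff.1 hab').2)
  refine ⟨Φ, ⟨hyW, ?_⟩, ?_, ?_, LinearMap.range T, ?_, ?_⟩
  · change (star (N p.1) (chartLift k p.2)) k ≠ 0
    rw [hNy, star_one]
    simp
  · exact fun q hq => (analyticOnNhd_chartMap k hN' q hq).sub analyticAt_const
  · intro q hq
    have h1 : q + c ∈ chartDom k W N := hq
    exact AnalyticAt.fun_comp (g := chartMap k N) (analyticOnNhd_chartMap k hN _ h1)
      (analyticAt_id.add analyticAt_const)
  · rw [LinearMap.finrank_range_of_inj hTinj, Module.finrank_prod]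
    congr 1
    · simp
    · rw [← h.finrank_chart hpV k hpσ (by simp)]
      exact (Module.finrank_mul_finrank ℝ 𝕜 K).symm
  · intro q hq
    have hqW : q.1 ∈ W := hq.1
    have hqk : (star (N q.1) (chartLift k q.2)) k ≠ 0 := hq.2
    have hmem : Φ q ∈ LinearMap.range T ↔
        chartProj k (star (N q.1) (chartLift k q.2)) - p.2 ∈ K := by
      constructor
      · rintro ⟨⟨a, b⟩, hab⟩
        have := congrArg Prod.snd hab
        change (b : {j : Fin n // j ≠ k} → 𝕜) = chartProj k _ - p.2 at this
        rw [← this]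
        exact b.2
      · intro hb
        exact ⟨(q.1, ⟨_, hb⟩), Prod.ext (sub_zero q.1).symm rfl⟩
    rw [hmem, mem_chart_preimage, and_iff_right (hWV hqW)]
    set b := chartProj k (star (N q.1) (chartLift k q.2)) - p.2 with hb
    have hK : b ∈ K ↔ σ p.1 (chartDir k b) = chartDir k b := by
      simp [K, sub_eq_zero]
    have e1 : chartDir k b =
        ((star (N q.1) (chartLift k q.2)) k)⁻¹ • star (N q.1) (chartLift k q.2) -
          chartLift k p.2 := by
      rw [← chartLift_chartProj k hqk, eq_sub_iff_add_eq', ← chartLift_add, hb,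
        add_sub_cancel]
    have e2 : ∀ v, σ p.1 (star (N q.1) v) = star (N q.1) (σ q.1 v) := by
      intro v
      have := (hNx q.1 hqW).2.2 (star (N q.1) v)
      rw [(hNx q.1 hqW).2.1] at this
      rw [this, (hNx q.1 hqW).1]
    rw [hK, e1, map_sub, hpσ, sub_left_inj, map_smul, e2]
    constructor
    · intro hq'
      rw [hq']
    · intro hq'
      have := smul_right_injective _ (inv_ne_zero hqk) hq'
      have h2 := congrArg (N q.1) this
      rwa [(hNx q.1 hqW).2.1, (hNx q.1 hqW).2.1] at h2

/-- The arc over `t ↦ p.1 + t ξ` obtained by transporting the line of `p` with `N` stays in the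
bundle and has velocity over `ξ`. -/
theorem isSubmersionToBase (h : IsProjFamily V σ e) : IsSubmersionToBase (projSet V σ) := by
  intro k p hp
  rw [mem_chart_preimage] at hp
  obtain ⟨hpV, hpσ⟩ := hp
  obtain ⟨W, hWo, hyW, hWV, N, hN, hNy, hNx⟩ := h.transport p.1 hpV
  refine eq_univ_of_forall fun ξ => ?_
  let γ₀ : ℝ → Base u × ({j : Fin n // j ≠ k} → 𝕜) := fun t => (p.1 + t • ξ, p.2)
  have hγ₀ : AnalyticAt ℝ γ₀ 0 :=
    (analyticAt_const.add (analyticAt_id.smul analyticAt_const)).prod analyticAt_const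
  have hγ₀0 : γ₀ 0 = p := by simp [γ₀]
  have hdom : p ∈ chartDom k W N := ⟨hyW, by rw [hNy]; simp⟩
  have hγ : AnalyticAt ℝ (fun t => chartMap k N (γ₀ t)) 0 := by
    refine AnalyticAt.fun_comp (g := chartMap k N) ?_ hγ₀
    rw [hγ₀0]
    exact analyticOnNhd_chartMap k hN p hdom
  refine ⟨_, ⟨fun t => chartMap k N (γ₀ t), hγ, ?_, ?_, hγ.differentiableAt.hasDerivAt⟩, ?_⟩
  · simp only [hγ₀0]
    refine Prod.ext rfl ?_
    change chartProj k (N p.1 (chartLift k p.2)) = p.2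
    rw [hNy, one_apply_eq_self, ← one_smul 𝕜 (chartLift k p.2)]
    exact chartProj_smul_chartLift k one_ne_zero _
  · have h1 : ∀ᶠ t in 𝓝 (0 : ℝ), γ₀ t ∈ chartDom k W N := by
      refine hγ₀.continuousAt.eventually ((isOpen_chartDom k hWo hN).mem_nhds ?_)
      rwa [hγ₀0]
    filter_upwards [h1] with t ht
    rw [mem_chart_preimage]
    refine ⟨hWV ht.1, ?_⟩
    change σ (γ₀ t).1 (chartLift k (chartProj k (N (γ₀ t).1 (chartLift k (γ₀ t).2)))) =
      chartLift k (chartProj k (N (γ₀ t).1 (chartLift k (γ₀ t).2)))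
    rw [chartLift_chartProj k ht.2, map_smul, (hNx _ ht.1).2.2]
    change _ • N (γ₀ t).1 (σ p.1 (chartLift k p.2)) = _
    rw [hpσ]
  · have h1 : HasDerivAt (fun t => (chartMap k N (γ₀ t)).1)
        (deriv (fun t => chartMap k N (γ₀ t)) 0).1 0 := by
      have h3 := (ContinuousLinearMap.fst ℝ (Base u)
        ({j : Fin n // j ≠ k} → 𝕜)).hasFDerivAt.comp_hasDerivAt 0
          hγ.differentiableAt.hasDerivAt
      exact h3
    have h2 : HasDerivAt (fun t : ℝ => p.1 + t • ξ) ξ 0 := by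
      simpa using ((hasDerivAt_id (0 : ℝ)).smul_const ξ).const_add p.1
    exact h1.unique h2

end IsProjFamily

end

end EigenBouquet

namespace EigenBouquet

noncomputable section

variable {𝕜 : Type*} [RCLike 𝕜] {u n : ℕ} {U : Set (Base u)} {L : OpFamily 𝕜 u n}

/-! ### The components of the reduced projective eigen-bouquet -/

theorem isOpen_proj_ne_zero {V : Set (Base u)} (hV : IsOpen V)
    {σ : Base u → (Fib 𝕜 n →L[𝕜] Fib 𝕜 n)} (hσ : ContinuousOn σ V) :
    IsOpen {p : ProjTotal 𝕜 u n | p.1 ∈ V ∧ ∃ (v : Fib 𝕜 n) (hv : v ≠ 0),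
      p.2 = Projectivization.mk 𝕜 v hv ∧ σ p.1 v ≠ 0} := by
  have hq : IsOpenMap (Prod.map (id : Base u → Base u)
      (fun v : {v : Fib 𝕜 n // v ≠ 0} => Projectivization.mk 𝕜 v.1 v.2)) :=
    IsOpenMap.id.prodMap (isOpenQuotientMap_mk 𝕜 n).isOpenMap
  have hO : IsOpen {p : Base u × {v : Fib 𝕜 n // v ≠ 0} | p.1 ∈ V ∧ σ p.1 p.2.1 ≠ 0} := by
    rw [isOpen_iff_mem_nhds]
    intro p hp
    have h1 : ContinuousAt (fun p : Base u × {v : Fib 𝕜 n // v ≠ 0} => σ p.1 p.2.1) p := by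
      refine ContinuousAt.clm_apply ?_ (continuous_subtype_val.comp continuous_snd).continuousAt
      exact ContinuousAt.comp (f := Prod.fst) (hσ.continuousAt (hV.mem_nhds hp.1))
        continuous_fst.continuousAt
    filter_upwards [(hV.preimage continuous_fst).mem_nhds hp.1, h1.eventually_ne hp.2] with q h h'
    exact ⟨h, h'⟩
  convert hq _ hO using 1
  ext ⟨x, l⟩
  constructor
  · rintro ⟨hx, v, hv, rfl, hne⟩
    exact ⟨(x, ⟨v, hv⟩), ⟨hx, hne⟩, rfl⟩
  · rintro ⟨⟨x', v⟩, ⟨hx, hne⟩, heq⟩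
    obtain ⟨rfl, rfl⟩ := Prod.ext_iff.1 heq
    exact ⟨hx, v.1, v.2, rfl, hne⟩

namespace IsGlobalBouquet

variable {s : ℕ} {V : Set (Base u)} {σ : Fin s → Base u → (Fib 𝕜 n →L[𝕜] Fib 𝕜 n)} {e : Fin s → ℕ}

theorem continuousOn (h : IsGlobalBouquet U L V σ e) (i : Fin s) : ContinuousOn (σ i) V := by
  intro y hy
  obtain ⟨W, hWo, hyW, hWV, T, hT, hTx⟩ := h.transport y hy
  have h1 : ContinuousAt (fun x => T x * σ i y * star (T x)) y := by
    have h2 := (hT y hyW).continuousAt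
    exact (h2.mul continuousAt_const).mul (analyticAt_star (hT y hyW)).continuousAt
  refine (h1.congr ?_).continuousWithinAt
  filter_upwards [hWo.mem_nhds hyW] with x hx
  rw [(hTx x hx).2.2 i, mul_assoc, (hTx x hx).2.1, mul_one]

theorem projEV'_eq (h : IsGlobalBouquet U L V σ e) :
    projEV' U L V = ⋃ i, projSet V (σ i) := by
  ext ⟨x, l⟩
  simp only [mem_iUnion]
  constructor
  · rintro ⟨hx, v, hv, hEV, rfl⟩
    obtain ⟨-, i, hi⟩ := ((h.bouquet x hx).mem_iff v).1 hEV
    exact ⟨i, hx, v, hv, hi, rfl⟩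
  · rintro ⟨i, hx, v, hv, hi, rfl⟩
    exact ⟨hx, v, hv, ((h.bouquet x hx).mem_iff v).2 ⟨hv, i, hi⟩, rfl⟩

theorem pairwise_disjoint (h : IsGlobalBouquet U L V σ e) :
    Pairwise fun i j => Disjoint (projSet V (σ i)) (projSet V (σ j)) := by
  intro i j hij
  rw [Set.disjoint_left]
  rintro ⟨x, l⟩ ⟨hx, v, hv, hi, rfl⟩ hj
  have hj' := ((mk_mem_projSet hv).1 hj).2
  refine hv ?_
  have := (h.bouquet x hx).res.apply_ne hij v
  rwa [hj', show σ i x v = v from hi] at this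

/-- Inside the reduced bouquet, the `j`-th bundle is cut out by the open condition `σ_j v ≠ 0`. The
bundles are therefore relatively open, disjoint and connected, hence are the components. -/
theorem connectedComponentIn_eq (h : IsGlobalBouquet U L V σ e) (hVo : IsOpen V)
    (hV : IsPreconnected V) (i : Fin s) {p : ProjTotal 𝕜 u n} (hp : p ∈ projSet V (σ i)) :
    connectedComponentIn (projEV' U L V) p = projSet V (σ i) := by
  have hsub : projSet V (σ i) ⊆ projEV' U L V := by
    rw [h.projEV'_eq]
    exact subset_iUnion (fun i => projSet V (σ i)) i
  refine subset_antisymm ?_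
    (((h.isProjFamily i).isPreconnected hV).subset_connectedComponentIn hp hsub)
  let O : Fin s → Set (ProjTotal 𝕜 u n) := fun j => {p | p.1 ∈ V ∧ ∃ (v : Fib 𝕜 n) (hv : v ≠ 0),
      p.2 = Projectivization.mk 𝕜 v hv ∧ σ j p.1 v ≠ 0}
  have hO : ∀ j, IsOpen (O j) := fun j => isOpen_proj_ne_zero hVo (h.continuousOn j)
  have hmem : ∀ q ∈ projEV' U L V, ∀ j, q ∈ O j ↔ q ∈ projSet V (σ j) := by
    rintro ⟨x, l⟩ ⟨hx, v, hv, hEV, rfl⟩ j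
    obtain ⟨-, k, hk⟩ := ((h.bouquet x hx).mem_iff v).1 hEV
    rw [mk_mem_projSet hv]
    refine and_congr_right fun _ => ⟨?_, fun hj => ⟨v, hv, rfl, ?_⟩⟩
    · rintro ⟨w, hw, heq, hne⟩
      obtain ⟨c, rfl⟩ := (Projectivization.mk_eq_mk_iff' 𝕜 _ _ hv hw).1 heq
      by_cases hjk : j = k
      · rw [hjk]; exact hk
      · exfalso
        have h1 := (h.bouquet x hx).res.apply_ne hjk (c • w)
        rw [show σ k x (c • w) = c • w from hk, map_smul] at h1
        refine hne ((smul_eq_zero.1 h1).resolve_left ?_)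
        rintro rfl
        exact hv (zero_smul _ _)
    · change σ j x v ≠ 0
      rw [hj]; exact hv
  have hC := isPreconnected_connectedComponentIn (x := p) (F := projEV' U L V)
  have hCs : connectedComponentIn (projEV' U L V) p ⊆ projEV' U L V :=
    connectedComponentIn_subset _ _
  have hpC : p ∈ connectedComponentIn (projEV' U L V) p := mem_connectedComponentIn (hsub hp)
  have hcover : connectedComponentIn (projEV' U L V) p ⊆ O i ∪ ⋃ j ∈ {j | j ≠ i}, O j := by
    intro q hq
    have h2 := hCs hq
    rw [h.projEV'_eq] at h2
    obtain ⟨j, hj⟩ := mem_iUnion.1 h2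
    have h3 := (hmem q (hCs hq) j).2 hj
    by_cases hji : j = i
    · exact Or.inl (hji ▸ h3)
    · exact Or.inr (mem_iUnion₂.2 ⟨j, hji, h3⟩)
  have hdisj : connectedComponentIn (projEV' U L V) p ∩ (O i ∩ ⋃ j ∈ {j | j ≠ i}, O j) = ∅ := by
    refine eq_empty_of_forall_notMem fun q hq => ?_
    obtain ⟨hqC, hqi, hq2⟩ := hq
    obtain ⟨j, hj, hqj⟩ := mem_iUnion₂.1 hq2
    exact Set.disjoint_left.1 (h.pairwise_disjoint hj) ((hmem q (hCs hqC) j).1 hqj)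
      ((hmem q (hCs hqC) i).1 hqi)
  rcases isPreconnected_iff_subset_of_disjoint.1 hC (O i) _ (hO i)
    (isOpen_biUnion fun j _ => hO j) hcover hdisj with h1 | h1
  · exact fun q hq => (hmem q (hCs hq) i).1 (h1 hq)
  · obtain ⟨j, hj, hpj⟩ := mem_iUnion₂.1 (h1 hpC)
    exact (Set.disjoint_left.1 (h.pairwise_disjoint hj) ((hmem p (hsub hp) j).1 hpj) hp).elim

theorem isConnected (h : IsGlobalBouquet U L V σ e) (hV : IsConnected V) (i : Fin s) :
    IsConnected (projSet V (σ i)) := by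
  refine ⟨?_, (h.isProjFamily i).isPreconnected hV.isPreconnected⟩
  obtain ⟨x, hx⟩ := hV.nonempty
  obtain ⟨v, hv, hσ⟩ := (h.isProjFamily i).exists_ne_zero hx
  exact ⟨_, (mk_mem_projSet hv).2 ⟨hx, hσ⟩⟩

theorem inner_eq_zero (h : IsGlobalBouquet U L V σ e) {i j : Fin s} (hij : i ≠ j) (x : Base u)
    (v w : Fib 𝕜 n) (hv : (x, v) ∈ cone (projSet V (σ i))) (hw : (x, w) ∈ cone (projSet V (σ j))) :
    inner 𝕜 v w = 0 := by
  obtain ⟨hx, hv⟩ := ((h.isProjFamily i).mem_cone x v).1 hv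
  obtain ⟨-, hw⟩ := ((h.isProjFamily j).mem_cone x w).1 hw
  rw [← hv, ← hw]
  exact (h.bouquet x hx).res.inner_eq_zero hij v w

theorem exists_eigenvalue (h : IsGlobalBouquet U L V σ e) (hs : ∀ x ∈ V, x ∉ discLocus U L →
    numEig L x = s) (i : Fin s) {x : Base u} (hx : x ∈ V) :
    ∃ μ : 𝕜, (∀ v, (x, v) ∈ cone (projSet V (σ i)) → v ∈ (endo L x).eigenspace μ) ∧
      (x ∉ discLocus U L → ∀ v ∈ (endo L x).eigenspace μ, (x, v) ∈ cone (projSet V (σ i))) := by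
  obtain ⟨lam, hlam⟩ := (h.bouquet x hx).eig
  refine ⟨lam i, fun v hv => ?_, fun hd v hv => ?_⟩
  · exact Module.End.mem_eigenspace_iff.2
      (apply_of_mem hlam (i := i) (((h.isProjFamily i).mem_cone x v).1 hv).2)
  · have hinj := injective_of_ncard (h.bouquet x hx).res hlam (hs x hx hd)
    exact ((h.isProjFamily i).mem_cone x v).2 ⟨hx,
      (mem_eigenspace_iff_of_injective (h.bouquet x hx).res hlam hinj i v).1 hv⟩

end IsGlobalBouquet

end

end EigenBouquet

/-! ### The main theorem -/

open EigenBouquet in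
theorem mainTheorem6 {𝕜 : Type*} [RCLike 𝕜] (u n : ℕ)
    (U : Set (Base u)) (hUo : IsOpen U) (hUc : IsConnected U)
    (L : OpFamily 𝕜 u n) (hL : AnalyticOnNhd ℝ L U)
    (h0 : ∀ x ∈ U, IsStarNormal (L x) ∧ ((RCLike.I : 𝕜) = 0 → IsSelfAdjoint (L x)))
    (hI : ¬ ∀ x ∈ U, ∃ c : 𝕜, L x = c • ContinuousLinearMap.id 𝕜 (Fib 𝕜 n))
    (hII : ∀ y ∈ U, (fittingStalk U L y).IsPrincipal) :
    (∃ e : Fin (sMax U L) → ℕ, Monotone e ∧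
      (∀ x ∈ U \ discLocus U L, HasEigDims L x e) ∧
      ∀ V : Set (Base u), V ⊆ U → IsOpen V → SimplyConnectedSpace V →
        ∃ Z : Fin (sMax U L) → Set (ProjTotal 𝕜 u n),
          projEV' U L V = ⋃ i, Z i ∧
          Pairwise (fun i j => Disjoint (Z i) (Z j)) ∧
          (∀ i, ∀ p ∈ Z i, connectedComponentIn (projEV' U L V) p = Z i) ∧
          (∀ i, IsConnected (Z i) ∧
            IsAnalyticSubmanifoldProj (Z i) (u + Module.finrank ℝ 𝕜 * (e i - 1)) ∧
            IsSubmersionToBase (Z i) ∧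
            IsProjSubbundle V (Z i) (e i) ∧
            IsVectorSubbundle V (cone (Z i)) (e i)) ∧
          (∀ i j, i ≠ j → ∀ x v w, (x, v) ∈ cone (Z i) → (x, w) ∈ cone (Z j) →
            inner 𝕜 v w = 0) ∧
          (∀ i, ∀ x ∈ V, ∃ μ : 𝕜,
            (∀ v, (x, v) ∈ cone (Z i) → v ∈ (endo L x).eigenspace μ) ∧
            (x ∉ discLocus U L → ∀ v ∈ (endo L x).eigenspace μ, (x, v) ∈ cone (Z i)))) ∧
    (∀ y ∈ U, ∃ W : Set (Base u), IsOpen W ∧ y ∈ W ∧ W ⊆ U ∧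
      ∃ b : Fin n → Base u → Fib 𝕜 n, (∀ i, AnalyticOnNhd ℝ (b i) W) ∧
        ∀ x ∈ W, Orthonormal 𝕜 (fun i => b i x) ∧
          ∀ i, ∃ μ : 𝕜, (endo L x).HasEigenvector μ (b i x)) ∧
    (∀ y ∈ U, ∃ W : Set (Base u), IsOpen W ∧ y ∈ W ∧ W ⊆ U ∧
      ∃ lam : Fin n → Base u → 𝕜, (∀ i, AnalyticOnNhd ℝ (lam i) W) ∧
        ∀ x ∈ W, (endo L x).charpoly = ∏ i, (Polynomial.X - Polynomial.C (lam i x))) := by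
  have hN : IsNormalFamily U L := h0
  have hT : HasTrivializations U L (sMax U L) := fun y hy =>
    hN.exists_trivialization hUo hUc.isPreconnected hL hy (hII y hy)
  refine ⟨?_, fun y hy => ?_, fun y hy => ?_⟩
  · obtain ⟨e, hmono, he⟩ := hT.exists_ranks hUc
    refine ⟨e, hmono, fun x hx => (he x hx.1).hasEigDims (hN.numEig_eq hx.1 hx.2),
      fun V hV hVo hVs => ?_⟩
    have hVc : IsConnected V := isConnected_iff_connectedSpace.2 inferInstance
    obtain ⟨σ, hσ⟩ := hT.exists_globalBouquet hV hVo he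
    exact ⟨fun i => projSet V (σ i), hσ.projEV'_eq, hσ.pairwise_disjoint,
      fun i p hp => hσ.connectedComponentIn_eq hVo hVc.isPreconnected i hp,
      fun i => ⟨hσ.isConnected hVc i, (hσ.isProjFamily i).isAnalyticSubmanifoldProj,
        (hσ.isProjFamily i).isSubmersionToBase, (hσ.isProjFamily i).isProjSubbundle,
        (hσ.isProjFamily i).isVectorSubbundle⟩,
      fun i j hij x v w => hσ.inner_eq_zero hij x v w,
      fun i x hx => hσ.exists_eigenvalue (fun x hx hd => hN.numEig_eq (hV hx) hd) i hx⟩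
  · obtain ⟨W, S, T, hW⟩ := hT y hy
    exact ⟨W, hW.isOpen, hW.mem, hW.subset, hW.exists_eigenbasis⟩
  · obtain ⟨W, S, T, hW⟩ := hT y hy
    obtain ⟨b, hb, hbx⟩ := hW.exists_eigenbasis
    exact ⟨W, hW.isOpen, hW.mem, hW.subset, exists_analytic_eigenvalues (hL.mono hW.subset) hb hbx⟩
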